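/- Let $\Omega=\{0,1\}^{\mathbb Z}$ and let $\eta^x$ denote $\eta\in\Omega$ with the state at $x$ flipped. Let $\xi=(\xi_t)_{t\ge0}$ be a spin-flip system on $\Omega$, i.e. the Feller process with càdlàg paths in which, in configuration $\eta$, the spin at $x$ flips at rate $c(x,\eta)\ge 0$, where $c(x,\cdot)$ is continuous, $c$ is shift-invariant, and $M<\infty$, with $$M=\sum_{x\ne0}\sup_{\eta}|c(0,\eta)-c(0,\eta^x)|,\qquad \epsilon=\inf_{\eta}\,[c(0,\eta)+c(0,\eta^0)].$$ Write $P_\eta$ for its law started from $\eta$ and $P^\mu=\int P_\eta\,\mu(d\eta)$. Let $\widehat P_{\eta,\eta'}$ be the law of the basic (Vasershtein) coupling $(\xi,\xi')$ of two copies started from $\eta,\eta'$ (at each site, spins that differ flip independently at their own rates; spins that agree flip together at the minimum of the two rates, and each flips alone at its remaining rate), and put $$\rho(t)=\sup_{\eta,\eta'}\widehat P_{\eta,\eta'}\big(\exists\,s\ge t:\ \xi_s(0)\ne\xi'_s(0)\big),\qquad t\ge0.$$ For $\theta\in(0,\frac{\pi}{2})$ let $C_t^\theta\subset\mathbb Z\times[0,\infty)$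 be the cone with tip $(0,t)$ opening in the time direction with angle $\theta$ on either side, i.e. $C^\theta_t=\{(x,s): s-t\ge \sqrt{x^2+(s-t)^2}\,\cos\theta\}$. Let $\mathcal F_0=\sigma\{\xi_0(x):x\in\mathbb Z\}$, $\mathcal F_t^\theta=\sigma\{\xi_s(x):(x,s)\in C_t^\theta\}$, and $$\Phi_\mu^\theta(t)=\sup_{A\in\mathcal F_0,\ B\in\mathcal F_t^\theta,\ P^\mu(A)>0}|P^\mu(B\mid A)-P^\mu(B)| .$$ $P^\mu$ is called cone-mixing if $\lim_{t\to\infty}\Phi_\mu^\theta(t)=0$ for every $\theta\in(0,\frac{\pi}{2})$. Then the following hold. 1. For all $\theta\in(0,\frac{\pi}{2})$, with $c=\cot\theta$, and all $t\ge0$: for all $B\in\mathcal F_t^\theta$ and $\eta,\eta'\in\Omega$, $$|P_\eta(B)-P_{\eta'}(B)|\le\rho(t)+\frac2c\int_0^\infty\rho(t+v)\,dv,$$ and for every probability measure $\mu$ on $\Omega$, $$\Phi^\theta_\mu(t)\le\rho(t)+\frac2c\int_0^\infty\rho(t+v)\,dv .$$ 2. If $\int_0^\infty\rho(v)\,dv<\infty$,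 then $P^\mu$ is cone-mixing for every probability measure $\mu$ on $\Omega$. 3. If $M<\epsilon$, then for all $t\ge0$, $x\in\mathbb Z$ and $\eta,\eta'\in\Omega$, $$\widehat P_{\eta,\eta'}\big(\xi_t(x)\ne\xi'_t(x)\big)\le e^{-(\epsilon-M)t},\qquad \rho(t)\le\frac{\epsilon}{\epsilon-M}\,e^{-(\epsilon-M)t}.$$ 4. If $M<\epsilon$, then $P^\mu$ is cone-mixing for every probability measure $\mu$ on $\Omega$. -/

import Mathlib

open MeasureTheory ProbabilityTheory Filter Topology Set
open scoped ENNReal NNReal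

noncomputable section

/-! ### Configurations and càdlàg paths -/

/-- Spin configurations on `ℤ`, i.e. `{0,1}^ℤ`, with the product topology and `σ`-algebra. -/
abbrev Config : Type := ℤ → Bool

/-- The configuration obtained from `η` by changing the state at the site `x`. -/
def flipAt (η : Config) (x : ℤ) : Config := Function.update η x (!(η x))

/-- The spatial shift over `y`. -/
def shiftConfig (y : ℤ) (η : Config) : Config := fun x => η (x - y)

/-- Right-continuous with left limits. -/
def IsCadlag {E : Type} [TopologicalSpace E] (ω : ℝ≥0 → E) : Prop :=
  ∀ t, ContinuousWithinAt ω (Ici t) t ∧ ∃ l, Tendsto ω (𝓝[<] t) (𝓝 l)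

/-- The path space `D_E[0,∞)`, with the `σ`-algebra generated by the time evaluations. -/
abbrev CadlagPath (E : Type) [TopologicalSpace E] : Type := {ω : ℝ≥0 → E // IsCadlag ω}

/-! ### Feller processes and their generators -/

/-- The past up to time `s`: the `σ`-algebra on path space generated by the evaluations at times
at most `s`. -/
abbrev pastSigma (E : Type) [TopologicalSpace E] [MeasurableSpace E] (s : ℝ≥0) :
    MeasurableSpace (CadlagPath E) :=
  ⨆ r : Iic s, MeasurableSpace.comap (fun ω : CadlagPath E => ω.1 r) inferInstance

/-- The family of path laws `x ↦ P x` is a Feller process with state space `E`. -/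
structure IsFellerProcess {E : Type} [TopologicalSpace E] [MeasurableSpace E]
    (P : Kernel E (CadlagPath E)) : Prop where
  prob : ∀ x, IsProbabilityMeasure (P x)
  start : ∀ x, ∀ᵐ ω ∂(P x), ω.1 0 = x
  /-- The Markov property at time `s`. -/
  markov : ∀ (x : E) (s t : ℝ≥0) (B : Set (CadlagPath E)) (C : Set E),
    MeasurableSet[pastSigma E s] B → MeasurableSet C →
    P x (B ∩ {ω | ω.1 (s + t) ∈ C}) = ∫⁻ ω in B, P (ω.1 s) {ω' | ω'.1 t ∈ C} ∂(P x)
  /-- The transition semigroup maps continuous functions to continuous functions. -/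
  feller : ∀ (f : C(E, ℝ)) (t : ℝ≥0), Continuous fun x => ∫ ω, f (ω.1 t) ∂(P x)

/-- The generator of the process `P`, evaluated at `f`, is `g`: the difference quotients
`(S(t) f - f) / t` of the transition semigroup converge to `g` uniformly as `t ↓ 0`. -/
def HasGeneratorAt {E : Type} [TopologicalSpace E] [MeasurableSpace E]
    (P : Kernel E (CadlagPath E)) (f g : E → ℝ) : Prop :=
  TendstoUniformly (fun (t : ℝ≥0) (x : E) => (∫ ω, f (ω.1 t) ∂(P x) - f x) / t) g (𝓝[>] 0)

/-! ### Spin-flip systems -/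

/-- `γ(u,v)`: the maximal dependence of the flip rate at `u` on the spin at `v`. -/
def gammaRate (c : ℤ → Config → ℝ) (u v : ℤ) : ℝ := ⨆ η : Config, |c u η - c u (flipAt η v)|

/-- `M`. -/
def rateM (c : ℤ → Config → ℝ) : ℝ := ∑' x : {x : ℤ // x ≠ 0}, gammaRate c 0 x

/-- `ε`. -/
def rateEps (c : ℤ → Config → ℝ) : ℝ := ⨅ η : Config, (c 0 η + c 0 (flipAt η 0))

/-- `c x η` is the rate to flip the spin at `x` in the configuration `η`: the rates are nonnegative,
continuous in the configuration and shift-invariant, and `M < ∞`. -/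
structure IsSpinFlipRate (c : ℤ → Config → ℝ) : Prop where
  nonneg : ∀ x η, 0 ≤ c x η
  continuous : ∀ x, Continuous (c x)
  shift_invariant : ∀ x y η, c (x + y) (shiftConfig y η) = c x η
  summable : Summable fun x : {x : ℤ // x ≠ 0} => gammaRate c 0 x

/-- Functions of finitely many coordinates of a configuration. -/
def IsCylinder (f : Config → ℝ) : Prop :=
  ∃ Λ : Finset ℤ, ∀ η η' : Config, (∀ x ∈ Λ, η x = η' x) → f η = f η'

/-- The spin-flip generator on cylinder functions (for which the sum has finitely many
nonzero terms). -/
def spinFlipGen (c : ℤ → Config → ℝ) (f : Config → ℝ) (η : Config) : ℝ :=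
  ∑' x : ℤ, c x η * (f (flipAt η x) - f η)

/-- `P` is the spin-flip system with rates `c`; `P η` is its law on path space started
from `η`. -/
structure IsSpinFlipSystem (c : ℤ → Config → ℝ) (P : Kernel Config (CadlagPath Config)) :
    Prop where
  feller : IsFellerProcess P
  generator : ∀ f, IsCylinder f → HasGeneratorAt P f (spinFlipGen c f)

/-! ### The basic coupling -/

/-- Functions of finitely many coordinates of a pair of configurations. -/
def IsPairCylinder (f : Config × Config → ℝ) : Prop :=
  ∃ Λ : Finset ℤ, ∀ p q : Config × Config,
    (∀ x ∈ Λ, p.1 x = q.1 x ∧ p.2 x = q.2 x) → f p = f q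

/-- The contribution of the site `x` to the generator of the basic (Vasershtein) coupling:
spins that differ flip independently of each other, and spins that agree flip together at the
largest possible rate. -/
def basicCouplingGenAt (c : ℤ → Config → ℝ) (f : Config × Config → ℝ) (x : ℤ)
    (p : Config × Config) : ℝ :=
  if p.1 x = p.2 x then
    min (c x p.1) (c x p.2) * (f (flipAt p.1 x, flipAt p.2 x) - f p)
      + (c x p.1 - min (c x p.1) (c x p.2)) * (f (flipAt p.1 x, p.2) - f p)
      + (c x p.2 - min (c x p.1) (c x p.2)) * (f (p.1, flipAt p.2 x) - f p)
  else
    c x p.1 * (f (flipAt p.1 x, p.2) - f p) + c x p.2 * (f (p.1, flipAt p.2 x) - f p)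

/-- The generator of the basic coupling on cylinder functions. -/
def basicCouplingGen (c : ℤ → Config → ℝ) (f : Config × Config → ℝ) (p : Config × Config) : ℝ :=
  ∑' x : ℤ, basicCouplingGenAt c f x p

/-- `Q` is the basic coupling of two copies of the spin-flip system with rates `c`;
`Q (η, η')` is its law started from the pair `(η, η')`. -/
structure IsBasicCoupling (c : ℤ → Config → ℝ)
    (Q : Kernel (Config × Config) (CadlagPath (Config × Config))) : Prop where
  feller : IsFellerProcess Q
  generator : ∀ f, IsPairCylinder f → HasGeneratorAt Q f (basicCouplingGen c f)

/-- `ρ(t)`: the worst-case probability that the two copies disagree at the origin at some time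
`s ≥ t`. -/
def rhoDisagree (Q : Kernel (Config × Config) (CadlagPath (Config × Config))) (t : ℝ≥0) : ℝ≥0∞ :=
  ⨆ p : Config × Config, Q p {ω | ∃ s, t ≤ s ∧ (ω.1 s).1 0 ≠ (ω.1 s).2 0}

/-! ### Cone-mixing -/

/-- The space-time point `(x, s) ∈ ℤ × [0,∞)` as a vector in the Euclidean plane. -/
def spaceTime (u : ℤ × ℝ≥0) : EuclideanSpace ℝ (Fin 2) := !₂[(u.1 : ℝ), (u.2 : ℝ)]

/-- The unit vector `ℓ` in the time direction. -/
def timeDir : EuclideanSpace ℝ (Fin 2) := !₂[(0 : ℝ), (1 : ℝ)]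

/-- The cone with tip `(0,t)` and angle `θ` on either side of the time direction. -/
def spaceTimeCone (θ : ℝ) (t : ℝ≥0) : Set (ℤ × ℝ≥0) :=
  {u | ‖spaceTime u - (t : ℝ) • timeDir‖ * Real.cos θ ≤
    inner ℝ (spaceTime u - (t : ℝ) • timeDir) timeDir}

/-- The `σ`-algebra generated by the configuration at time `0`. -/
abbrev sigmaZero : MeasurableSpace (CadlagPath Config) :=
  ⨆ x : ℤ, MeasurableSpace.comap (fun ω : CadlagPath Config => ω.1 0 x) inferInstance

/-- The `σ`-algebra generated by the spins in the cone. -/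
abbrev sigmaCone (θ : ℝ) (t : ℝ≥0) : MeasurableSpace (CadlagPath Config) :=
  ⨆ u : spaceTimeCone θ t,
    MeasurableSpace.comap (fun ω : CadlagPath Config => ω.1 u.1.2 u.1.1) inferInstance

/-- The cone-mixing coefficient of a law `R` on path space. -/
def coneMixingCoeff (R : Measure (CadlagPath Config)) (θ : ℝ) (t : ℝ≥0) : ℝ≥0∞ :=
  ⨆ (A : Set (CadlagPath Config)) (B : Set (CadlagPath Config))
    (_ : MeasurableSet[sigmaZero] A) (_ : MeasurableSet[sigmaCone θ t] B) (_ : 0 < R A),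
    ENNReal.ofReal |(R[|A]).real B - R.real B|

/-- Cone-mixing: the cone-mixing coefficient vanishes as `t → ∞`, for every cone angle. -/
def IsConeMixing (R : Measure (CadlagPath Config)) : Prop :=
  ∀ θ ∈ Ioo 0 (Real.pi / 2), Tendsto (coneMixingCoeff R θ) atTop (𝓝 0)

end

/-! A spin-flip system and a basic coupling are given only as Feller processes whose generators are
prescribed on cylinder functions. That the coupling has marginals $P_\eta$ and $P_{\eta'}$ and is
invariant under spatial shifts must therefore be deduced from uniqueness: the generator determines
the process. Uniqueness comes from an explicit approximation. In a finite set Λ, with the rates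
frozen outside Λ, iterated Euler steps `f ↦ f + h * (generator of f)` converge to the semigroup
(`HasJumpRate.eventually_abs_transOp_sub_le`). The iterates depend only on the rates, so two
processes with the same rates have the same one-time laws (`HasJumpRate.map_eval_eq`), hence by the
Markov property the same path laws (`IsFellerProcess.map_mapPath`).

What controls the scheme is the oscillation of a function at each site. Suppose these oscillations
are bounded by a weight `a` for which the influence matrix satisfies `Σ_x g x u * a x ≤ lam * a u`.
Then one Euler step multiplies the bound by `1 - h * (κ - lam)`, where κ is the rate at which a
discrepancy disappears at its own site. A summable `a` also makes the total freezing error small.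
Such weights exist for every `lam` above the total influence, as a Neumann series
(`exists_supersolution`).

Statement 1. In the coupling, an event in the cone can distinguish the copies only if they disagree
at some site x at or after the time $t+|x|\cot\theta$ at which x enters the cone. By shift
invariance this costs at most $\sum_x\rho(t+|x|\cot\theta)$, and monotonicity of ρ turns the sum
into the integral. Conditioning on the time-zero configuration only changes the initial law, so the
bound for pairs of initial states passes to the mixing coefficient. Statement 2 is dominated
convergence in this bound.

Statement 3. Let $u_x(t)$ be the probability of a discrepancy at x at time t. The coupling generator
gives $u_x'\le\sum_y\gamma(0,y-x)\,u_y-\epsilon u_x$, the sum being over y ≠ x, and an iterated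
comparison yields $u_x\le e^{-(\epsilon-M)t}$. A disagreement at the origin after time t is either
present at time t or created later. Creation has rate at most $Me^{-(\epsilon-M)s}$ at time s, and
integration gives $1+M/(\epsilon-M)=\epsilon/(\epsilon-M)$.

Statement 4 supposes no coupling, so it is proved from the semigroup alone. When $M<\epsilon$, pick
`lam` strictly between; the semigroup then contracts weighted oscillations at rate `ε - lam`
(`HasJumpRate.oscLe_transOp`). Conditioning successively at the observation times shows that
finitely many observations in the cone depend on the initial state by at most $Ce^{-dt}$
(`IsSpinFlipSystem.oscLe_integral_spins`), and cylinder events approximate all cone events. -/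

/-! ### Oscillations of functions of a configuration -/

section Oscillation

variable {A : Type}

/-- Changing the configuration at the site `u` changes `f` by at most `a u`. -/
def OscLe (f : (ℤ → A) → ℝ) (a : ℤ → ℝ) : Prop :=
  ∀ (u : ℤ) (η ζ : ℤ → A), (∀ x, x ≠ u → η x = ζ x) → |f η - f ζ| ≤ a u

/-- The configuration which agrees with `η` on `Λ` and is constant outside `Λ`. -/
def freeze (a₀ : A) (Λ : Finset ℤ) (η : ℤ → A) : ℤ → A := fun x => if x ∈ Λ then η x else a₀

lemma OscLe.mono {f : (ℤ → A) → ℝ} {a b : ℤ → ℝ} (hf : OscLe f a) (hab : ∀ u, a u ≤ b u) :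
    OscLe f b := fun u η ζ h => (hf u η ζ h).trans (hab u)

lemma OscLe.freeze_comp {f : (ℤ → A) → ℝ} {a : ℤ → ℝ} (hf : OscLe f a) (a₀ : A)
    (Λ : Finset ℤ) : OscLe (fun η => f (freeze a₀ Λ η)) a := fun u η ζ h =>
  hf u _ _ fun x hx => by simp only [freeze, h x hx]

lemma dependsOn_freeze {B : Type} (f : (ℤ → A) → B) (a₀ : A) (Λ : Finset ℤ) :
    DependsOn (fun η => f (freeze a₀ Λ η)) (Λ : Set ℤ) := by
  intro η ζ h
  have : freeze a₀ Λ η = freeze a₀ Λ ζ := by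
    funext x
    by_cases hx : x ∈ Λ
    · simp [freeze, hx, h x hx]
    · simp [freeze, hx]
  simp only [this]

/-- The configuration equal to `ζ` on `Λ` and to `η` elsewhere. -/
def splice (Λ : Finset ℤ) (ζ η : ℤ → A) : ℤ → A := fun x => if x ∈ Λ then ζ x else η x

lemma OscLe.abs_sub_splice_le [DecidableEq A] {f : (ℤ → A) → ℝ} {a : ℤ → ℝ} (hf : OscLe f a)
    (η ζ : ℤ → A) (Λ : Finset ℤ) :
    |f η - f (splice Λ ζ η)| ≤ ∑ y ∈ Λ, if η y ≠ ζ y then a y else 0 := by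
  induction Λ using Finset.induction_on with
  | empty =>
    have : splice ∅ ζ η = η := by funext x; simp [splice]
    simp [this]
  | insert y Λ hy ih =>
    rw [Finset.sum_insert hy]
    have h1 : |f (splice Λ ζ η) - f (splice (insert y Λ) ζ η)| ≤
        if η y ≠ ζ y then a y else 0 := by
      split_ifs with h
      · refine hf y _ _ fun x hx => ?_
        simp [splice, hx]
      · push Not at h
        have : splice Λ ζ η = splice (insert y Λ) ζ η := by
          funext x
          rcases eq_or_ne x y with rfl | hx
          · simp [splice, hy, h]
          · simp [splice, hx]
        simp [this]
    have h2 := abs_sub_le (f η) (f (splice Λ ζ η)) (f (splice (insert y Λ) ζ η))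
    linarith

lemma tendsto_splice [TopologicalSpace A] (η ζ : ℤ → A) :
    Tendsto (fun Λ : Finset ℤ => splice Λ ζ η) atTop (𝓝 ζ) := by
  rw [tendsto_pi_nhds]
  intro x
  refine tendsto_const_nhds.congr' ?_
  filter_upwards [eventually_ge_atTop {x}] with Λ hΛ
  have : x ∈ Λ := hΛ (Finset.mem_singleton_self x)
  simp [splice, this]

/-- A continuous function varies by at most the sum of its oscillations over the discrepancies. -/
lemma OscLe.abs_sub_le_tsum [DecidableEq A] [TopologicalSpace A] {f : (ℤ → A) → ℝ} {a : ℤ → ℝ}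
    (hf : OscLe f a) (hc : Continuous f) (ha : Summable a) (ha0 : ∀ y, 0 ≤ a y) (η ζ : ℤ → A) :
    |f η - f ζ| ≤ ∑' y, if η y ≠ ζ y then a y else 0 := by
  have hs : Summable fun y => if η y ≠ ζ y then a y else 0 := by
    refine Summable.of_nonneg_of_le (fun y => ?_) (fun y => ?_) ha
    · split_ifs <;> simp [ha0]
    · split_ifs <;> simp [ha0]
  have h1 : Tendsto (fun Λ : Finset ℤ => |f η - f (splice Λ ζ η)|) atTop (𝓝 |f η - f ζ|) :=
    (tendsto_const_nhds.sub ((hc.tendsto ζ).comp (tendsto_splice η ζ))).abs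
  refine le_of_tendsto' h1 fun Λ => (hf.abs_sub_splice_le η ζ Λ).trans ?_
  exact hs.sum_le_tsum Λ fun y _ => by split_ifs <;> simp [ha0]

lemma tendstoUniformly_freeze [UniformSpace A] (a₀ : A) :
    TendstoUniformly (fun Λ : Finset ℤ => freeze a₀ Λ) id atTop := by
  intro V hV
  rw [Pi.uniformity] at hV
  obtain ⟨I, hI, W, hW, -, rfl, -⟩ := Filter.mem_iInf'.1 hV
  filter_upwards [eventually_ge_atTop hI.toFinset] with Λ hΛ η
  refine mem_iInter₂.2 fun i hi => ?_
  obtain ⟨t, ht, hsub⟩ := Filter.mem_comap.1 (hW i)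
  refine hsub ?_
  have : i ∈ Λ := hΛ (hI.mem_toFinset.2 hi)
  simpa [freeze, this] using refl_mem_uniformity ht

/-- Uniform continuity on the compact configuration space. This is how statements about cylinder
functions reach continuous rates and continuous test functions. -/
lemma eventually_abs_sub_freeze_le [UniformSpace A] [CompactSpace A] (a₀ : A)
    {f : (ℤ → A) → ℝ} (hf : Continuous f) {δ : ℝ} (hδ : 0 < δ) :
    ∀ᶠ Λ : Finset ℤ in atTop, ∀ η, |f η - f (freeze a₀ Λ η)| ≤ δ := by
  have h := (CompactSpace.uniformContinuous_of_continuous hf).comp_tendstoUniformly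
    (tendstoUniformly_freeze a₀)
  filter_upwards [Metric.tendstoUniformly_iff.1 h δ hδ] with Λ hΛ η
  exact (hΛ η).le

lemma exists_bound_of_dependsOn [Finite A] {f : (ℤ → A) → ℝ} {Λ : Finset ℤ}
    (hf : DependsOn f (Λ : Set ℤ)) : ∃ C, 0 ≤ C ∧ ∀ η, |f η| ≤ C := by
  obtain ⟨g, rfl⟩ := dependsOn_iff_exists_comp.1 hf
  obtain ⟨C, hC⟩ := (Set.finite_range fun σ => |g σ|).bddAbove
  refine ⟨max C 0, le_max_right _ _, fun η => (hC ⟨_, rfl⟩).trans (le_max_left _ _)⟩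

lemma continuous_of_dependsOn [TopologicalSpace A] [DiscreteTopology A] {B : Type}
    [TopologicalSpace B] [Nonempty B] {f : (ℤ → A) → B} {Λ : Finset ℤ} (hf : DependsOn f (Λ : Set ℤ)) :
    Continuous f := by
  obtain ⟨g, rfl⟩ := dependsOn_iff_exists_comp.1 hf
  have : Continuous g := by
    have : DiscreteTopology ((i : (Λ : Set ℤ)) → A) := inferInstance
    exact continuous_of_discreteTopology
  refine this.comp ?_
  exact continuous_pi fun i => continuous_apply _

lemma DependsOn.update_left {Λ : Finset ℤ} {f : (ℤ → A) → ℝ} (hf : DependsOn f (Λ : Set ℤ)) (x : ℤ)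
    (a : A) : DependsOn (fun η => f (Function.update η x a)) (Λ : Set ℤ) := by
  intro η ζ h
  refine hf fun y hy => ?_
  rcases eq_or_ne y x with rfl | hyx
  · simp
  · simp [hyx, h y hy]

end Oscillation

/-! ### Jump rates and frozen Euler steps -/

section Euler

variable {A : Type} [Fintype A]

/-- The generator of the jumps in `Λ`, at rate `r x a η` from `η` to the configuration
with the state at `x` replaced by `a`. -/
def localGen (r : ℤ → A → (ℤ → A) → ℝ) (Λ : Finset ℤ) (f : (ℤ → A) → ℝ) (η : ℤ → A) : ℝ :=
  ∑ x ∈ Λ, ∑ a, r x a η * (f (Function.update η x a) - f η)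

/-- Conditions on the jump rates: `g x u` bounds the influence of `u` on the jumps at `x ≠ u`, and
`κ` is a rate at which a discrepancy disappears at its own site. -/
structure IsJumpRate (r : ℤ → A → (ℤ → A) → ℝ) (g : ℤ → ℤ → ℝ) (κ L K : ℝ) : Prop where
  nonneg : ∀ x a η, 0 ≤ r x a η
  le : ∀ x a η, r x a η ≤ K
  influence : ∀ x u, x ≠ u → ∀ η ζ : ℤ → A, (∀ y, y ≠ u → η y = ζ y) →
    ∑ a, |r x a η - r x a ζ| ≤ g x u
  -- `L` is borrowed from the identity part of the Euler step: adding `L` times the discrepancy lets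
  -- the on-site jumps be estimated together with the borrowed term, and leaves a net decay at rate
  -- κ.
  onsite : ∀ (u : ℤ) (η ζ : ℤ → A) (F : A → ℝ) (D : ℝ), (∀ y, y ≠ u → η y = ζ y) →
    (∀ a b, |F a - F b| ≤ D) →
    |∑ a, (r u a η * (F a - F (η u)) - r u a ζ * (F a - F (ζ u))) + L * (F (η u) - F (ζ u))| ≤
      (L - κ) * D

/-- An Euler step of length `h` of the dynamics in `Λ` in which the rates see a frozen
environment outside `Λ`. -/
def eulerStep (r : ℤ → A → (ℤ → A) → ℝ) (a₀ : A) (Λ : Finset ℤ) (h : ℝ) (f : (ℤ → A) → ℝ)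
    (η : ℤ → A) : ℝ :=
  f η + h * localGen (fun x a η => r x a (freeze a₀ Λ η)) Λ f η

variable {r : ℤ → A → (ℤ → A) → ℝ} {g : ℤ → ℤ → ℝ} {κ L K : ℝ}

/-- Freezing the rates outside Λ keeps all iterates in the finite-dimensional space of functions of
the coordinates in Λ, where the generator limit is uniform. -/
lemma dependsOn_eulerStep (r : ℤ → A → (ℤ → A) → ℝ) (a₀ : A) {Λ : Finset ℤ} (h : ℝ)
    {f : (ℤ → A) → ℝ} (hf : DependsOn f (Λ : Set ℤ)) :
    DependsOn (eulerStep r a₀ Λ h f) (Λ : Set ℤ) := by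
  intro η ζ hηζ
  have h1 : ∀ x a, r x a (freeze a₀ Λ η) = r x a (freeze a₀ Λ ζ) := fun x a =>
    dependsOn_freeze (r x a) a₀ Λ hηζ
  have h2 : ∀ x a, f (Function.update η x a) = f (Function.update ζ x a) := fun x a =>
    hf.update_left x a hηζ
  simp only [eulerStep, localGen, h1, h2, hf hηζ]

lemma IsJumpRate.sum_le (hr : IsJumpRate r g κ L K) (Λ : Finset ℤ) (η : ℤ → A) :
    ∑ x ∈ Λ, ∑ a, r x a η ≤ Λ.card * (Fintype.card A * K) := by
  calc ∑ x ∈ Λ, ∑ a, r x a η ≤ ∑ x ∈ Λ, ∑ _a : A, K :=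
        Finset.sum_le_sum fun x _ => Finset.sum_le_sum fun a _ => hr.le x a η
    _ = _ := by simp

/-- For small `h` the step is a convex combination of values of `f`: the weight left on the current
configuration is one minus `h` times the total jump rate. -/
lemma IsJumpRate.abs_eulerStep_le (hr : IsJumpRate r g κ L K) (a₀ : A) {Λ : Finset ℤ} {h : ℝ}
    (hh : 0 ≤ h) (hsmall : h * (Λ.card * (Fintype.card A * K)) ≤ 1)
    {f : (ℤ → A) → ℝ} {C : ℝ} (hf : ∀ η, |f η| ≤ C) (η : ℤ → A) :
    |eulerStep r a₀ Λ h f η| ≤ C := by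
  set ρ : ℤ → A → ℝ := fun x a => r x a (freeze a₀ Λ η) with hρ
  have hρ0 : ∀ x a, 0 ≤ ρ x a := fun x a => hr.nonneg _ _ _
  set R := ∑ x ∈ Λ, ∑ a, ρ x a with hR
  have hR0 : 0 ≤ R := Finset.sum_nonneg fun x _ => Finset.sum_nonneg fun a _ => hρ0 x a
  have hR1 : h * R ≤ 1 := (mul_le_mul_of_nonneg_left (hr.sum_le Λ _) hh).trans hsmall
  have e : eulerStep r a₀ Λ h f η =
      (1 - h * R) * f η + h * ∑ x ∈ Λ, ∑ a, ρ x a * f (Function.update η x a) := by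
    simp only [eulerStep, localGen, mul_sub, Finset.sum_sub_distrib, hR, ← Finset.sum_mul, hρ]
    ring
  have h1 : |∑ x ∈ Λ, ∑ a, ρ x a * f (Function.update η x a)| ≤ R * C := by
    rw [hR, Finset.sum_mul]
    refine (Finset.abs_sum_le_sum_abs _ _).trans (Finset.sum_le_sum fun x _ => ?_)
    rw [Finset.sum_mul]
    refine (Finset.abs_sum_le_sum_abs _ _).trans (Finset.sum_le_sum fun a _ => ?_)
    rw [abs_mul, abs_of_nonneg (hρ0 x a)]
    exact mul_le_mul_of_nonneg_left (hf _) (hρ0 x a)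
  rw [e]
  calc _ ≤ |(1 - h * R) * f η| + |h * ∑ x ∈ Λ, ∑ a, ρ x a * f (Function.update η x a)| :=
        abs_add_le _ _
    _ ≤ (1 - h * R) * C + h * (R * C) := by
        rw [abs_mul, abs_mul, abs_of_nonneg hh, abs_of_nonneg (sub_nonneg.2 hR1)]
        exact add_le_add (mul_le_mul_of_nonneg_left (hf η) (sub_nonneg.2 hR1))
          (mul_le_mul_of_nonneg_left h1 hh)
    _ = C := by ring

/-- The oscillation bound for one Euler step. -/
lemma IsJumpRate.oscLe_eulerStep (hr : IsJumpRate r g κ L K) (a₀ : A) {Λ : Finset ℤ} {h : ℝ}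
    (hh : 0 ≤ h) (hsmall : h * (L + Λ.card * (Fintype.card A * K)) ≤ 1)
    {f : (ℤ → A) → ℝ} {a : ℤ → ℝ} {lam : ℝ} (ha0 : ∀ u, 0 ≤ a u) (hlam : 0 ≤ 1 - h * (κ - lam))
    (hsup : ∀ u, ∑ x ∈ Λ.erase u, g x u * a x ≤ lam * a u)
    (hdep : DependsOn f (Λ : Set ℤ)) (hf : OscLe f a) :
    OscLe (eulerStep r a₀ Λ h f) (fun u => (1 - h * (κ - lam)) * a u) := by
  intro u η ζ hηζ
  by_cases hu : u ∈ Λ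
  swap
  · have : eulerStep r a₀ Λ h f η = eulerStep r a₀ Λ h f ζ :=
      dependsOn_eulerStep r a₀ h hdep fun x hx => hηζ x (by rintro rfl; exact hu hx)
    rw [this, sub_self, abs_zero]
    exact mul_nonneg hlam (ha0 u)
  set η' := freeze a₀ Λ η with hη'
  set ζ' := freeze a₀ Λ ζ with hζ'
  have hfr : ∀ y, y ≠ u → η' y = ζ' y := fun y hy => by
    simp only [hη', hζ', freeze, hηζ y hy]
  have hη'u : η' u = η u := by simp [hη', freeze, hu]
  have hζ'u : ζ' u = ζ u := by simp [hζ', freeze, hu]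
  set d := f η - f ζ with hd
  have hda : |d| ≤ a u := hf u η ζ hηζ
  set R := ∑ x ∈ Λ.erase u, ∑ b, r x b ζ' with hR
  have hR0 : 0 ≤ R := Finset.sum_nonneg fun x _ => Finset.sum_nonneg fun b _ => hr.nonneg _ _ _
  have hRle : R ≤ Λ.card * (Fintype.card A * K) := by
    refine (Finset.sum_le_sum_of_subset_of_nonneg (Finset.erase_subset _ _) ?_).trans
      (hr.sum_le Λ ζ')
    exact fun x _ _ => Finset.sum_nonneg fun b _ => hr.nonneg _ _ _
  have hcoef : 0 ≤ 1 - h * R - h * L := by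
    have := mul_le_mul_of_nonneg_left (add_le_add_right hRle L) hh
    nlinarith
  -- the four contributions
  set T₁ := ∑ b, (r u b η' * (f (Function.update η u b) - f η) -
    r u b ζ' * (f (Function.update ζ u b) - f ζ)) + L * d with hT₁
  set T₂ := ∑ x ∈ Λ.erase u, ∑ b, r x b ζ' *
    (f (Function.update η x b) - f (Function.update ζ x b)) with hT₂
  set T₃ := ∑ x ∈ Λ.erase u, ∑ b, (r x b η' - r x b ζ') * (f (Function.update η x b) - f η)
    with hT₃
  -- `T₁` collects the jumps at `u`, corrected by `L`; `T₂` the jumps elsewhere, made together at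
  -- the rates of `ζ'`; `T₃` the effect of the differing rates. The smallness of `h` keeps the
  -- remaining coefficient of `d` nonnegative.
  have e : eulerStep r a₀ Λ h f η - eulerStep r a₀ Λ h f ζ =
      (1 - h * R - h * L) * d + h * T₁ + h * T₂ + h * T₃ := by
    have e1 : localGen (fun x a η => r x a (freeze a₀ Λ η)) Λ f η -
        localGen (fun x a η => r x a (freeze a₀ Λ η)) Λ f ζ =
        T₁ - L * d + (T₂ - R * d + T₃) := by
      simp only [localGen]
      rw [← Finset.add_sum_erase Λ _ hu, ← Finset.add_sum_erase Λ _ hu, add_sub_add_comm,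
        ← Finset.sum_sub_distrib, ← Finset.sum_sub_distrib, hT₁, hT₂, hR, hT₃, Finset.sum_mul,
        ← Finset.sum_sub_distrib, ← Finset.sum_add_distrib, add_sub_cancel_right]
      congr 1
      refine Finset.sum_congr rfl fun x _ => ?_
      rw [← Finset.sum_sub_distrib, Finset.sum_mul, ← Finset.sum_sub_distrib,
        ← Finset.sum_add_distrib]
      refine Finset.sum_congr rfl fun b _ => ?_
      rw [hd]
      ring
    simp only [eulerStep]
    linear_combination h * e1
  have h1 : |T₁| ≤ (L - κ) * a u := by
    have hup : ∀ b, Function.update ζ u b = Function.update η u b := by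
      intro b
      funext y
      rcases eq_or_ne y u with rfl | hy
      · simp
      · simp [hy, hηζ y hy]
    have hζ : Function.update η u (ζ u) = ζ := by rw [← hup, Function.update_eq_self]
    have := hr.onsite u η' ζ' (fun b => f (Function.update η u b)) (a u) hfr fun b b' =>
      hf u _ _ fun x hx => by simp [hx]
    simp only [hη'u, hζ'u, Function.update_eq_self, hζ] at this
    simpa only [hT₁, hup, hd] using this
  have h2 : |T₂| ≤ R * a u := by
    rw [hT₂, hR, Finset.sum_mul]
    refine (Finset.abs_sum_le_sum_abs _ _).trans (Finset.sum_le_sum fun x hx => ?_)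
    rw [Finset.sum_mul]
    refine (Finset.abs_sum_le_sum_abs _ _).trans (Finset.sum_le_sum fun b _ => ?_)
    rw [abs_mul, abs_of_nonneg (hr.nonneg _ _ _)]
    refine mul_le_mul_of_nonneg_left (hf u _ _ fun y hy => ?_) (hr.nonneg _ _ _)
    rcases eq_or_ne y x with rfl | hyx
    · simp
    · simp [hyx, hηζ y hy]
  -- A discrepancy at `u` changes the rates at `x` by at most `g x u`, and a jump at `x` changes `f`
  -- by at most `a x`; the supersolution inequality sums these products.
  have h3 : |T₃| ≤ lam * a u := by
    refine le_trans ?_ (hsup u)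
    refine (Finset.abs_sum_le_sum_abs _ _).trans (Finset.sum_le_sum fun x hx => ?_)
    refine (Finset.abs_sum_le_sum_abs _ _).trans ?_
    refine le_trans ?_ (mul_le_mul_of_nonneg_right
      (hr.influence x u (Finset.ne_of_mem_erase hx) η' ζ' hfr) (ha0 x))
    rw [Finset.sum_mul]
    refine Finset.sum_le_sum fun b _ => ?_
    rw [abs_mul]
    exact mul_le_mul_of_nonneg_left (hf x _ _ fun y hy => by simp [hy]) (abs_nonneg _)
  have h0 : |(1 - h * R - h * L) * d| ≤ (1 - h * R - h * L) * a u := by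
    rw [abs_mul, abs_of_nonneg hcoef]
    exact mul_le_mul_of_nonneg_left hda hcoef
  have k1 := mul_le_mul_of_nonneg_left h1 hh
  have k2 := mul_le_mul_of_nonneg_left h2 hh
  have k3 := mul_le_mul_of_nonneg_left h3 hh
  rw [e]
  have t1 := abs_add_le ((1 - h * R - h * L) * d + h * T₁ + h * T₂) (h * T₃)
  have t2 := abs_add_le ((1 - h * R - h * L) * d + h * T₁) (h * T₂)
  have t3 := abs_add_le ((1 - h * R - h * L) * d) (h * T₁)
  simp only [abs_mul h, abs_of_nonneg hh] at t1 t2 t3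
  nlinarith

lemma dependsOn_iterate_eulerStep (r : ℤ → A → (ℤ → A) → ℝ) (a₀ : A) {Λ : Finset ℤ} (h : ℝ)
    {f : (ℤ → A) → ℝ} (hf : DependsOn f (Λ : Set ℤ)) (j : ℕ) :
    DependsOn ((eulerStep r a₀ Λ h)^[j] f) (Λ : Set ℤ) := by
  induction j with
  | zero => exact hf
  | succ j ih =>
    rw [Function.iterate_succ_apply']
    exact dependsOn_eulerStep r a₀ h ih

lemma IsJumpRate.oscLe_iterate_eulerStep (hr : IsJumpRate r g κ L K) (a₀ : A) {Λ : Finset ℤ}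
    {h : ℝ} (hh : 0 ≤ h) (hsmall : h * (L + Λ.card * (Fintype.card A * K)) ≤ 1)
    {f : (ℤ → A) → ℝ} {a : ℤ → ℝ} {lam : ℝ} (ha0 : ∀ u, 0 ≤ a u) (hlam : 0 ≤ 1 - h * (κ - lam))
    (hsup : ∀ u, ∑ x ∈ Λ.erase u, g x u * a x ≤ lam * a u)
    (hdep : DependsOn f (Λ : Set ℤ)) (hf : OscLe f a) (j : ℕ) :
    OscLe ((eulerStep r a₀ Λ h)^[j] f) fun u => (1 - h * (κ - lam)) ^ j * a u := by
  induction j with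
  | zero => simpa using hf
  | succ j ih =>
    rw [Function.iterate_succ_apply']
    have hpow := pow_nonneg hlam j
    refine (hr.oscLe_eulerStep a₀ hh hsmall (lam := lam) (fun u => mul_nonneg hpow (ha0 u)) hlam
      (fun u => ?_) (dependsOn_iterate_eulerStep r a₀ h hdep j) ih).mono fun u => ?_
    · calc _ = (1 - h * (κ - lam)) ^ j * ∑ x ∈ Λ.erase u, g x u * a x := by
            rw [Finset.mul_sum]; exact Finset.sum_congr rfl fun x _ => by ring
        _ ≤ _ := mul_le_mul_of_nonneg_left (hsup u) hpow
        _ = _ := by ring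
    · rw [pow_succ']; exact (mul_assoc _ _ _).ge

end Euler

/-! ### The Markov property on path space -/

section PathSpace

variable {E : Type} [TopologicalSpace E]

lemma isCadlag_add_left {ω : ℝ≥0 → E} (hω : IsCadlag ω) (s : ℝ≥0) :
    IsCadlag fun t => ω (s + t) := by
  intro t
  have hc : Continuous fun u : ℝ≥0 => s + u := by fun_prop
  obtain ⟨h1, l, h2⟩ := hω (s + t)
  refine ⟨h1.comp hc.continuousWithinAt fun u hu => ?_, l, h2.comp ?_⟩
  · exact add_le_add_right (mem_Ici.1 hu) s
  · exact tendsto_nhdsWithin_of_tendsto_nhds_of_eventually_within _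
      (hc.continuousAt.tendsto.mono_left nhdsWithin_le_nhds)
      (eventually_nhdsWithin_of_forall fun u hu => add_lt_add_right (mem_Iio.1 hu) s)

/-- The path after time `s`. -/
def shiftPath (s : ℝ≥0) (ω : CadlagPath E) : CadlagPath E :=
  ⟨fun t => ω.1 (s + t), isCadlag_add_left ω.2 s⟩

lemma IsCadlag.continuous_comp {F : Type} [TopologicalSpace F] {ω : ℝ≥0 → E} (hω : IsCadlag ω)
    {π : E → F} (hπ : Continuous π) : IsCadlag fun t => π (ω t) := by
  intro t
  obtain ⟨h1, l, h2⟩ := hω t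
  exact ⟨hπ.continuousAt.comp_continuousWithinAt h1, π l, (hπ.tendsto l).comp h2⟩

/-- The image of a path under a continuous map of the state space. -/
def mapPath {F : Type} [TopologicalSpace F] (π : E → F) (hπ : Continuous π) (ω : CadlagPath E) :
    CadlagPath F := ⟨fun t => π (ω.1 t), ω.2.continuous_comp hπ⟩

variable [MeasurableSpace E]

@[fun_prop]
lemma measurable_eval (t : ℝ≥0) : Measurable fun ω : CadlagPath E => ω.1 t :=
  (measurable_pi_apply t).comp measurable_subtype_coe

lemma measurableSet_eval (t : ℝ≥0) {C : Set E} (hC : MeasurableSet C) :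
    MeasurableSet {ω : CadlagPath E | ω.1 t ∈ C} := measurable_eval t hC

lemma setLIntegral_eval (μ : Measure (CadlagPath E)) (t : ℝ≥0) {C : Set E}
    (hC : MeasurableSet C) (f : E → ℝ≥0∞) :
    ∫⁻ ω in {ω | ω.1 t ∈ C}, f (ω.1 t) ∂μ = ∫⁻ ω, C.indicator f (ω.1 t) ∂μ := by
  rw [← lintegral_indicator (measurableSet_eval t hC)]
  rfl

lemma measurable_shiftPath (s : ℝ≥0) : Measurable (shiftPath (E := E) s) :=
  Measurable.subtype_mk (measurable_pi_lambda _ fun t => measurable_eval (s + t))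

lemma measurable_mapPath {F : Type} [TopologicalSpace F] [MeasurableSpace F] {π : E → F}
    (hπ : Continuous π) (hπm : Measurable π) : Measurable (mapPath π hπ) :=
  Measurable.subtype_mk (measurable_pi_lambda _ fun t => hπm.comp (measurable_eval t))

/-- Finite-dimensional boxes in path space, described by successive observations. -/
inductive IsBox : Set (CadlagPath E) → Prop
  | univ : IsBox Set.univ
  | cons (d : ℝ≥0) (C : Set E) (D : Set (CadlagPath E)) : MeasurableSet C → IsBox D →
      IsBox {ω | ω.1 d ∈ C ∧ shiftPath d ω ∈ D}

lemma IsBox.measurableSet {D : Set (CadlagPath E)} (hD : IsBox D) : MeasurableSet D := by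
  induction hD with
  | univ => exact MeasurableSet.univ
  | cons d C D hC _ ih => exact (measurable_eval d hC).inter (measurable_shiftPath d ih)

/-- Split off the earliest observation time and measure the others from it. The induction is on the
number of times, which drops strictly because the earliest one is erased. -/
lemma isBox_of_finset (n : ℕ) : ∀ (I : Finset ℝ≥0) (C : ℝ≥0 → Set E), I.card = n →
    (∀ i, MeasurableSet (C i)) → IsBox {ω : CadlagPath E | ∀ i ∈ I, ω.1 i ∈ C i} := by
  induction n using Nat.strong_induction_on with
  | _ n ih =>
    intro I C hI hC
    rcases I.eq_empty_or_nonempty with rfl | hne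
    · simpa using IsBox.univ (E := E)
    set d := I.min' hne with hd
    have hdI : d ∈ I := I.min'_mem hne
    set J := (I.erase d).image fun i => i - d with hJ
    have hcard : J.card < n :=
      Finset.card_image_le.trans_lt (hI ▸ Finset.card_erase_lt_of_mem hdI)
    have hbox := IsBox.cons d (C d) _ (hC d) (ih _ hcard J (fun j => C (d + j)) rfl
      fun j => hC _)
    convert hbox using 1
    ext ω
    simp only [mem_ofPred_eq, hJ, Finset.mem_image, Finset.mem_erase, forall_exists_index, and_imp]
    constructor
    · refine fun h => ⟨h d hdI, ?_⟩
      rintro j i - hi rfl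
      exact h _ (by rwa [add_tsub_cancel_of_le (I.min'_le i hi)])
    · rintro ⟨h1, h2⟩ i hi
      rcases eq_or_ne i d with rfl | hid
      · exact h1
      · have := h2 _ i hid hi rfl
        have e : d + (i - d) = i := add_tsub_cancel_of_le (I.min'_le i hi)
        simpa only [shiftPath, e] using this

/-- Traces of square cylinders on path space form a π-system generating its σ-algebra, and each of
them is a box. Boxes in successive form are the ones suited to induction with the Markov property.
-/
lemma measure_ext_of_isBox {μ ν : Measure (CadlagPath E)} [IsFiniteMeasure μ]
    (h : ∀ D, IsBox D → μ D = ν D) : μ = ν := by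
  set S : Set (Set (CadlagPath E)) := preimage Subtype.val ''
    squareCylinders fun _ : ℝ≥0 => {C : Set E | MeasurableSet C} with hS
  have hpi : IsPiSystem S := by
    have := (isPiSystem_squareCylinders (fun _ : ℝ≥0 => MeasurableSpace.isPiSystem_measurableSet
      (α := E)) (by simp)).comap (Subtype.val : CadlagPath E → ℝ≥0 → E)
    exact this
  refine ext_of_generate_finite S ?_ hpi ?_ (h _ IsBox.univ)
  · rw [hS, ← MeasurableSpace.comap_generateFrom, generateFrom_squareCylinders]
    rfl
  · rintro _ ⟨_, ⟨I, C, hC, rfl⟩, rfl⟩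
    refine h _ ?_
    have hC' : ∀ i, MeasurableSet (C i) := by
      simpa [Set.mem_pi] using hC
    convert isBox_of_finset _ I C rfl hC' using 1
    ext ω
    simp

lemma pastSigma_le (s : ℝ≥0) :
    pastSigma E s ≤ (inferInstance : MeasurableSpace (CadlagPath E)) :=
  iSup_le fun r => (measurable_eval r.1).comap_le

lemma measurableSet_pastSigma_eval {s t : ℝ≥0} (hst : s ≤ t) {C : Set E} (hC : MeasurableSet C) :
    MeasurableSet[pastSigma E t] {ω : CadlagPath E | ω.1 s ∈ C} :=
  (le_iSup (fun r : Iic t => MeasurableSpace.comap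
    (fun ω : CadlagPath E => ω.1 r) inferInstance) ⟨s, hst⟩) _ ⟨C, hC, rfl⟩

/-- The Markov property for events of the future path. -/
lemma IsFellerProcess.measure_inter_shiftPath_of_isBox {P : Kernel E (CadlagPath E)}
    (hP : IsFellerProcess P) {D : Set (CadlagPath E)} (hD : IsBox D) :
    ∀ (x : E) (s : ℝ≥0) (B : Set (CadlagPath E)), MeasurableSet[pastSigma E s] B →
      P x (B ∩ shiftPath s ⁻¹' D) = ∫⁻ ω in B, P (ω.1 s) D ∂(P x) := by
  induction hD with
  | univ =>
    intro x s B _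
    have : ∀ y, P y Set.univ = 1 := fun y => have := hP.prob y; measure_univ
    simp [this]
  | cons d C D hC hD ih =>
    intro x s B hB
    have hmono : pastSigma E s ≤ pastSigma E (s + d) :=
      iSup_le fun r => le_iSup_of_le (⟨r.1, (mem_Iic.1 r.2).trans le_self_add⟩ : Iic (s + d)) le_rfl
    have hev : MeasurableSet[pastSigma E (s + d)] {ω : CadlagPath E | ω.1 (s + d) ∈ C} :=
      measurableSet_pastSigma_eval le_rfl hC
    have hψ : Measurable fun y => P y D := P.measurable_coe hD.measurableSet
    have hBm : MeasurableSet B := pastSigma_le s _ hB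
    have e1 : B ∩ shiftPath s ⁻¹' {ω | ω.1 d ∈ C ∧ shiftPath d ω ∈ D} =
        (B ∩ {ω | ω.1 (s + d) ∈ C}) ∩ shiftPath (s + d) ⁻¹' D := by
      ext ω
      have : shiftPath d (shiftPath s ω) = shiftPath (s + d) ω := by
        simp [shiftPath, add_assoc]
      simp only [mem_inter_iff, mem_preimage, mem_ofPred_eq, this]
      simp [shiftPath, and_assoc]
    -- The induction hypothesis for `D` is used twice: here from time `s + d`, and at the end from
    -- time `d` under `P (ω.1 s)`. The one-time Markov property at `s` joins the two.
    rw [e1, ih x (s + d) _ ((hmono _ hB).inter hev)]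
    -- the Markov property at time `s`, as an identity of measures
    have e2 : ((P x).restrict B).map (fun ω => ω.1 (s + d)) =
        ((P x).restrict B).bind fun ω => (P (ω.1 s)).map fun ω' => ω'.1 d := by
      have hm : Measurable fun ω : CadlagPath E => (P (ω.1 s)).map fun ω' => ω'.1 d :=
        (Measure.measurable_map _ (measurable_eval d)).comp (P.measurable.comp (measurable_eval s))
      ext C' hC'
      rw [Measure.map_apply (measurable_eval _) hC', Measure.restrict_apply
        (measurable_eval _ hC'), Measure.bind_apply hC' hm.aemeasurable, inter_comm]
      refine (hP.markov x s d B C' hB hC').trans ?_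
      exact lintegral_congr fun ω => by rw [Measure.map_apply (measurable_eval _) hC']; rfl
    have hm : Measurable fun ω : CadlagPath E => (P (ω.1 s)).map fun ω' => ω'.1 d :=
      (Measure.measurable_map _ (measurable_eval d)).comp (P.measurable.comp (measurable_eval s))
    have hind : Measurable (C.indicator fun y => P y D) := hψ.indicator hC
    calc ∫⁻ ω in B ∩ {ω | ω.1 (s + d) ∈ C}, P (ω.1 (s + d)) D ∂(P x)
        = ∫⁻ ω in B, C.indicator (fun y => P y D) (ω.1 (s + d)) ∂(P x) := by
          rw [inter_comm, ← Measure.restrict_restrict (measurableSet_eval (s + d) hC),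
            setLIntegral_eval _ _ hC fun y => P y D]
      _ = ∫⁻ y, C.indicator (fun y => P y D) y
            ∂(((P x).restrict B).map fun ω => ω.1 (s + d)) :=
          (lintegral_map hind (measurable_eval _)).symm
      _ = ∫⁻ ω in B, ∫⁻ ω', C.indicator (fun y => P y D) (ω'.1 d) ∂(P (ω.1 s)) ∂(P x) := by
          rw [e2, Measure.lintegral_bind hm.aemeasurable hind.aemeasurable]
          exact lintegral_congr fun ω => lintegral_map hind (measurable_eval _)
      _ = _ := by
          refine lintegral_congr fun ω => ?_
          have hev' : MeasurableSet[pastSigma E d] {ω : CadlagPath E | ω.1 d ∈ C} :=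
            measurableSet_pastSigma_eval le_rfl hC
          have := ih (ω.1 s) d _ hev'
          rw [show {ω : CadlagPath E | ω.1 d ∈ C ∧ shiftPath d ω ∈ D} =
            {ω | ω.1 d ∈ C} ∩ shiftPath d ⁻¹' D from rfl, this,
            setLIntegral_eval _ _ hC fun y => P y D]

/-- The Markov property: given the past, the future path has law `P (ω.1 s)`. -/
lemma IsFellerProcess.map_shiftPath {P : Kernel E (CadlagPath E)} (hP : IsFellerProcess P) (x : E)
    {s : ℝ≥0} {B : Set (CadlagPath E)} (hB : MeasurableSet[pastSigma E s] B) :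
    ((P x).restrict B).map (shiftPath s) = P ∘ₘ (((P x).restrict B).map fun ω => ω.1 s) := by
  have := hP.prob x
  refine measure_ext_of_isBox fun D hD => ?_
  rw [Measure.map_apply (measurable_shiftPath s) hD.measurableSet,
    Measure.restrict_apply (measurable_shiftPath s hD.measurableSet),
    Measure.bind_apply hD.measurableSet P.measurable.aemeasurable,
    lintegral_map (P.measurable_coe hD.measurableSet) (measurable_eval s), inter_comm,
    hP.measure_inter_shiftPath_of_isBox hD x s B hB]

lemma IsFellerProcess.measure_eval_inter_shiftPath {P : Kernel E (CadlagPath E)}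
    (hP : IsFellerProcess P) (x : E) (d : ℝ≥0) {C : Set E} (hC : MeasurableSet C)
    {D : Set (CadlagPath E)} (hD : MeasurableSet D) :
    P x ({ω | ω.1 d ∈ C} ∩ shiftPath d ⁻¹' D) =
      ∫⁻ z, C.indicator (fun z => P z D) z ∂((P x).map fun ω => ω.1 d) := by
  have h1 := congrArg (fun m => m D)
    (hP.map_shiftPath x (measurableSet_pastSigma_eval (le_refl d) hC))
  rw [Measure.map_apply (measurable_shiftPath d) hD,
    Measure.restrict_apply (measurable_shiftPath d hD),
    Measure.bind_apply hD P.measurable.aemeasurable,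
    lintegral_map (P.measurable_coe hD) (measurable_eval d), inter_comm] at h1
  rw [h1, lintegral_map ((P.measurable_coe hD).indicator hC) (measurable_eval d),
    setLIntegral_eval _ _ hC fun y => P y D]

lemma MeasureTheory.Measure.integral_bind_kernel {α β : Type} [MeasurableSpace α]
    [MeasurableSpace β] (μ : Measure α) [IsFiniteMeasure μ] (κ : Kernel α β) [IsFiniteKernel κ]
    {f : β → ℝ} (hf : Measurable f) {C : ℝ} (hC : ∀ y, |f y| ≤ C) :
    ∫ y, f y ∂(κ ∘ₘ μ) = ∫ x, ∫ y, f y ∂(κ x) ∂μ := by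
  have h1 : κ ∘ₘ μ = (μ ⊗ₘ κ).map Prod.snd := (Measure.snd_compProd μ κ).symm
  rw [h1, integral_map measurable_snd.aemeasurable hf.aestronglyMeasurable,
    Measure.integral_compProd]
  exact Integrable.of_bound (hf.comp measurable_snd).aestronglyMeasurable C
    (Eventually.of_forall fun z => hC _)

lemma IsFellerProcess.setIntegral_shiftPath {P : Kernel E (CadlagPath E)}
    (hP : IsFellerProcess P) (x : E) {s : ℝ≥0} {B : Set (CadlagPath E)}
    (hB : MeasurableSet[pastSigma E s] B) {F : CadlagPath E → ℝ} (hF : Measurable F) {C : ℝ}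
    (hC : ∀ ω, |F ω| ≤ C) :
    ∫ ω in B, F (shiftPath s ω) ∂(P x) = ∫ ω in B, ∫ ω', F ω' ∂(P (ω.1 s)) ∂(P x) := by
  have := hP.prob
  have : IsMarkovKernel P := ⟨hP.prob⟩
  have hSF : StronglyMeasurable fun y => ∫ ω', F ω' ∂(P y) :=
    hF.stronglyMeasurable.integral_kernel
  rw [← integral_map (f := F) (measurable_shiftPath s).aemeasurable hF.aestronglyMeasurable,
    hP.map_shiftPath x hB, Measure.integral_bind_kernel _ _ hF hC,
    integral_map (measurable_eval s).aemeasurable hSF.aestronglyMeasurable]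

lemma IsFellerProcess.integral_shiftPath {P : Kernel E (CadlagPath E)}
    (hP : IsFellerProcess P) (x : E) (s : ℝ≥0) {F : CadlagPath E → ℝ} (hF : Measurable F) {C : ℝ}
    (hC : ∀ ω, |F ω| ≤ C) :
    ∫ ω, F (shiftPath s ω) ∂(P x) = ∫ ω, ∫ ω', F ω' ∂(P (ω.1 s)) ∂(P x) := by
  simpa using hP.setIntegral_shiftPath x (B := Set.univ) (s := s) MeasurableSet.univ hF hC

/-- If the one-dimensional marginals of two Feller processes correspond under a continuous map of
the state spaces, then so do the path laws. -/
lemma IsFellerProcess.map_mapPath {F : Type} [TopologicalSpace F] [MeasurableSpace F]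
    {P : Kernel E (CadlagPath E)} (hP : IsFellerProcess P) {P' : Kernel F (CadlagPath F)}
    (hP' : IsFellerProcess P') {π : E → F} (hπ : Continuous π) (hπm : Measurable π)
    (h : ∀ x t, (P x).map (fun ω => π (ω.1 t)) = (P' (π x)).map fun ω => ω.1 t) (x : E) :
    (P x).map (mapPath π hπ) = P' (π x) := by
  have := hP.prob
  have hmeas := measurable_mapPath hπ hπm
  refine measure_ext_of_isBox fun D hD => ?_
  rw [Measure.map_apply hmeas hD.measurableSet]
  induction hD generalizing x with
  | univ => have := hP'.prob; simp
  | cons d C D hC hD ih =>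
    have hψ : Measurable fun y => P' y D := P'.measurable_coe hD.measurableSet
    have hind : Measurable (C.indicator fun y => P' y D) := hψ.indicator hC
    have e1 : mapPath π hπ ⁻¹' {ω | ω.1 d ∈ C ∧ shiftPath d ω ∈ D} =
        {ω | ω.1 d ∈ π ⁻¹' C} ∩ shiftPath d ⁻¹' (mapPath π hπ ⁻¹' D) := rfl
    rw [e1, hP.measure_eval_inter_shiftPath x d (hπm hC) (hmeas hD.measurableSet)]
    have e2 := hP'.measure_eval_inter_shiftPath (π x) d hC hD.measurableSet
    rw [show {ω : CadlagPath F | ω.1 d ∈ C ∧ shiftPath d ω ∈ D} =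
      {ω | ω.1 d ∈ C} ∩ shiftPath d ⁻¹' D from rfl, e2, ← h x d,
      lintegral_map (g := fun ω : CadlagPath E => π (ω.1 d)) hind
        (hπm.comp (measurable_eval d)),
      lintegral_map ((P.measurable_coe (hmeas hD.measurableSet)).indicator (hπm hC))
        (measurable_eval d)]
    refine lintegral_congr fun ω => ?_
    by_cases hω : π (ω.1 d) ∈ C <;> simp [hω, ih]

end PathSpace

/-! ### Approximation of the transition semigroup -/

section Semigroup

variable {E : Type} [TopologicalSpace E] [MeasurableSpace E]

/-- The transition semigroup. -/
noncomputable def transOp (P : Kernel E (CadlagPath E)) (t : ℝ≥0) (φ : E → ℝ) (e : E) : ℝ :=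
  ∫ ω, φ (ω.1 t) ∂(P e)

variable {P : Kernel E (CadlagPath E)}

lemma integrable_eval (hP : IsFellerProcess P) (e : E) (t : ℝ≥0) {φ : E → ℝ} (hφ : Measurable φ)
    {C : ℝ} (hC : ∀ e, |φ e| ≤ C) : Integrable (fun ω : CadlagPath E => φ (ω.1 t)) (P e) := by
  have := hP.prob e
  exact Integrable.of_bound (hφ.comp (measurable_eval t)).aestronglyMeasurable C
    (Eventually.of_forall fun ω => hC _)

lemma abs_integral_le_of_forall {α : Type} [MeasurableSpace α] (μ : Measure α)
    [IsProbabilityMeasure μ] {f : α → ℝ} {C : ℝ} (hC : ∀ x, |f x| ≤ C) : |∫ x, f x ∂μ| ≤ C := by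
  simpa using norm_integral_le_of_norm_le_const (μ := μ) (f := f) (Eventually.of_forall hC)

lemma abs_transOp_le (hP : IsFellerProcess P) (t : ℝ≥0) {φ : E → ℝ} {C : ℝ}
    (hC : ∀ e, |φ e| ≤ C) (e : E) : |transOp P t φ e| ≤ C := by
  have := hP.prob e
  exact abs_integral_le_of_forall (P e) fun ω => hC (ω.1 t)

lemma measurable_transOp (t : ℝ≥0) {φ : E → ℝ} (hφ : Measurable φ) :
    Measurable (transOp P t φ) :=
  (StronglyMeasurable.integral_kernel (κ := P)
    (hφ.comp (measurable_eval t)).stronglyMeasurable).measurable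

lemma transOp_zero (hP : IsFellerProcess P) (φ : E → ℝ) (e : E) : transOp P 0 φ e = φ e := by
  have := hP.prob e
  have h : (fun ω : CadlagPath E => φ (ω.1 0)) =ᵐ[P e] fun _ => φ e := by
    filter_upwards [hP.start e] with ω hω
    rw [hω]
  rw [transOp, integral_congr_ae h]
  simp

lemma transOp_add (hP : IsFellerProcess P) (s t : ℝ≥0) {φ : E → ℝ} (hφ : Measurable φ)
    {C : ℝ} (hC : ∀ e, |φ e| ≤ C) (e : E) :
    transOp P (s + t) φ e = transOp P s (transOp P t φ) e :=
  hP.integral_shiftPath e s (hφ.comp (measurable_eval t)) (C := C) fun _ => hC _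

lemma abs_transOp_sub_le (hP : IsFellerProcess P) (t : ℝ≥0) {φ ψ : E → ℝ} (hφ : Measurable φ)
    (hψ : Measurable ψ) {C D δ : ℝ} (hC : ∀ e, |φ e| ≤ C) (hD : ∀ e, |ψ e| ≤ D)
    (h : ∀ e, |φ e - ψ e| ≤ δ) (e : E) : |transOp P t φ e - transOp P t ψ e| ≤ δ := by
  rw [transOp, transOp, ← integral_sub (integrable_eval hP e t hφ hC) (integrable_eval hP e t hψ hD)]
  exact abs_transOp_le hP t h e

/-- One-step errors accumulate at most linearly. -/
lemma abs_transOp_nsmul_sub_le (hP : IsFellerProcess P) (h : ℝ≥0) {C δ : ℝ} (k : ℕ) :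
    ∀ F : ℕ → E → ℝ, (∀ j, Measurable (F j)) → (∀ j e, |F j e| ≤ C) →
      (∀ j < k, ∀ e, |transOp P h (F j) e - F (j + 1) e| ≤ δ) →
      ∀ e, |transOp P (k * h) (F 0) e - F k e| ≤ k * δ := by
  induction k with
  | zero => intro F _ _ _ e; simp [transOp_zero hP]
  | succ k ih =>
    intro F hm hC hF e
    have h1 := ih (fun j => F (j + 1)) (fun j => hm _) (fun j => hC _)
      (fun j hj => hF (j + 1) (by omega)) e
    have h2 : |transOp P (k * h) (transOp P h (F 0)) e - transOp P (k * h) (F 1) e| ≤ δ :=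
      abs_transOp_sub_le hP _ (measurable_transOp h (hm 0)) (hm 1)
        (abs_transOp_le hP h (hC 0)) (hC 1) (hF 0 (by omega)) e
    have h3 : ((k + 1 : ℕ) : ℝ≥0) * h = k * h + h := by push_cast; ring
    rw [h3, transOp_add hP _ _ (hm 0) (hC 0)]
    have := abs_sub_le (transOp P (k * h) (transOp P h (F 0)) e) (transOp P (k * h) (F 1) e)
      (F (k + 1) e)
    simp only [zero_add] at h1
    push_cast
    linarith

end Semigroup

/-! ### Convergence of frozen Euler schemes to the semigroup -/

section Approximation

variable {A : Type} [Fintype A] {r : ℤ → A → (ℤ → A) → ℝ} {g : ℤ → ℤ → ℝ} {κ L K : ℝ}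

lemma measurable_of_dependsOn {ι : Type} [MeasurableSpace A] [MeasurableSingletonClass A]
    {f : (ι → A) → ℝ} {Λ : Finset ι} (hf : DependsOn f (Λ : Set ι)) : Measurable f := by
  obtain ⟨g, rfl⟩ := dependsOn_iff_exists_comp.1 hf
  have hg : Measurable g := by
    have : Finite ((i : (Λ : Set ι)) → A) := inferInstance
    exact measurable_of_countable g
  exact hg.comp (measurable_pi_lambda _ fun i => measurable_pi_apply _)

/-- The image under `π` of the process `P` has the jump rates `r`. -/
def HasJumpRate {E : Type} [TopologicalSpace E] [MeasurableSpace E]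
    (P : Kernel E (CadlagPath E)) (π : E → ℤ → A) (r : ℤ → A → (ℤ → A) → ℝ) : Prop :=
  ∀ (Λ : Finset ℤ) (f : (ℤ → A) → ℝ), DependsOn f (Λ : Set ℤ) →
    HasGeneratorAt P (fun e => f (π e)) fun e => localGen r Λ f (π e)

/-- Outside a finite set `T` the weights have small mass and the errors are bounded by `N`; on `T`
finitely many continuous rates are uniformly well approximated by frozen ones. Summability of `a`
thus replaces any uniformity of the freezing error over sites. -/
lemma IsJumpRate.eventually_frozen_le [UniformSpace A] (hr : IsJumpRate r g κ L K)
    (hrc : ∀ x a, Continuous (r x a)) (a₀ : A) {a : ℤ → ℝ} (ha : Summable a) (ha0 : ∀ x, 0 ≤ a x)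
    {δ : ℝ} (hδ : 0 < δ) :
    ∀ᶠ Λ : Finset ℤ in atTop, ∀ η,
      ∑ x ∈ Λ, a x * ∑ b, |r x b η - r x b (freeze a₀ Λ η)| ≤ δ := by
  have hK : 0 ≤ K := (hr.nonneg 0 a₀ fun _ => a₀).trans (hr.le _ _ _)
  set N : ℝ := Fintype.card A * K with hN
  have hN0 : 0 ≤ N := by positivity
  obtain ⟨T, hT⟩ := summable_iff_vanishing_norm.1 ha (δ / (2 * (N + 1))) (by positivity)
  set S : ℝ := ∑ x ∈ T, a x with hS
  have hS0 : 0 ≤ S := Finset.sum_nonneg fun x _ => ha0 x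
  set δ' : ℝ := δ / (2 * (S + 1) * (Fintype.card A + 1)) with hδ'
  have hδ'0 : 0 < δ' := by positivity
  have hev : ∀ᶠ Λ : Finset ℤ in atTop, ∀ x ∈ T, ∀ b ∈ (Finset.univ : Finset A), ∀ η,
      |r x b η - r x b (freeze a₀ Λ η)| ≤ δ' := by
    rw [Filter.eventually_all_finset]
    intro x _
    rw [Filter.eventually_all_finset]
    exact fun b _ => eventually_abs_sub_freeze_le a₀ (hrc x b) hδ'0
  filter_upwards [hev] with Λ hΛ η
  have hin : ∀ x ∈ T, ∑ b, |r x b η - r x b (freeze a₀ Λ η)| ≤ δ / (2 * (S + 1)) := by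
    intro x hx
    calc ∑ b, |r x b η - r x b (freeze a₀ Λ η)| ≤ ∑ _b : A, δ' :=
          Finset.sum_le_sum fun b hb => hΛ x hx b hb η
      _ = Fintype.card A * δ' := by simp
      _ ≤ (Fintype.card A + 1) * δ' := by nlinarith
      _ = _ := by rw [hδ']; field_simp
  have hout : ∀ x, ∑ b, |r x b η - r x b (freeze a₀ Λ η)| ≤ N := by
    intro x
    calc ∑ b, |r x b η - r x b (freeze a₀ Λ η)| ≤ ∑ _b : A, K := by
          refine Finset.sum_le_sum fun b _ => ?_
          have h1 := hr.nonneg x b η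
          have h2 := hr.nonneg x b (freeze a₀ Λ η)
          have h3 := hr.le x b η
          have h4 := hr.le x b (freeze a₀ Λ η)
          rw [abs_le]
          constructor <;> linarith
      _ = N := by simp [hN]
  rw [← Finset.sum_inter_add_sum_sdiff Λ T]
  have h1 : ∑ x ∈ Λ ∩ T, a x * ∑ b, |r x b η - r x b (freeze a₀ Λ η)| ≤ δ / 2 := by
    calc _ ≤ ∑ x ∈ Λ ∩ T, a x * (δ / (2 * (S + 1))) := by
          refine Finset.sum_le_sum fun x hx => mul_le_mul_of_nonneg_left
            (hin x (Finset.mem_inter.1 hx).2) (ha0 x)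
      _ ≤ ∑ x ∈ T, a x * (δ / (2 * (S + 1))) :=
          Finset.sum_le_sum_of_subset_of_nonneg Finset.inter_subset_right fun x _ _ =>
            mul_nonneg (ha0 x) (by positivity)
      _ = S * (δ / (2 * (S + 1))) := by rw [← Finset.sum_mul]
      _ ≤ (S + 1) * (δ / (2 * (S + 1))) := by
          have : 0 ≤ δ / (2 * (S + 1)) := by positivity
          nlinarith
      _ = δ / 2 := by field_simp
  have h2 : ∑ x ∈ Λ \ T, a x * ∑ b, |r x b η - r x b (freeze a₀ Λ η)| ≤ δ / 2 := by
    have h3 := hT (Λ \ T) Finset.sdiff_disjoint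
    rw [Real.norm_of_nonneg (Finset.sum_nonneg fun x _ => ha0 x)] at h3
    calc _ ≤ ∑ x ∈ Λ \ T, a x * N :=
          Finset.sum_le_sum fun x _ => mul_le_mul_of_nonneg_left (hout x) (ha0 x)
      _ = (∑ x ∈ Λ \ T, a x) * N := by rw [Finset.sum_mul]
      _ ≤ δ / (2 * (N + 1)) * (N + 1) := by
          refine mul_le_mul h3.le (by linarith) hN0 (by positivity)
      _ = δ / 2 := by field_simp
  linarith

lemma abs_localGen_sub_le {f : (ℤ → A) → ℝ} {a : ℤ → ℝ} (hf : OscLe f a)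
    (r r' : ℤ → A → (ℤ → A) → ℝ) (Λ : Finset ℤ) (η : ℤ → A) :
    |localGen r Λ f η - localGen r' Λ f η| ≤ ∑ x ∈ Λ, a x * ∑ b, |r x b η - r' x b η| := by
  simp only [localGen]
  rw [← Finset.sum_sub_distrib]
  refine (Finset.abs_sum_le_sum_abs _ _).trans (Finset.sum_le_sum fun x _ => ?_)
  rw [← Finset.sum_sub_distrib, Finset.mul_sum]
  refine (Finset.abs_sum_le_sum_abs _ _).trans (Finset.sum_le_sum fun b _ => ?_)
  rw [← sub_mul, abs_mul, mul_comm]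
  exact mul_le_mul_of_nonneg_right (hf x _ _ fun y hy => by simp [hy]) (abs_nonneg _)

lemma dependsOn_eq_sum [DecidableEq A] {f : (ℤ → A) → ℝ} {Λ : Finset ℤ}
    (hf : DependsOn f (Λ : Set ℤ)) (a₀ : A) :
    f = fun η => ∑ σ : Λ → A, f (fun x => if hx : x ∈ Λ then σ ⟨x, hx⟩ else a₀) *
      if (fun i : Λ => η i) = σ then 1 else 0 := by
  funext η
  rw [Finset.sum_eq_single fun i : Λ => η i]
  · simp only [if_true, mul_one]
    refine hf fun x hx => ?_
    rw [dif_pos (Finset.mem_coe.1 hx)]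
  · intro σ _ hσ
    rw [if_neg (Ne.symm hσ), mul_zero]
  · simp

variable {E : Type} [TopologicalSpace E] [MeasurableSpace E] {P : Kernel E (CadlagPath E)}

/-- On functions of finitely many coordinates the generator is approached at a uniform rate. -/
lemma HasJumpRate.eventually_abs_sub_le [MeasurableSpace A] [MeasurableSingletonClass A]
    (hP : IsFellerProcess P) {π : E → ℤ → A} (hπ : Measurable π) (hgen : HasJumpRate P π r)
    (a₀ : A) (Λ : Finset ℤ) {δ : ℝ} (hδ : 0 < δ) :
    ∀ᶠ h : ℝ≥0 in 𝓝[>] 0, ∀ (f : (ℤ → A) → ℝ) (C : ℝ), DependsOn f (Λ : Set ℤ) →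
      (∀ η, |f η| ≤ C) → ∀ e,
      |transOp P h (fun e => f (π e)) e - (f (π e) + h * localGen r Λ f (π e))| ≤ h * (δ * C) := by
  classical
  -- Indicators of the finitely many patterns on Λ span the functions of the coordinates in Λ.
  -- Generator convergence for these gives a rate valid for all such functions bounded by `C`, as is
  -- needed for Euler iterates that change with `h`.
  set ind : (Λ → A) → (ℤ → A) → ℝ := fun σ η => if (fun i : Λ => η i) = σ then 1 else 0 with hind
  have hdep : ∀ σ, DependsOn (ind σ) (Λ : Set ℤ) := by
    intro σ η ζ h
    have : (fun i : Λ => η i) = fun i : Λ => ζ i := funext fun i => h i i.2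
    simp only [hind, this]
  have hb : ∀ σ η, |ind σ η| ≤ 1 := by
    intro σ η
    simp only [hind]
    split_ifs <;> simp
  set δ' := δ / (Fintype.card (Λ → A) + 1) with hδ'
  have hδ'0 : 0 < δ' := by positivity
  have hev : ∀ᶠ h : ℝ≥0 in 𝓝[>] 0, ∀ σ ∈ (Finset.univ : Finset (Λ → A)), ∀ e,
      |transOp P h (fun e => ind σ (π e)) e - (ind σ (π e) + h * localGen r Λ (ind σ) (π e))| ≤
        h * δ' := by
    rw [Filter.eventually_all_finset]
    intro σ _
    filter_upwards [Metric.tendstoUniformly_iff.1 (hgen Λ (ind σ) (hdep σ)) δ' hδ'0,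
      self_mem_nhdsWithin] with h hh hpos e
    have hpos' : (0 : ℝ) < h := hpos
    have h1 := (hh e).le
    rw [Real.dist_eq, abs_sub_comm] at h1
    have h2 : transOp P h (fun e => ind σ (π e)) e -
        (ind σ (π e) + h * localGen r Λ (ind σ) (π e)) =
        h * ((∫ ω, ind σ (π (ω.1 h)) ∂(P e) - ind σ (π e)) / h - localGen r Λ (ind σ) (π e)) := by
      rw [transOp]
      field_simp
      ring
    rw [h2, abs_mul, abs_of_pos hpos']
    exact mul_le_mul_of_nonneg_left h1 hpos'.le
  filter_upwards [hev] with h hh f C hf hC e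
  have hC0 : 0 ≤ C := (abs_nonneg _).trans (hC fun _ => a₀)
  set w : (Λ → A) → ℝ := fun σ => f fun x => if hx : x ∈ Λ then σ ⟨x, hx⟩ else a₀ with hw
  have hsum : f = fun η => ∑ σ, w σ * ind σ η := dependsOn_eq_sum hf a₀
  have e1 : transOp P h (fun e => f (π e)) e =
      ∑ σ, w σ * transOp P h (fun e => ind σ (π e)) e := by
    simp only [transOp, hsum]
    rw [integral_finsetSum]
    · simp only [integral_const_mul]
    · intro σ _
      exact (integrable_eval hP e h ((measurable_of_dependsOn (hdep σ)).comp hπ)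
        fun e => hb σ _).const_mul _
  have e2 : localGen r Λ f (π e) = ∑ σ, w σ * localGen r Λ (ind σ) (π e) := by
    have : ∀ x b, r x b (π e) * (f (Function.update (π e) x b) - f (π e)) =
        ∑ σ, w σ * (r x b (π e) * (ind σ (Function.update (π e) x b) - ind σ (π e))) := by
      intro x b
      rw [hsum]
      simp only
      rw [← Finset.sum_sub_distrib, Finset.mul_sum]
      exact Finset.sum_congr rfl fun σ _ => by ring
    simp only [localGen, this]
    simp only [Finset.mul_sum]
    conv_rhs => rw [Finset.sum_comm]
    refine Finset.sum_congr rfl fun x _ => ?_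
    rw [Finset.sum_comm]
  have e3 : transOp P h (fun e => f (π e)) e - (f (π e) + h * localGen r Λ f (π e)) =
      ∑ σ, w σ * (transOp P h (fun e => ind σ (π e)) e -
        (ind σ (π e) + h * localGen r Λ (ind σ) (π e))) := by
    rw [e1, e2]
    conv_lhs => rw [hsum]
    simp only [mul_sub, mul_add, Finset.sum_sub_distrib, Finset.sum_add_distrib, Finset.mul_sum]
    congr 2
    exact Finset.sum_congr rfl fun σ _ => by ring
  rw [e3]
  refine (Finset.abs_sum_le_sum_abs _ _).trans ?_
  calc _ ≤ ∑ _σ : Λ → A, C * (h * δ') := by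
        refine Finset.sum_le_sum fun σ hσ => ?_
        rw [abs_mul]
        exact mul_le_mul (hC _) (hh σ hσ e) (abs_nonneg _) hC0
    _ = Fintype.card (Λ → A) * (C * (h * δ')) := by simp
    _ ≤ (Fintype.card (Λ → A) + 1) * (C * (h * δ')) := by
        have : 0 ≤ C * (h * δ') := mul_nonneg hC0 (mul_nonneg h.2 hδ'0.le)
        nlinarith
    _ = h * (δ * C) := by rw [hδ']; field_simp

/-- Iterated frozen Euler steps approximate the transition semigroup. -/
theorem HasJumpRate.eventually_abs_transOp_sub_le [UniformSpace A]
    [MeasurableSpace A] [MeasurableSingletonClass A]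
    (hP : IsFellerProcess P) {π : E → ℤ → A} (hπ : Measurable π) (hgen : HasJumpRate P π r)
    (hr : IsJumpRate r g κ L K) (hrc : ∀ x a, Continuous (r x a)) (a₀ : A) {a : ℤ → ℝ} {lam : ℝ}
    (ha : Summable a) (ha0 : ∀ x, 0 ≤ a x)
    (hsup : ∀ (Λ : Finset ℤ) u, ∑ x ∈ Λ.erase u, g x u * a x ≤ lam * a u)
    {Λ₀ : Finset ℤ} {f : (ℤ → A) → ℝ} (hdep : DependsOn f (Λ₀ : Set ℤ)) (hf : OscLe f a)
    (t : ℝ≥0) {δ : ℝ} (hδ : 0 < δ) :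
    ∀ᶠ Λ : Finset ℤ in atTop, ∀ᶠ k : ℕ in atTop, ∀ e,
      |transOp P t (fun e => f (π e)) e - (eulerStep r a₀ Λ (t / k))^[k] f (π e)| ≤ δ := by
  obtain ⟨C, hC0, hC⟩ := exists_bound_of_dependsOn hdep
  -- `W` bounds the growth of oscillations over all steps. `δ₁` pays for freezing and `δ₂` for the
  -- generator limit; over total time `t` each contributes at most `δ / 2`. Λ is fixed before `k`,
  -- since the admissible step length depends on Λ.
  set q := |κ - lam| with hq
  set W := Real.exp (t * q) with hW
  have hW0 : 0 < W := Real.exp_pos _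
  set δ₁ := δ / (2 * (t + 1) * W) with hδ₁
  have hδ₁0 : 0 < δ₁ := by positivity
  set δ₂ := δ / (2 * (t + 1) * (C + 1)) with hδ₂
  have hδ₂0 : 0 < δ₂ := by positivity
  filter_upwards [hr.eventually_frozen_le hrc a₀ ha ha0 hδ₁0, eventually_ge_atTop Λ₀]
    with Λ hΛ hsub
  -- The generator limit needs strictly positive step lengths, so `t = 0` is treated apart.
  rcases eq_or_ne t 0 with rfl | ht
  · refine Eventually.of_forall fun k e => ?_
    have hid : ∀ f : (ℤ → A) → ℝ, eulerStep r a₀ Λ 0 f = f := fun f => by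
      funext η; simp [eulerStep]
    rw [transOp_zero hP]
    have : (eulerStep r a₀ Λ 0)^[k] f = f := by
      induction k with
      | zero => rfl
      | succ k ih => rw [Function.iterate_succ_apply', ih, hid]
    simp [this, hδ.le]
  have htpos : 0 < t := pos_iff_ne_zero.2 ht
  have hlim : Tendsto (fun k : ℕ => t / (k : ℝ≥0)) atTop (𝓝[>] 0) := by
    refine tendsto_nhdsWithin_iff.2 ⟨?_, ?_⟩
    · rw [← NNReal.tendsto_coe]
      simpa using tendsto_const_div_atTop_nhds_zero_nat (t : ℝ)
    · filter_upwards [eventually_gt_atTop 0] with k hk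
      exact div_pos htpos (by exact_mod_cast hk)
  have hlimR : Tendsto (fun k : ℕ => (t : ℝ) / k) atTop (𝓝 0) :=
    tendsto_const_div_atTop_nhds_zero_nat (t : ℝ)
  have hsm : ∀ c : ℝ, ∀ᶠ k : ℕ in atTop, (t : ℝ) / k * c ≤ 1 := fun c => by
    have := hlimR.mul_const c
    rw [zero_mul] at this
    exact (this.eventually_lt_const one_pos).mono fun k hk => hk.le
  filter_upwards [hlim.eventually (hgen.eventually_abs_sub_le hP hπ a₀ Λ hδ₂0),
    hsm (L + Λ.card * (Fintype.card A * K)), hsm (Λ.card * (Fintype.card A * K)), hsm q,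
    eventually_gt_atTop 0] with k hk1 hk2 hk3 hk4 hk0 e
  set h : ℝ := (t : ℝ) / k with hh
  have hcast : ((t / (k : ℝ≥0) : ℝ≥0) : ℝ) = h := by simp [hh]
  have hk0' : (0 : ℝ) < k := by exact_mod_cast hk0
  have hh0 : 0 ≤ h := by positivity
  have hkh : k * h = t := by rw [hh]; field_simp
  set F : ℕ → (ℤ → A) → ℝ := fun j => (eulerStep r a₀ Λ h)^[j] f with hF
  have hFs : ∀ j, F (j + 1) = eulerStep r a₀ Λ h (F j) := fun j =>
    Function.iterate_succ_apply' _ _ _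
  have hFdep : ∀ j, DependsOn (F j) (Λ : Set ℤ) :=
    dependsOn_iterate_eulerStep r a₀ h (hdep.mono (Finset.coe_subset.2 hsub))
  have hFC : ∀ j η, |F j η| ≤ C := by
    intro j
    induction j with
    | zero => exact hC
    | succ j ih => rw [hFs]; exact hr.abs_eulerStep_le a₀ hh0 hk3 ih
  have hq1 : 1 - h * (κ - lam) ≤ Real.exp (h * q) := by
    have h1 : -(h * (κ - lam)) ≤ h * q := by
      have := mul_le_mul_of_nonneg_left (neg_le_abs (κ - lam)) hh0
      linarith
    have h2 := Real.add_one_le_exp (h * q)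
    linarith
  have hq0 : 0 ≤ 1 - h * (κ - lam) := by
    have := mul_le_mul_of_nonneg_left (le_abs_self (κ - lam)) hh0
    linarith
  have hFosc : ∀ j, OscLe (F j) fun u => (1 - h * (κ - lam)) ^ j * a u :=
    hr.oscLe_iterate_eulerStep a₀ hh0 hk2 ha0 hq0 (hsup Λ) (hdep.mono (Finset.coe_subset.2 hsub)) hf
  have hFoscW : ∀ j < k, OscLe (F j) fun u => W * a u := by
    intro j hj
    refine (hFosc j).mono fun u => mul_le_mul_of_nonneg_right ?_ (ha0 u)
    calc (1 - h * (κ - lam)) ^ j ≤ Real.exp (h * q) ^ j := pow_le_pow_left₀ hq0 hq1 j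
      _ ≤ Real.exp (h * q) ^ k :=
          pow_le_pow_right₀ (Real.one_le_exp (mul_nonneg hh0 (abs_nonneg _))) hj.le
      _ = W := by rw [← Real.exp_nat_mul, hW, ← mul_assoc, hkh]
  have hstep : ∀ j < k, ∀ e, |transOp P (t / k) (fun e => F j (π e)) e - F (j + 1) (π e)| ≤
      h * (δ₂ * C + W * δ₁) := by
    intro j hj e
    have h1 := hk1 (F j) C (hFdep j) (hFC j) e
    rw [hcast] at h1
    have h2 : |localGen r Λ (F j) (π e) -
        localGen (fun x a η => r x a (freeze a₀ Λ η)) Λ (F j) (π e)| ≤ W * δ₁ := by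
      refine (abs_localGen_sub_le (hFoscW j hj) _ _ _ _).trans ?_
      simp only [mul_assoc, ← Finset.mul_sum]
      exact mul_le_mul_of_nonneg_left (hΛ _) hW0.le
    have h3 : |h * localGen r Λ (F j) (π e) -
        h * localGen (fun x a η => r x a (freeze a₀ Λ η)) Λ (F j) (π e)| ≤ h * (W * δ₁) := by
      rw [← mul_sub, abs_mul, abs_of_nonneg hh0]
      exact mul_le_mul_of_nonneg_left h2 hh0
    rw [hFs, eulerStep]
    have h4 := abs_sub_le (transOp P (t / k) (fun e => F j (π e)) e)
      (F j (π e) + h * localGen r Λ (F j) (π e))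
      (F j (π e) + h * localGen (fun x a η => r x a (freeze a₀ Λ η)) Λ (F j) (π e))
    rw [add_sub_add_left_eq_sub] at h4
    linarith
  have hmain := abs_transOp_nsmul_sub_le hP (t / k) k (fun j e => F j (π e))
    (fun j => (measurable_of_dependsOn (hFdep j)).comp hπ) (fun j e => hFC j _) hstep e
  have hkt : (k : ℝ≥0) * (t / k) = t := by
    have : (k : ℝ≥0) ≠ 0 := by exact_mod_cast hk0.ne'
    field_simp
  rw [hkt] at hmain
  refine hmain.trans ?_
  rw [← mul_assoc, hkh]
  have e1 : W * δ₁ = δ / (2 * (t + 1)) := by rw [hδ₁]; field_simp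
  have e2 : δ₂ * C ≤ δ / (2 * (t + 1)) := by
    calc δ₂ * C ≤ δ₂ * (C + 1) := by nlinarith
      _ = _ := by rw [hδ₂]; field_simp
  calc (t : ℝ) * (δ₂ * C + W * δ₁) ≤ t * (δ / (2 * (t + 1)) + δ / (2 * (t + 1))) := by
        rw [e1]; exact mul_le_mul_of_nonneg_left (by linarith) t.2
    _ = δ * (t / (t + 1)) := by field_simp; ring
    _ ≤ δ * 1 := by
        refine mul_le_mul_of_nonneg_left ?_ hδ.le
        rw [div_le_one (by positivity)]
        linarith
    _ = δ := mul_one δ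

end Approximation

/-! ### Supersolutions of the influence matrix -/

/-- Take the Neumann series `β = Σ_k lam⁻¹ ^ k * b k`, with `b k` the `k`-fold convolution power of
`G` applied to the unit mass at 0. Convolution with `G` shifts the index, so it gives `lam` times
the series without its zeroth term. The mass is geometric with ratio below 1, and the zeroth term
gives `β 0 ≥ 1`. -/
lemma ENNReal.exists_supersolution (G : ℤ → ℝ≥0∞) {lam : ℝ≥0∞} (hlam : ∑' x, G x < lam)
    (hlam' : lam ≠ ∞) :
    ∃ β : ℤ → ℝ≥0∞, ∑' u, β u ≠ ∞ ∧ 1 ≤ β 0 ∧ ∀ u, ∑' x, G (u - x) * β x ≤ lam * β u := by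
  set M := ∑' x, G x with hM
  have hlam0 : lam ≠ 0 := (pos_of_gt hlam).ne'
  let b : ℕ → ℤ → ℝ≥0∞ := fun k => Nat.rec (Pi.single 0 1) (fun _ f u => ∑' x, G (u - x) * f x) k
  have hb0 : b 0 = Pi.single 0 1 := rfl
  have hbs : ∀ k u, b (k + 1) u = ∑' x, G (u - x) * b k x := fun _ _ => rfl
  have hbsum : ∀ k, ∑' u, b k u = M ^ k := by
    intro k
    induction k with
    | zero => rw [hb0, tsum_pi_single, pow_zero]
    | succ k ih =>
      simp only [hbs]
      rw [ENNReal.tsum_comm]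
      have : ∀ x, ∑' u, G (u - x) * b k x = M * b k x := fun x => by
        have h : ∑' u, G (u - x) = M := (Equiv.subRight x).tsum_eq G
        rw [ENNReal.tsum_mul_right, h]
      simp only [this]
      rw [ENNReal.tsum_mul_left, ih, pow_succ']
  refine ⟨fun u => ∑' k, lam⁻¹ ^ k * b k u, ?_, ?_, fun u => ?_⟩
  · rw [ENNReal.tsum_comm]
    simp only [ENNReal.tsum_mul_left, hbsum, ← mul_pow]
    rw [ENNReal.tsum_geometric]
    refine ENNReal.inv_ne_top.2 (tsub_pos_of_lt ?_).ne'
    rw [mul_comm, ← div_eq_mul_inv]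
    exact (ENNReal.div_lt_iff (Or.inl hlam0) (Or.inl hlam')).2 (by simpa using hlam)
  · calc (1 : ℝ≥0∞) = lam⁻¹ ^ 0 * b 0 0 := by simp [hb0]
      _ ≤ _ := ENNReal.le_tsum 0
  · calc ∑' x, G (u - x) * ∑' k, lam⁻¹ ^ k * b k x
        = ∑' k, lam⁻¹ ^ k * b (k + 1) u := by
          simp only [← ENNReal.tsum_mul_left, hbs]
          rw [ENNReal.tsum_comm]
          exact tsum_congr fun k => tsum_congr fun x => by ring
      _ = ∑' k, lam * (lam⁻¹ ^ (k + 1) * b (k + 1) u) := by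
          refine tsum_congr fun k => ?_
          rw [pow_succ', ← mul_assoc, ← mul_assoc, ENNReal.mul_inv_cancel hlam0 hlam', one_mul]
      _ = lam * ∑' k, lam⁻¹ ^ (k + 1) * b (k + 1) u := ENNReal.tsum_mul_left
      _ ≤ lam * ∑' k, lam⁻¹ ^ k * b k u := by
          exact mul_le_mul' le_rfl (ENNReal.tsum_comp_le_tsum_of_injective
            (add_left_injective 1) fun k => lam⁻¹ ^ k * b k u)

/-- If `lam` exceeds the total mass of `G`, then convolution with `G` has a summable
`lam`-supersolution. -/
lemma exists_supersolution {G : ℤ → ℝ} (hG : Summable G) (hG0 : ∀ x, 0 ≤ G x) {lam : ℝ}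
    (hlam : ∑' x, G x < lam) :
    ∃ β : ℤ → ℝ, Summable β ∧ (∀ u, 0 ≤ β u) ∧ 1 ≤ β 0 ∧
      ∀ (Λ : Finset ℤ) u, ∑ x ∈ Λ, G (u - x) * β x ≤ lam * β u := by
  have hlam0 : 0 < lam := (tsum_nonneg hG0).trans_lt hlam
  have h1 : ∑' x, ENNReal.ofReal (G x) < ENNReal.ofReal lam := by
    rw [← ENNReal.ofReal_tsum_of_nonneg hG0 hG]
    exact (ENNReal.ofReal_lt_ofReal_iff hlam0).2 hlam
  obtain ⟨β, hβ, hβ0, hβs⟩ := ENNReal.exists_supersolution _ h1 ENNReal.ofReal_ne_top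
  have hfin : ∀ u, β u ≠ ∞ := ENNReal.ne_top_of_tsum_ne_top hβ
  refine ⟨fun u => (β u).toReal, ENNReal.summable_toReal hβ, fun u => ENNReal.toReal_nonneg, ?_,
    fun Λ u => ?_⟩
  · simpa using ENNReal.toReal_mono (hfin 0) hβ0
  · have h2 : ∑ x ∈ Λ, ENNReal.ofReal (G (u - x)) * β x ≤ ENNReal.ofReal lam * β u :=
      (ENNReal.sum_le_tsum Λ).trans (hβs u)
    have h3 := ENNReal.toReal_mono (ENNReal.mul_ne_top ENNReal.ofReal_ne_top (hfin u)) h2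
    rw [ENNReal.toReal_sum fun x _ => ENNReal.mul_ne_top ENNReal.ofReal_ne_top (hfin x),
      ENNReal.toReal_mul, ENNReal.toReal_ofReal hlam0.le] at h3
    simpa only [ENNReal.toReal_mul, ENNReal.toReal_ofReal (hG0 _)] using h3

/-- The supersolution inequality is linear and invariant under translation, so it survives
nonnegative combinations of translates. -/
lemma sum_supersolution {G β : ℤ → ℝ} {lam : ℝ}
    (hβ : ∀ (Λ : Finset ℤ) u, ∑ x ∈ Λ, G (u - x) * β x ≤ lam * β u) (T : Finset ℤ) {w : ℤ → ℝ}
    (hw : ∀ x, 0 ≤ w x) (Λ : Finset ℤ) (u : ℤ) :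
    ∑ x ∈ Λ, G (u - x) * ∑ z ∈ T, w z * β (x - z) ≤ lam * ∑ z ∈ T, w z * β (u - z) := by
  calc ∑ x ∈ Λ, G (u - x) * ∑ z ∈ T, w z * β (x - z)
      = ∑ z ∈ T, w z * ∑ x ∈ Λ, G (u - x) * β (x - z) := by
        simp only [Finset.mul_sum]
        rw [Finset.sum_comm]
        exact Finset.sum_congr rfl fun z _ => Finset.sum_congr rfl fun x _ => by ring
    _ ≤ ∑ z ∈ T, w z * (lam * β (u - z)) := by
        refine Finset.sum_le_sum fun z _ => mul_le_mul_of_nonneg_left ?_ (hw z)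
        have h := hβ (Λ.map (Equiv.subRight z).toEmbedding) (u - z)
        rw [Finset.sum_map] at h
        simpa using h
    _ = _ := by
        rw [Finset.mul_sum]
        exact Finset.sum_congr rfl fun z _ => by ring

/-! ### Uniqueness and contraction of oscillations -/

section Uniqueness

variable {A : Type} [Fintype A] {r : ℤ → A → (ℤ → A) → ℝ} {κ L K : ℝ}
  {E : Type} [TopologicalSpace E] [MeasurableSpace E] {P : Kernel E (CadlagPath E)}

/-- Translates of β placed on the finite support dominate the oscillations of `f`, since `β 0 ≥ 1`
and no oscillation exceeds `2 * C`. For uniqueness the size of `lam` is irrelevant, so the total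
mass plus 1 will do. -/
lemma exists_oscLe_supersolution [Nonempty A] {G : ℤ → ℝ} (hG : Summable G) (hG0 : ∀ x, 0 ≤ G x)
    {Λ : Finset ℤ} {f : (ℤ → A) → ℝ} (hf : DependsOn f (Λ : Set ℤ)) :
    ∃ (a : ℤ → ℝ) (lam : ℝ), Summable a ∧ (∀ x, 0 ≤ a x) ∧
      (∀ (Λ : Finset ℤ) u, ∑ x ∈ Λ.erase u, G (u - x) * a x ≤ lam * a u) ∧ OscLe f a := by
  obtain ⟨β, hβ, hβ0, hβ1, hβs⟩ := exists_supersolution hG hG0 (lt_add_one (∑' x, G x))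
  obtain ⟨C, hC0, hC⟩ := exists_bound_of_dependsOn hf
  refine ⟨fun u => ∑ z ∈ Λ, (2 * C) * β (u - z), _, ?_, fun u => ?_,
    fun Λ' u => sum_supersolution hβs Λ (w := fun _ => 2 * C) (fun _ => by positivity) _ u, ?_⟩
  · exact summable_sum fun z _ => ((Equiv.subRight z).summable_iff.2 hβ).mul_left _
  · exact Finset.sum_nonneg fun z _ => mul_nonneg (by positivity) (hβ0 _)
  · intro u η ζ h
    by_cases hu : u ∈ Λ
    · calc |f η - f ζ| ≤ |f η| + |f ζ| := abs_sub _ _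
        _ ≤ 2 * C := by linarith [hC η, hC ζ]
        _ ≤ 2 * C * β (u - u) := by rw [sub_self]; nlinarith
        _ ≤ _ := Finset.single_le_sum (f := fun z => 2 * C * β (u - z))
            (fun z _ => mul_nonneg (by positivity) (hβ0 _)) hu
    · rw [hf fun x hx => h x (by rintro rfl; exact hu hx), sub_self, abs_zero]
      exact Finset.sum_nonneg fun z _ => mul_nonneg (by positivity) (hβ0 _)

/-- The one-dimensional marginals are determined by the jump rates. -/
theorem HasJumpRate.map_eval_eq [UniformSpace A] [MeasurableSpace A] [MeasurableSingletonClass A]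
    {E' : Type} [TopologicalSpace E'] [MeasurableSpace E'] {P' : Kernel E' (CadlagPath E')}
    (hP : IsFellerProcess P) {π : E → ℤ → A} (hπ : Measurable π) (hgen : HasJumpRate P π r)
    (hP' : IsFellerProcess P') {π' : E' → ℤ → A} (hπ' : Measurable π')
    (hgen' : HasJumpRate P' π' r) {G : ℤ → ℝ} (hG : Summable G) (hG0 : ∀ x, 0 ≤ G x)
    (hr : IsJumpRate r (fun x u => G (u - x)) κ L K) (hrc : ∀ x a, Continuous (r x a))
    {e : E} {e' : E'} (he : π e = π' e') (t : ℝ≥0) :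
    (P e).map (fun ω => π (ω.1 t)) = (P' e').map fun ω => π' (ω.1 t) := by
  have := hP.prob e
  have := hP'.prob e'
  have hm : Measurable fun ω : CadlagPath E => π (ω.1 t) := hπ.comp (measurable_eval t)
  have hm' : Measurable fun ω : CadlagPath E' => π' (ω.1 t) := hπ'.comp (measurable_eval t)
  have := Measure.isProbabilityMeasure_map (μ := P e) hm.aemeasurable
  have := Measure.isProbabilityMeasure_map (μ := P' e') hm'.aemeasurable
  have a₀ : A := π e 0
  have : Nonempty A := ⟨a₀⟩
  -- Both semigroups are close to the same Euler iterate evaluated at the same configuration `π e =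
  -- π' e'`.
  have key : ∀ (Λ₀ : Finset ℤ) (f : (ℤ → A) → ℝ), DependsOn f (Λ₀ : Set ℤ) →
      transOp P t (fun e => f (π e)) e = transOp P' t (fun e => f (π' e)) e' := by
    intro Λ₀ f hf
    obtain ⟨a, lam, ha, ha0, hsup, hosc⟩ := exists_oscLe_supersolution hG hG0 hf
    refine eq_of_forall_dist_le fun δ hδ => ?_
    obtain ⟨Λ, h1, h2⟩ := ((hgen.eventually_abs_transOp_sub_le hP hπ hr hrc a₀ ha ha0 hsup hf hosc
      t (half_pos hδ)).and (hgen'.eventually_abs_transOp_sub_le hP' hπ' hr hrc a₀ ha ha0 hsup hf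
      hosc t (half_pos hδ))).exists
    obtain ⟨k, h3, h4⟩ := (h1.and h2).exists
    have h5 := h3 e
    have h6 := h4 e'
    rw [he] at h5
    rw [Real.dist_eq]
    rw [abs_le] at h5 h6 ⊢
    constructor <;> linarith [h5.1, h5.2, h6.1, h6.2]
  refine ext_of_generate_finite (measurableCylinders fun _ : ℤ => A)
    generateFrom_measurableCylinders.symm isPiSystem_measurableCylinders ?_ (by simp)
  intro D hD
  obtain ⟨Λ, S, hS, rfl⟩ := (mem_measurableCylinders _).1 hD
  set D : Set (ℤ → A) := cylinder (α := fun _ : ℤ => A) Λ S with hDdef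
  have hD' : MeasurableSet D := .of_mem_measurableCylinders hD
  have hdep : DependsOn (D.indicator fun _ => (1 : ℝ)) (Λ : Set ℤ) := by
    intro η ζ h
    have : Λ.restrict η = Λ.restrict ζ := funext fun i => h i i.2
    have : η ∈ D ↔ ζ ∈ D := by rw [hDdef, mem_cylinder, mem_cylinder, this]
    by_cases hη : η ∈ D
    · simp [hη, this.1 hη]
    · simp [hη, mt this.2 hη]
  have h := key Λ _ hdep
  have e1 : transOp P t (fun e => D.indicator (fun _ => (1 : ℝ)) (π e)) e =
      ((P e).map fun ω => π (ω.1 t)).real D := by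
    rw [← integral_indicator_one hD', integral_map hm.aemeasurable
      (measurable_one.indicator hD').aestronglyMeasurable]
    rfl
  have e2 : transOp P' t (fun e => D.indicator (fun _ => (1 : ℝ)) (π' e)) e' =
      ((P' e').map fun ω => π' (ω.1 t)).real D := by
    rw [← integral_indicator_one hD', integral_map hm'.aemeasurable
      (measurable_one.indicator hD').aestronglyMeasurable]
    rfl
  rw [e1, e2] at h
  exact (measureReal_eq_measureReal_iff).1 h

/-- The transition semigroup contracts oscillations. -/
theorem HasJumpRate.oscLe_transOp [UniformSpace A] [MeasurableSpace A]
    [MeasurableSingletonClass A] [BorelSpace (ℤ → A)] {P : Kernel (ℤ → A) (CadlagPath (ℤ → A))}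
    (hP : IsFellerProcess P) (hgen : HasJumpRate P id r) {g : ℤ → ℤ → ℝ}
    (hr : IsJumpRate r g κ L K) (hrc : ∀ x a, Continuous (r x a)) (a₀ : A) {a : ℤ → ℝ} {lam : ℝ}
    (ha : Summable a) (ha0 : ∀ x, 0 ≤ a x)
    (hsup : ∀ (Λ : Finset ℤ) u, ∑ x ∈ Λ.erase u, g x u * a x ≤ lam * a u)
    {f : (ℤ → A) → ℝ} (hfc : Continuous f) (hf : OscLe f a) (t : ℝ≥0) :
    OscLe (transOp P t f) fun u => Real.exp (-(κ - lam) * t) * a u := by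
  intro u η ζ hηζ
  refine le_of_forall_pos_le_add fun δ hδ => ?_
  -- At each of the two configurations, freezing `f` costs `δ / 4` and the Euler approximation costs
  -- `δ / 4`.
  obtain ⟨Λ₀, hΛ₀⟩ := (eventually_abs_sub_freeze_le a₀ hfc (δ := δ / 4) (by positivity)).exists
  set f' : (ℤ → A) → ℝ := fun η => f (freeze a₀ Λ₀ η) with hf'
  have hdep : DependsOn f' (Λ₀ : Set ℤ) := dependsOn_freeze f a₀ Λ₀
  have hosc : OscLe f' a := hf.freeze_comp a₀ Λ₀
  obtain ⟨Λ, hΛ, hsub⟩ := ((hgen.eventually_abs_transOp_sub_le hP measurable_id hr hrc a₀ ha ha0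
    hsup hdep hosc t (δ := δ / 4) (by positivity)).and (eventually_ge_atTop Λ₀)).exists
  have hlimR : Tendsto (fun k : ℕ => (t : ℝ) / k) atTop (𝓝 0) :=
    tendsto_const_div_atTop_nhds_zero_nat (t : ℝ)
  have hsm : ∀ c : ℝ, ∀ᶠ k : ℕ in atTop, (t : ℝ) / k * c ≤ 1 := fun c => by
    have := hlimR.mul_const c
    rw [zero_mul] at this
    exact (this.eventually_lt_const one_pos).mono fun k hk => hk.le
  obtain ⟨k, hk, hk1, hk2, hk0⟩ := (hΛ.and ((hsm (L + Λ.card * (Fintype.card A * K))).and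
    ((hsm (κ - lam)).and (eventually_gt_atTop 0)))).exists
  set h : ℝ := (t : ℝ) / k with hh
  have hk0' : (0 : ℝ) < k := by exact_mod_cast hk0
  have hh0 : 0 ≤ h := by positivity
  have hkh : k * h = t := by rw [hh]; field_simp
  have hq0 : 0 ≤ 1 - h * (κ - lam) := by linarith
  have h1 := hr.oscLe_iterate_eulerStep a₀ hh0 hk1 ha0 hq0 (hsup Λ)
    (hdep.mono (Finset.coe_subset.2 hsub)) hosc k u η ζ hηζ
  have h2 : (1 - h * (κ - lam)) ^ k ≤ Real.exp (-(κ - lam) * t) := by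
    calc (1 - h * (κ - lam)) ^ k ≤ Real.exp (-(h * (κ - lam))) ^ k := by
          refine pow_le_pow_left₀ hq0 ?_ k
          have := Real.add_one_le_exp (-(h * (κ - lam)))
          linarith
      _ = Real.exp (-(κ - lam) * t) := by
          rw [← Real.exp_nat_mul, ← hkh]; congr 1; ring
  have h3 := mul_le_mul_of_nonneg_right h2 (ha0 u)
  obtain ⟨C, hC⟩ := (isCompact_range hfc.abs).bddAbove
  have hC' : ∀ η, |f η| ≤ C := fun η => hC ⟨η, rfl⟩
  have h4 : ∀ ξ, |transOp P t f ξ - transOp P t f' ξ| ≤ δ / 4 :=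
    abs_transOp_sub_le hP t hfc.measurable (measurable_of_dependsOn hdep) hC'
      (fun ξ => hC' _) hΛ₀
  have h5 := hk η
  have h6 := hk ζ
  have h7 := h4 η
  have h8 := h4 ζ
  simp only [id] at h5 h6
  rw [abs_le] at *
  constructor <;> linarith [h1.1, h1.2, h5.1, h5.2, h6.1, h6.2, h7.1, h7.2, h8.1, h8.2]

end Uniqueness

/-! ### Spin-flip rates -/

section SpinFlip

variable {c : ℤ → Config → ℝ}

lemma flipAt_same (η : Config) (x : ℤ) : flipAt η x x = !(η x) := by simp [flipAt]

lemma flipAt_of_ne (η : Config) {x y : ℤ} (h : y ≠ x) : flipAt η x y = η y := by simp [flipAt, h]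

lemma eq_or_eq_flipAt {u : ℤ} {η ζ : Config} (h : ∀ x, x ≠ u → η x = ζ x) :
    ζ = η ∨ ζ = flipAt η u := by
  by_cases hu : η u = ζ u
  · left
    funext x
    by_cases hx : x = u
    · rw [hx, hu]
    · exact (h x hx).symm
  · right
    funext x
    by_cases hx : x = u
    · rw [hx, flipAt_same]
      revert hu
      cases η u <;> cases ζ u <;> simp
    · rw [flipAt_of_ne _ hx, h x hx]

lemma shiftConfig_flipAt (y x : ℤ) (η : Config) :
    shiftConfig y (flipAt η x) = flipAt (shiftConfig y η) (x + y) := by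
  funext z
  by_cases hz : z = x + y
  · subst hz
    simp [shiftConfig, flipAt]
  · have : z - y ≠ x := fun h => hz (by omega)
    rw [flipAt_of_ne _ hz, shiftConfig, flipAt_of_ne _ this, shiftConfig]

lemma shiftConfig_add_neg (y : ℤ) (η : Config) : shiftConfig y (shiftConfig (-y) η) = η := by
  funext z
  simp [shiftConfig]

lemma shiftConfig_surjective (y : ℤ) : Function.Surjective (shiftConfig y) := fun η =>
  ⟨_, shiftConfig_add_neg y η⟩

lemma IsSpinFlipRate.apply_eq (hc : IsSpinFlipRate c) (x : ℤ) (η : Config) :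
    c x (shiftConfig x η) = c 0 η := by
  simpa using hc.shift_invariant 0 x η

lemma IsSpinFlipRate.exists_bound (hc : IsSpinFlipRate c) : ∃ K, 0 ≤ K ∧ ∀ x η, c x η ≤ K := by
  obtain ⟨K, hK⟩ := (isCompact_range (hc.continuous 0)).bddAbove
  refine ⟨K, (hc.nonneg 0 fun _ => false).trans (hK ⟨_, rfl⟩), fun x η => ?_⟩
  obtain ⟨ζ, rfl⟩ := shiftConfig_surjective x η
  rw [hc.apply_eq]
  exact hK ⟨ζ, rfl⟩

lemma IsSpinFlipRate.bddAbove (hc : IsSpinFlipRate c) (u v : ℤ) :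
    BddAbove (range fun η : Config => |c u η - c u (flipAt η v)|) := by
  obtain ⟨K, -, hK⟩ := hc.exists_bound
  refine ⟨K, ?_⟩
  rintro _ ⟨η, rfl⟩
  have h1 := hc.nonneg u η
  have h2 := hc.nonneg u (flipAt η v)
  have h3 := hK u η
  have h4 := hK u (flipAt η v)
  simp only
  rw [abs_le]
  constructor <;> linarith

lemma gammaRate_nonneg (c : ℤ → Config → ℝ) (u v : ℤ) : 0 ≤ gammaRate c u v :=
  Real.iSup_nonneg fun _ => abs_nonneg _

lemma IsSpinFlipRate.gammaRate_eq (hc : IsSpinFlipRate c) (u v : ℤ) :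
    gammaRate c u v = gammaRate c 0 (v - u) := by
  have h : ∀ η, |c u (shiftConfig u η) - c u (flipAt (shiftConfig u η) v)| =
      |c 0 η - c 0 (flipAt η (v - u))| := fun η => by
    rw [hc.apply_eq, ← hc.apply_eq u (flipAt η (v - u)), shiftConfig_flipAt, sub_add_cancel]
  simp only [gammaRate, ← h]
  exact ((shiftConfig_surjective u).iSup_comp fun η => |c u η - c u (flipAt η v)|).symm

/-- The influence of the spin at distance `y ≠ 0` on a flip rate. -/
noncomputable def influence (c : ℤ → Config → ℝ) (y : ℤ) : ℝ := if y = 0 then 0 else gammaRate c 0 y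

lemma influence_nonneg (c : ℤ → Config → ℝ) (y : ℤ) : 0 ≤ influence c y := by
  unfold influence
  split_ifs
  exacts [le_rfl, gammaRate_nonneg _ _ _]

lemma influence_eq_indicator (c : ℤ → Config → ℝ) :
    influence c = ({x : ℤ | x ≠ 0}).indicator (gammaRate c 0) := by
  funext y
  by_cases h : y = 0 <;> simp [influence, h]

lemma IsSpinFlipRate.summable_influence (hc : IsSpinFlipRate c) : Summable (influence c) := by
  rw [influence_eq_indicator, ← summable_subtype_iff_indicator]
  exact hc.summable

lemma tsum_influence (c : ℤ → Config → ℝ) : ∑' y, influence c y = rateM c := by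
  rw [influence_eq_indicator, ← tsum_subtype]
  rfl

lemma rateM_nonneg (c : ℤ → Config → ℝ) : 0 ≤ rateM c :=
  tsum_nonneg fun _ => gammaRate_nonneg _ _ _

lemma IsSpinFlipRate.abs_sub_flipAt_le (hc : IsSpinFlipRate c) {x u : ℤ} (hxu : x ≠ u)
    (η : Config) : |c x η - c x (flipAt η u)| ≤ influence c (u - x) := by
  rw [influence, if_neg (sub_ne_zero.2 hxu.symm), ← hc.gammaRate_eq]
  exact le_ciSup (hc.bddAbove x u) η

lemma IsSpinFlipRate.abs_sub_le (hc : IsSpinFlipRate c) {x u : ℤ} (hxu : x ≠ u) {η ζ : Config}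
    (h : ∀ y, y ≠ u → η y = ζ y) : |c x η - c x ζ| ≤ influence c (u - x) := by
  rcases eq_or_eq_flipAt h with rfl | rfl
  · simpa using influence_nonneg c _
  · exact hc.abs_sub_flipAt_le hxu η

lemma IsSpinFlipRate.rateEps_le (hc : IsSpinFlipRate c) (u : ℤ) (η : Config) :
    rateEps c ≤ c u η + c u (flipAt η u) := by
  obtain ⟨ζ, rfl⟩ := shiftConfig_surjective u η
  have h : flipAt (shiftConfig u ζ) u = shiftConfig u (flipAt ζ 0) := by
    rw [shiftConfig_flipAt, zero_add]
  rw [h, hc.apply_eq, hc.apply_eq]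
  refine ciInf_le ⟨0, ?_⟩ ζ
  rintro _ ⟨η, rfl⟩
  exact add_nonneg (hc.nonneg _ _) (hc.nonneg _ _)

/-- The rate at which the spin at `x` jumps to `a`. -/
noncomputable def spinJumpRate (c : ℤ → Config → ℝ) (x : ℤ) (a : Bool) (η : Config) : ℝ :=
  if a = η x then 0 else c x η

lemma IsSpinFlipRate.continuous_spinJumpRate (hc : IsSpinFlipRate c) (x : ℤ) (a : Bool) :
    Continuous (spinJumpRate c x a) := by
  have h : spinJumpRate c x a = fun η => (if a = η x then 0 else 1) * c x η := by
    funext η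
    simp only [spinJumpRate]
    split_ifs <;> simp
  rw [h]
  refine Continuous.mul (continuous_of_dependsOn (Λ := {x}) fun η ζ hηζ => ?_) (hc.continuous x)
  rw [hηζ x (by simp)]

/-- With two states, if the configurations differ only at `u`, a flip at `u` of either one makes
them equal. The on-site expression is then `2 * K - (c u η + c u (flipAt η u))` times the difference
of `F`. This gives `κ = ε`, and `L = 2 * K` makes the factor nonnegative. -/
lemma IsSpinFlipRate.isJumpRate (hc : IsSpinFlipRate c) {K : ℝ} (hK : ∀ x η, c x η ≤ K) :
    IsJumpRate (spinJumpRate c) (fun x u => influence c (u - x)) (rateEps c) (2 * K) K where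
  nonneg x a η := by
    unfold spinJumpRate
    split_ifs
    exacts [le_rfl, hc.nonneg x η]
  le x a η := by
    unfold spinJumpRate
    split_ifs
    exacts [(hc.nonneg x η).trans (hK x η), hK x η]
  influence x u hxu η ζ h := by
    have h1 := hc.abs_sub_le hxu h
    have h2 := h x hxu
    cases hb : ζ x <;> simpa [spinJumpRate, h2, hb] using h1
  onsite u η ζ F D h hD := by
    have hD0 : 0 ≤ D := by simpa using hD true true
    have hε := hc.rateEps_le u η
    have k1 := hK u η
    have k2 := hK u (flipAt η u)
    rcases eq_or_eq_flipAt h with rfl | rfl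
    · simp only [sub_self, Finset.sum_const_zero, mul_zero, add_zero, abs_zero]
      exact mul_nonneg (by linarith) hD0
    · have hd := hD (η u) (!(η u))
      have e : ∑ a, (spinJumpRate c u a η * (F a - F (η u)) -
          spinJumpRate c u a (flipAt η u) * (F a - F (flipAt η u u))) +
          2 * K * (F (η u) - F (flipAt η u u)) =
          (2 * K - (c u η + c u (flipAt η u))) * (F (η u) - F (!(η u))) := by
        rw [flipAt_same]
        cases hb : η u <;> simp [spinJumpRate, flipAt_same, hb] <;> ring
      rw [e, abs_mul, abs_of_nonneg (by linarith)]
      exact mul_le_mul (by linarith) hd (abs_nonneg _) (by linarith)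

lemma spinFlipGen_eq_localGen {Λ : Finset ℤ} {f : Config → ℝ} (hf : DependsOn f (Λ : Set ℤ))
    (η : Config) : spinFlipGen c f η = localGen (spinJumpRate c) Λ f η := by
  have h0 : ∀ x ∉ Λ, c x η * (f (flipAt η x) - f η) = 0 := by
    intro x hx
    have : f (flipAt η x) = f η := hf fun y hy => flipAt_of_ne η (by rintro rfl; exact hx hy)
    rw [this, sub_self, mul_zero]
  rw [spinFlipGen, tsum_eq_sum h0, localGen]
  refine Finset.sum_congr rfl fun x _ => ?_
  have e : Function.update η x (η x) = η := Function.update_eq_self x η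
  cases hb : η x
  · simp [spinJumpRate, flipAt, hb]
  · simp [spinJumpRate, flipAt, hb]

lemma IsSpinFlipSystem.hasJumpRate {P : Kernel Config (CadlagPath Config)}
    (hP : IsSpinFlipSystem c P) : HasJumpRate P id (spinJumpRate c) := by
  intro Λ f hf
  have := hP.generator f ⟨Λ, fun η η' h => hf fun x hx => h x hx⟩
  simpa only [id, spinFlipGen_eq_localGen hf, funext (spinFlipGen_eq_localGen (c := c) hf)] using this

end SpinFlip

/-! ### The basic coupling as a system of jumps of pairs of spins -/

section Coupling

variable {c : ℤ → Config → ℝ}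

/-- A pair of configurations as a configuration of pairs. -/
def pairConfig (p : Config × Config) : ℤ → Bool × Bool := fun x => (p.1 x, p.2 x)

lemma measurable_pairConfig : Measurable pairConfig :=
  measurable_pi_lambda _ fun x =>
    ((measurable_pi_apply x).comp measurable_fst).prodMk
      ((measurable_pi_apply x).comp measurable_snd)

/-- The rate at which a pair `s` of spins with individual flip rates `u` and `v` jumps to `a`. -/
noncomputable def pairRate (s a : Bool × Bool) (u v : ℝ) : ℝ :=
  if s.1 = s.2 then
    if a.1 = s.1 then if a.2 = s.2 then 0 else v - min u v
    else if a.2 = s.2 then u - min u v else min u v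
  else
    if a.1 = s.1 then if a.2 = s.2 then 0 else v
    else if a.2 = s.2 then u else 0

lemma pairRate_nonneg (s a : Bool × Bool) {u v : ℝ} (hu : 0 ≤ u) (hv : 0 ≤ v) :
    0 ≤ pairRate s a u v := by
  unfold pairRate
  have := min_le_left u v
  have := min_le_right u v
  have := le_min hu hv
  split_ifs <;> linarith

lemma pairRate_le (s a : Bool × Bool) {u v K : ℝ} (hu : 0 ≤ u) (hv : 0 ≤ v) (huK : u ≤ K)
    (hvK : v ≤ K) : pairRate s a u v ≤ K := by
  unfold pairRate
  have := min_le_left u v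
  have := le_min hu hv
  split_ifs <;> linarith

lemma abs_pairRate_sub_le (s a : Bool × Bool) (u v u' v' : ℝ) :
    |pairRate s a u v - pairRate s a u' v'| ≤ 2 * (|u - u'| + |v - v'|) := by
  have h0 : |min u v - min u' v'| ≤ |u - u'| + |v - v'| :=
    (abs_min_sub_min_le_max u v u' v').trans (max_le_add_of_nonneg (abs_nonneg _) (abs_nonneg _))
  have h1 := abs_nonneg (u - u')
  have h2 := abs_nonneg (v - v')
  have h3 := le_abs_self (u - u')
  have h4 := le_abs_self (v - v')
  have h5 := neg_abs_le (u - u')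
  have h6 := neg_abs_le (v - v')
  rw [abs_le] at h0
  unfold pairRate
  rw [abs_le]
  split_ifs <;> constructor <;> linarith [h0.1, h0.2]

lemma continuous_pairRate (s a : Bool × Bool) :
    Continuous fun z : ℝ × ℝ => pairRate s a z.1 z.2 := by
  unfold pairRate
  split_ifs <;> fun_prop

/-- The jump rates of the basic coupling. -/
noncomputable def couplingJumpRate (c : ℤ → Config → ℝ) (x : ℤ) (a : Bool × Bool) (η : ℤ → Bool × Bool) : ℝ :=
  pairRate (η x) a (c x fun y => (η y).1) (c x fun y => (η y).2)

lemma IsSpinFlipRate.continuous_couplingJumpRate (hc : IsSpinFlipRate c) (x : ℤ)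
    (a : Bool × Bool) : Continuous (couplingJumpRate c x a) := by
  rw [continuous_iff_continuousAt]
  intro η
  have h1 : Continuous fun η : ℤ → Bool × Bool => c x fun y => (η y).1 :=
    (hc.continuous x).comp (by fun_prop)
  have h2 : Continuous fun η : ℤ → Bool × Bool => c x fun y => (η y).2 :=
    (hc.continuous x).comp (by fun_prop)
  have h3 : Continuous fun ζ : ℤ → Bool × Bool =>
      pairRate (η x) a (c x fun y => (ζ y).1) (c x fun y => (ζ y).2) :=
    (continuous_pairRate (η x) a).comp (h1.prodMk h2)
  refine h3.continuousAt.congr ?_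
  have : ∀ᶠ ζ : ℤ → Bool × Bool in 𝓝 η, ζ x ∈ ({η x} : Set (Bool × Bool)) :=
    (continuous_apply x).continuousAt ((isOpen_discrete ({η x} : Set (Bool × Bool))).mem_nhds rfl)
  filter_upwards [this] with ζ hζ
  rw [couplingJumpRate, mem_singleton_iff.1 hζ]

/-- Crude constants: 16 is four target states times `2 * (1 + 1)`, and `8 * K` is four states times
two terms of size `K`. The negative κ gives no contraction, but the coupling rates serve only for
uniqueness. -/
lemma IsSpinFlipRate.isJumpRate_coupling (hc : IsSpinFlipRate c) {K : ℝ}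
    (hK : ∀ x η, c x η ≤ K) :
    IsJumpRate (couplingJumpRate c) (fun x u => 16 * influence c (u - x)) (-(8 * K)) 0 K where
  nonneg x a η := pairRate_nonneg _ _ (hc.nonneg _ _) (hc.nonneg _ _)
  le x a η := pairRate_le _ _ (hc.nonneg _ _) (hc.nonneg _ _) (hK _ _) (hK _ _)
  influence x u hxu η ζ h := by
    have h1 : |c x (fun y => (η y).1) - c x fun y => (ζ y).1| ≤ influence c (u - x) :=
      hc.abs_sub_le hxu fun y hy => by rw [h y hy]
    have h2 : |c x (fun y => (η y).2) - c x fun y => (ζ y).2| ≤ influence c (u - x) :=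
      hc.abs_sub_le hxu fun y hy => by rw [h y hy]
    calc ∑ a, |couplingJumpRate c x a η - couplingJumpRate c x a ζ|
        ≤ ∑ _a : Bool × Bool, 2 * (influence c (u - x) + influence c (u - x)) := by
          refine Finset.sum_le_sum fun a _ => ?_
          simp only [couplingJumpRate, h x hxu]
          refine (abs_pairRate_sub_le _ _ _ _ _ _).trans ?_
          linarith
      _ = 16 * influence c (u - x) := by simp; ring
  onsite u η ζ F D h hD := by
    have hD0 : 0 ≤ D := by simpa using hD default default
    have hb : ∀ (a : Bool × Bool) (ξ : ℤ → Bool × Bool),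
        |couplingJumpRate c u a ξ * (F a - F (ξ u))| ≤ K * D := by
      intro a ξ
      have h0 : 0 ≤ couplingJumpRate c u a ξ := pairRate_nonneg _ _ (hc.nonneg _ _) (hc.nonneg _ _)
      have h1 : couplingJumpRate c u a ξ ≤ K :=
        pairRate_le _ _ (hc.nonneg _ _) (hc.nonneg _ _) (hK _ _) (hK _ _)
      rw [abs_mul, abs_of_nonneg h0]
      exact mul_le_mul h1 (hD _ _) (abs_nonneg _) (h0.trans h1)
    rw [zero_mul, add_zero]
    calc _ ≤ ∑ _a : Bool × Bool, (K * D + K * D) := by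
          refine (Finset.abs_sum_le_sum_abs _ _).trans (Finset.sum_le_sum fun a _ => ?_)
          exact (abs_sub _ _).trans (add_le_add (hb a η) (hb a ζ))
      _ = (0 - -(8 * K)) * D := by simp; ring

lemma basicCouplingGen_eq_sum {Λ : Finset ℤ} {f : Config × Config → ℝ}
    (hf : ∀ p q : Config × Config, (∀ x ∈ Λ, p.1 x = q.1 x ∧ p.2 x = q.2 x) → f p = f q)
    (p : Config × Config) :
    basicCouplingGen c f p = ∑ x ∈ Λ, basicCouplingGenAt c f x p := by
  refine tsum_eq_sum fun x hx => ?_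
  have hne : ∀ y ∈ Λ, y ≠ x := by rintro y hy rfl; exact hx hy
  have h1 : f (flipAt p.1 x, flipAt p.2 x) = f p :=
    hf _ _ fun y hy => ⟨flipAt_of_ne _ (hne y hy), flipAt_of_ne _ (hne y hy)⟩
  have h2 : f (flipAt p.1 x, p.2) = f p := hf _ _ fun y hy => ⟨flipAt_of_ne _ (hne y hy), rfl⟩
  have h3 : f (p.1, flipAt p.2 x) = f p := hf _ _ fun y hy => ⟨rfl, flipAt_of_ne _ (hne y hy)⟩
  simp [basicCouplingGenAt, h1, h2, h3]

variable {Q : Kernel (Config × Config) (CadlagPath (Config × Config))}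

lemma update_pairConfig (p : Config × Config) (x : ℤ) (a : Bool × Bool) :
    Function.update (pairConfig p) x a =
      pairConfig (Function.update p.1 x a.1, Function.update p.2 x a.2) := by
  funext y
  rcases eq_or_ne y x with rfl | h
  · simp [pairConfig]
  · simp [pairConfig, h]

lemma IsBasicCoupling.hasJumpRate (hQ : IsBasicCoupling c Q) :
    HasJumpRate Q pairConfig (couplingJumpRate c) := by
  intro Λ f hf
  have hcyl : ∀ p q : Config × Config, (∀ x ∈ Λ, p.1 x = q.1 x ∧ p.2 x = q.2 x) →
      f (pairConfig p) = f (pairConfig q) := fun p q h =>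
    hf fun x hx => Prod.ext (h x hx).1 (h x hx).2
  have e : (basicCouplingGen c fun p => f (pairConfig p)) =
      fun p => localGen (couplingJumpRate c) Λ f (pairConfig p) := by
    funext p
    rw [basicCouplingGen_eq_sum hcyl, localGen]
    refine Finset.sum_congr rfl fun x _ => ?_
    have e1 : Function.update p.1 x (p.1 x) = p.1 := Function.update_eq_self x _
    have e2 : Function.update p.2 x (p.2 x) = p.2 := Function.update_eq_self x _
    simp only [update_pairConfig, Fintype.sum_prod_type, Fintype.sum_bool]
    cases hb1 : p.1 x <;> cases hb2 : p.2 x <;>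
      simp only [hb1] at e1 <;> simp only [hb2] at e2 <;>
      simp [basicCouplingGenAt, couplingJumpRate, pairRate, pairConfig, flipAt, hb1, hb2,
        e1, e2] <;> ring
  rw [← e]
  exact hQ.generator _ ⟨Λ, hcyl⟩

/-- The rates of joint and of solitary flips of the first spin add up to its own flip rate, so the
minimum cancels on functions of the first copy. -/
lemma IsBasicCoupling.hasJumpRate_fst (hQ : IsBasicCoupling c Q) :
    HasJumpRate Q Prod.fst (spinJumpRate c) := by
  intro Λ f hf
  have hcyl : ∀ p q : Config × Config, (∀ x ∈ Λ, p.1 x = q.1 x ∧ p.2 x = q.2 x) →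
      f p.1 = f q.1 := fun p q h => hf fun x hx => (h x hx).1
  have e : (basicCouplingGen c fun p => f p.1) =
      fun p => localGen (spinJumpRate c) Λ f p.1 := by
    funext p
    rw [basicCouplingGen_eq_sum hcyl, localGen]
    refine Finset.sum_congr rfl fun x _ => ?_
    have e1 : Function.update p.1 x (p.1 x) = p.1 := Function.update_eq_self x _
    cases hb1 : p.1 x <;> cases hb2 : p.2 x <;> simp only [hb1] at e1 <;>
      simp [basicCouplingGenAt, spinJumpRate, flipAt, hb1, hb2] <;> ring
  rw [← e]
  exact hQ.generator _ ⟨Λ, hcyl⟩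

lemma IsBasicCoupling.hasJumpRate_snd (hQ : IsBasicCoupling c Q) :
    HasJumpRate Q Prod.snd (spinJumpRate c) := by
  intro Λ f hf
  have hcyl : ∀ p q : Config × Config, (∀ x ∈ Λ, p.1 x = q.1 x ∧ p.2 x = q.2 x) →
      f p.2 = f q.2 := fun p q h => hf fun x hx => (h x hx).2
  have e : (basicCouplingGen c fun p => f p.2) =
      fun p => localGen (spinJumpRate c) Λ f p.2 := by
    funext p
    rw [basicCouplingGen_eq_sum hcyl, localGen]
    refine Finset.sum_congr rfl fun x _ => ?_
    have e1 : Function.update p.2 x (p.2 x) = p.2 := Function.update_eq_self x _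
    cases hb1 : p.1 x <;> cases hb2 : p.2 x <;> simp only [hb2] at e1 <;>
      simp [basicCouplingGenAt, spinJumpRate, flipAt, hb1, hb2] <;> ring
  rw [← e]
  exact hQ.generator _ ⟨Λ, hcyl⟩

/-- The first marginal of the basic coupling. -/
lemma IsBasicCoupling.map_fst (hc : IsSpinFlipRate c) {P : Kernel Config (CadlagPath Config)}
    (hP : IsSpinFlipSystem c P) (hQ : IsBasicCoupling c Q) (p : Config × Config) :
    (Q p).map (mapPath Prod.fst continuous_fst) = P p.1 := by
  obtain ⟨K, -, hK⟩ := hc.exists_bound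
  refine hQ.feller.map_mapPath hP.feller continuous_fst measurable_fst (fun p t => ?_) p
  exact HasJumpRate.map_eval_eq hQ.feller measurable_fst hQ.hasJumpRate_fst hP.feller
    measurable_id hP.hasJumpRate hc.summable_influence (influence_nonneg c) (hc.isJumpRate hK)
    hc.continuous_spinJumpRate rfl t

/-- The second marginal of the basic coupling. -/
lemma IsBasicCoupling.map_snd (hc : IsSpinFlipRate c) {P : Kernel Config (CadlagPath Config)}
    (hP : IsSpinFlipSystem c P) (hQ : IsBasicCoupling c Q) (p : Config × Config) :
    (Q p).map (mapPath Prod.snd continuous_snd) = P p.2 := by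
  obtain ⟨K, -, hK⟩ := hc.exists_bound
  refine hQ.feller.map_mapPath hP.feller continuous_snd measurable_snd (fun p t => ?_) p
  exact HasJumpRate.map_eval_eq hQ.feller measurable_snd hQ.hasJumpRate_snd hP.feller
    measurable_id hP.hasJumpRate hc.summable_influence (influence_nonneg c) (hc.isJumpRate hK)
    hc.continuous_spinJumpRate rfl t

/-- The spatial shift of a pair of configurations. -/
def shiftPair (y : ℤ) (p : Config × Config) : Config × Config :=
  (shiftConfig y p.1, shiftConfig y p.2)

lemma continuous_shiftPair (y : ℤ) : Continuous (shiftPair y) := by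
  unfold shiftPair shiftConfig
  fun_prop

lemma measurable_shiftPair (y : ℤ) : Measurable (shiftPair y) := (continuous_shiftPair y).measurable

lemma IsSpinFlipRate.couplingJumpRate_shift (hc : IsSpinFlipRate c) (x y : ℤ) (a : Bool × Bool)
    (p : Config × Config) :
    couplingJumpRate c (x + y) a (pairConfig (shiftPair y p)) =
      couplingJumpRate c x a (pairConfig p) := by
  have h1 := hc.shift_invariant x y p.1
  have h2 := hc.shift_invariant x y p.2
  have h3 : x + y - y = x := by ring
  simp only [couplingJumpRate, pairConfig, shiftPair]
  rw [show (fun z => shiftConfig y p.1 z) = shiftConfig y p.1 from rfl, h1, h2]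
  simp only [shiftConfig, h3]

/-- A cylinder function of the shifted pair is a cylinder function of the pair over the translated
set, and the rates are shift-invariant. The shifted process thus has the same jump rates, and
uniqueness identifies its law. -/
lemma IsBasicCoupling.hasJumpRate_shiftPair (hc : IsSpinFlipRate c) (hQ : IsBasicCoupling c Q)
    (y : ℤ) : HasJumpRate Q (fun p => pairConfig (shiftPair y p)) (couplingJumpRate c) := by
  intro Λ f hf
  set Λ' := Λ.map (Equiv.subRight y).toEmbedding with hΛ'
  set f' : (ℤ → Bool × Bool) → ℝ := fun η => f fun x => η (x - y) with hf'
  have hdep : DependsOn f' (Λ' : Set ℤ) := by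
    intro η ζ h
    refine hf fun x hx => h _ ?_
    simp only [hΛ', Finset.coe_map, mem_image]
    exact ⟨x, hx, rfl⟩
  have e : ∀ p, localGen (couplingJumpRate c) Λ f (pairConfig (shiftPair y p)) =
      localGen (couplingJumpRate c) Λ' f' (pairConfig p) := by
    intro p
    rw [localGen, localGen, hΛ', Finset.sum_map]
    refine Finset.sum_congr rfl fun x _ => Finset.sum_congr rfl fun a _ => ?_
    have h1 := hc.couplingJumpRate_shift (x - y) y a p
    rw [sub_add_cancel] at h1
    have h2 : (fun z => Function.update (pairConfig p) (x - y) a (z - y)) =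
        Function.update (pairConfig (shiftPair y p)) x a := by
      funext z
      rcases eq_or_ne z x with rfl | hz
      · simp
      · rw [Function.update_of_ne hz, Function.update_of_ne (by omega)]
        rfl
    simp only [Equiv.coe_toEmbedding, Equiv.subRight_apply, h1, hf', h2]
    rfl
  simp only [e]
  exact hQ.hasJumpRate Λ' f' hdep

/-- The basic coupling is invariant under spatial shifts. -/
lemma IsBasicCoupling.map_shiftPair (hc : IsSpinFlipRate c) (hQ : IsBasicCoupling c Q) (y : ℤ)
    (p : Config × Config) :
    (Q p).map (mapPath (shiftPair y) (continuous_shiftPair y)) = Q (shiftPair y p) := by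
  obtain ⟨K, -, hK⟩ := hc.exists_bound
  refine hQ.feller.map_mapPath hQ.feller (continuous_shiftPair y) (measurable_shiftPair y)
    (fun p t => ?_) p
  have h := HasJumpRate.map_eval_eq hQ.feller
    (measurable_pairConfig.comp (measurable_shiftPair y)) (hQ.hasJumpRate_shiftPair hc y)
    hQ.feller measurable_pairConfig hQ.hasJumpRate (hc.summable_influence.mul_left 16)
    (fun x => mul_nonneg (by norm_num) (influence_nonneg c x)) (hc.isJumpRate_coupling hK)
    hc.continuous_couplingJumpRate (e := p) (e' := shiftPair y p) rfl t
  set unpair : (ℤ → Bool × Bool) → Config × Config :=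
    fun η => (fun x => (η x).1, fun x => (η x).2) with hunpair
  have hum : Measurable unpair :=
    (measurable_pi_lambda _ fun x => measurable_fst.comp (measurable_pi_apply x)).prodMk
      (measurable_pi_lambda _ fun x => measurable_snd.comp (measurable_pi_apply x))
  have h' := congrArg (Measure.map unpair) h
  have hm₁ : Measurable fun ω : CadlagPath (Config × Config) =>
      (pairConfig ∘ shiftPair y) (ω.1 t) :=
    (measurable_pairConfig.comp (measurable_shiftPair y)).comp (measurable_eval t)
  have hm₂ : Measurable fun ω : CadlagPath (Config × Config) => pairConfig (ω.1 t) :=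
    measurable_pairConfig.comp (measurable_eval t)
  rw [Measure.map_map hum hm₁, Measure.map_map hum hm₂] at h'
  exact h'

end Coupling

/-! ### The cone and the cone-mixing coefficient -/

section Cone

lemma cot_pos_of_mem {θ : ℝ} (hθ : θ ∈ Ioo 0 (Real.pi / 2)) : 0 < Real.cot θ := by
  rw [Real.cot_eq_cos_div_sin]
  have h1 := Real.cos_pos_of_mem_Ioo ⟨by linarith [hθ.1, Real.pi_pos], hθ.2⟩
  have h2 := Real.sin_pos_of_mem_Ioo ⟨hθ.1, by linarith [hθ.2, Real.pi_pos]⟩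
  positivity

/-- The time at which the site `x` enters the cone. -/
noncomputable def entryTime (θ : ℝ) (t : ℝ≥0) (x : ℤ) : ℝ≥0 :=
  t + (|(x : ℝ)| * Real.cot θ).toNNReal

/-- With `d` the time elapsed since the tip, squaring the cone condition gives $x^2\cos^2\theta\le
d^2\sin^2\theta$, that is $|x|\cot\theta\le d$. -/
lemma entryTime_le {θ : ℝ} (hθ : θ ∈ Ioo 0 (Real.pi / 2)) {t : ℝ≥0} {u : ℤ × ℝ≥0}
    (hu : u ∈ spaceTimeCone θ t) : entryTime θ t u.1 ≤ u.2 := by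
  have hcos := Real.cos_pos_of_mem_Ioo ⟨by linarith [hθ.1, Real.pi_pos], hθ.2⟩
  have hsin := Real.sin_pos_of_mem_Ioo ⟨hθ.1, by linarith [hθ.2, Real.pi_pos]⟩
  set d : ℝ := (u.2 : ℝ) - t with hd
  have hv : spaceTime u - (t : ℝ) • timeDir = !₂[(u.1 : ℝ), d] := by
    ext i
    fin_cases i <;> simp [spaceTime, timeDir, hd]
  have hin : inner ℝ (!₂[(u.1 : ℝ), d] : EuclideanSpace ℝ (Fin 2)) timeDir = d := by
    simp [timeDir, PiLp.inner_apply, Fin.sum_univ_two]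
  have hu' : ‖(!₂[(u.1 : ℝ), d] : EuclideanSpace ℝ (Fin 2))‖ * Real.cos θ ≤ d := by
    simp only [spaceTimeCone, mem_ofPred_eq, hv, hin] at hu
    exact hu
  have hd0 : 0 ≤ d := (mul_nonneg (norm_nonneg _) hcos.le).trans hu'
  have hsq : ‖(!₂[(u.1 : ℝ), d] : EuclideanSpace ℝ (Fin 2))‖ ^ 2 = (u.1 : ℝ) ^ 2 + d ^ 2 := by
    rw [EuclideanSpace.norm_sq_eq]
    simp [Fin.sum_univ_two]
  have h1 := pow_le_pow_left₀ (mul_nonneg (norm_nonneg _) hcos.le) hu' 2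
  rw [mul_pow, hsq] at h1
  have h2 : (|(u.1 : ℝ)| * Real.cos θ) ^ 2 ≤ (d * Real.sin θ) ^ 2 := by
    rw [mul_pow, mul_pow, sq_abs]
    have := Real.sin_sq_add_cos_sq θ
    nlinarith
  have h3 := abs_le_of_sq_le_sq' h2 (by positivity)
  have h4 : |(u.1 : ℝ)| * Real.cot θ ≤ d := by
    rw [Real.cot_eq_cos_div_sin, ← mul_div_assoc, div_le_iff₀ hsin]
    exact h3.2
  rw [entryTime, ← NNReal.coe_le_coe, NNReal.coe_add, Real.coe_toNNReal _
    (mul_nonneg (abs_nonneg _) (cot_pos_of_mem hθ).le)]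
  linarith

/-- The spins in the cone. -/
def coneSpins (θ : ℝ) (t : ℝ≥0) (ω : CadlagPath Config) (u : spaceTimeCone θ t) : Bool :=
  ω.1 u.1.2 u.1.1

lemma sigmaCone_eq_comap (θ : ℝ) (t : ℝ≥0) :
    sigmaCone θ t = MeasurableSpace.comap (coneSpins θ t) inferInstance := by
  rw [sigmaCone, MeasurableSpace.pi, MeasurableSpace.comap_iSup]
  simp only [MeasurableSpace.comap_comp]
  rfl

lemma measurable_coneSpins (θ : ℝ) (t : ℝ≥0) : Measurable (coneSpins θ t) :=
  measurable_pi_lambda _ fun u => (measurable_pi_apply u.1.1).comp (measurable_eval u.1.2)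

lemma sigmaZero_eq_comap :
    sigmaZero = MeasurableSpace.comap (fun ω : CadlagPath Config => ω.1 0) inferInstance := by
  rw [sigmaZero, MeasurableSpace.pi, MeasurableSpace.comap_iSup]
  simp only [MeasurableSpace.comap_comp]
  rfl

/-- Averaging a bound for deterministic initial states. -/
lemma coneMixingCoeff_le {P : Kernel Config (CadlagPath Config)} (hP : IsFellerProcess P)
    (μ : Measure Config) [IsProbabilityMeasure μ] {θ : ℝ} {t : ℝ≥0} {b : ℝ≥0∞}
    (h : ∀ B, MeasurableSet[sigmaCone θ t] B → ∀ η η' : Config,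
      ENNReal.ofReal |(P η).real B - (P η').real B| ≤ b) :
    coneMixingCoeff (P ∘ₘ μ) θ t ≤ b := by
  have : IsMarkovKernel P := ⟨hP.prob⟩
  refine iSup_le fun A => iSup_le fun B => iSup_le fun hA => iSup_le fun hB => iSup_le fun hpos => ?_
  rcases eq_or_ne b ∞ with rfl | hb
  · exact le_top
  have hBm : MeasurableSet B := by
    rw [sigmaCone_eq_comap] at hB
    exact (measurable_coneSpins θ t).comap_le _ hB
  rw [sigmaZero_eq_comap] at hA
  obtain ⟨C, hC, rfl⟩ := hA
  set A : Set (CadlagPath Config) := (fun ω => ω.1 0) ⁻¹' C with hA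
  have hAm : MeasurableSet A := measurable_eval 0 hC
  set f : Config → ℝ := fun η => (P η).real B with hf
  have hfm : Measurable f := (P.measurable_coe hBm).ennreal_toReal
  have hf1 : ∀ η, ‖f η‖ ≤ 1 := fun η => by
    rw [Real.norm_of_nonneg measureReal_nonneg]
    exact measureReal_le_one
  have hfi : ∀ ν : Measure Config, IsFiniteMeasure ν → Integrable f ν := fun ν _ =>
    Integrable.of_bound hfm.aestronglyMeasurable 1 (Eventually.of_forall hf1)
  -- Paths start at η almost surely, so a time-zero event merely selects initial states.
  -- Conditioning on it replaces `μ` by `μ[|C]`, and two averages of `f` differ by at most its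
  -- oscillation.
  have hAB : ∀ (D : Set (CadlagPath Config)) (η : Config), P η (A ∩ D) =
      C.indicator (fun η => P η D) η := by
    intro D η
    by_cases hη : η ∈ C
    · rw [indicator_of_mem hη]
      refine measure_congr ?_
      filter_upwards [hP.start η] with ω hω
      refine propext ⟨fun h => h.2, fun h => ⟨?_, h⟩⟩
      change ω.1 0 ∈ C
      rwa [hω]
    · rw [indicator_of_notMem hη]
      refine measure_mono_null (inter_subset_left (t := D)) ?_
      refine measure_mono_null (fun ω hω => ?_) (hP.start η)
      intro h
      apply hη
      rw [← h]
      exact hω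
  have hRA : (P ∘ₘ μ) A = μ C := by
    rw [Measure.bind_apply hAm P.measurable.aemeasurable]
    have : ∀ η, P η A = C.indicator (fun _ => 1) η := fun η => by
      have := hAB Set.univ η
      rw [inter_univ] at this
      rw [this]
      simp
    simp only [this]
    rw [lintegral_indicator hC]
    simp
  have hRAB : (P ∘ₘ μ) (A ∩ B) = ∫⁻ η in C, P η B ∂μ := by
    rw [Measure.bind_apply (hAm.inter hBm) P.measurable.aemeasurable]
    simp only [hAB]
    rw [lintegral_indicator hC]
  have hreal : ∀ ν : Measure Config, ∫ η, f η ∂ν = (∫⁻ η, P η B ∂ν).toReal := fun ν => by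
    rw [integral_eq_lintegral_of_nonneg_ae (Eventually.of_forall fun η => measureReal_nonneg)
      hfm.aestronglyMeasurable]
    congr 1
    refine lintegral_congr fun η => ?_
    simp [measureReal_def]
  have hCpos : μ C ≠ 0 := by
    rw [← hRA]
    exact hpos.ne'
  have e1 : ((P ∘ₘ μ)[|A]).real B = ∫ η, f η ∂(μ[|C]) := by
    rw [hreal, measureReal_def, cond_apply hAm, hRA, hRAB, ProbabilityTheory.cond,
      lintegral_smul_measure, smul_eq_mul]
  have e2 : (P ∘ₘ μ).real B = ∫ η, f η ∂μ := by
    rw [hreal, measureReal_def, Measure.bind_apply hBm P.measurable.aemeasurable]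
  have : IsProbabilityMeasure (μ[|C]) := cond_isProbabilityMeasure hCpos
  have hosc : ∀ η η', |f η - f η'| ≤ b.toReal := fun η η' =>
    (ENNReal.ofReal_le_iff_le_toReal hb).1 (h B hB η η')
  have hmean : ∀ η, |f η - ∫ η', f η' ∂μ| ≤ b.toReal := by
    intro η
    have e : f η - ∫ η', f η' ∂μ = ∫ η', (f η - f η') ∂μ := by
      rw [integral_sub (integrable_const _) (hfi μ inferInstance)]
      simp
    rw [e]
    exact abs_integral_le_of_forall μ (hosc η)
  rw [e1, e2]
  refine (ENNReal.ofReal_le_iff_le_toReal hb).2 ?_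
  have e3 : ∫ η, f η ∂(μ[|C]) - ∫ η, f η ∂μ = ∫ η, (f η - ∫ η', f η' ∂μ) ∂(μ[|C]) := by
    rw [integral_sub (hfi _ inferInstance) (integrable_const _)]
    simp
  rw [e3]
  exact abs_integral_le_of_forall _ hmean

end Cone

/-! ### The bounds in terms of `ρ` -/

section Rho

variable {c : ℤ → Config → ℝ} {Q : Kernel (Config × Config) (CadlagPath (Config × Config))}

lemma rhoDisagree_antitone (Q : Kernel (Config × Config) (CadlagPath (Config × Config))) :
    Antitone (rhoDisagree Q) := fun _ _ hst =>
  iSup_mono fun _ => measure_mono fun _ ⟨u, hu, h⟩ => ⟨u, hst.trans hu, h⟩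

lemma IsBasicCoupling.measure_disagree_le (hc : IsSpinFlipRate c) (hQ : IsBasicCoupling c Q)
    (p : Config × Config) (x : ℤ) (t : ℝ≥0) :
    Q p {ω | ∃ s, t ≤ s ∧ (ω.1 s).1 x ≠ (ω.1 s).2 x} ≤ rhoDisagree Q t := by
  set S : Set (CadlagPath (Config × Config)) :=
    {ω | ∃ s, t ≤ s ∧ (ω.1 s).1 0 ≠ (ω.1 s).2 0} with hS
  have hpre : {ω : CadlagPath (Config × Config) | ∃ s, t ≤ s ∧ (ω.1 s).1 x ≠ (ω.1 s).2 x} =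
      mapPath (shiftPair (-x)) (continuous_shiftPair (-x)) ⁻¹' S := by
    ext ω
    simp [hS, mapPath, shiftPair, shiftConfig]
  rw [hpre]
  -- The event is an uncountable union over times and its measurability is not established; the
  -- inequality between the measure of a preimage and the image measure holds for every set.
  calc Q p (mapPath (shiftPair (-x)) (continuous_shiftPair (-x)) ⁻¹' S)
      ≤ (Q p).map (mapPath (shiftPair (-x)) (continuous_shiftPair (-x))) S :=
        Measure.le_map_apply (measurable_mapPath _ (measurable_shiftPair _)).aemeasurable S
    _ = Q (shiftPair (-x) p) S := by rw [hQ.map_shiftPair hc]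
    _ ≤ rhoDisagree Q t := le_iSup (fun p => Q p S) (shiftPair (-x) p)

/-- Comparison with the intervals `(n * a, (n + 1) * a]`: ρ is smallest at the right end, so the
term indexed by `n`, taken there, is below the mean over its interval. -/
lemma tsum_antitone_le_lintegral {ρ : ℝ≥0 → ℝ≥0∞} (hρ : Antitone ρ) {a : ℝ} (ha : 0 < a)
    (t : ℝ≥0) :
    ∑' n : ℕ, ρ (t + (((n : ℝ) + 1) * a).toNNReal) ≤
      ENNReal.ofReal (1 / a) * ∫⁻ v in Ioi (0 : ℝ), ρ (t + v.toNNReal) := by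
  set I : ℕ → Set ℝ := fun n => Ioc (n * a) ((n + 1 : ℕ) * a) with hI
  have hdisj : Pairwise (Function.onFun Disjoint I) :=
    Monotone.pairwise_disjoint_on_Ioc_succ (f := fun n : ℕ => (n : ℝ) * a) fun m n hmn =>
      mul_le_mul_of_nonneg_right (by exact_mod_cast hmn) ha.le
  have hsub : (⋃ n, I n) ⊆ Ioi 0 := iUnion_subset fun n v hv =>
    (mul_nonneg (Nat.cast_nonneg n) ha.le).trans_lt hv.1
  have hterm : ∀ n : ℕ, ρ (t + (((n : ℝ) + 1) * a).toNNReal) * ENNReal.ofReal a ≤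
      ∫⁻ v in I n, ρ (t + v.toNNReal) := by
    intro n
    have hvol : volume (I n) = ENNReal.ofReal a := by
      rw [hI, Real.volume_Ioc]
      congr 1
      push_cast
      ring
    rw [← hvol, ← setLIntegral_const]
    refine setLIntegral_mono' measurableSet_Ioc fun v hv => hρ ?_
    have := hv.2
    push_cast at this
    gcongr
  have hmain : (∑' n : ℕ, ρ (t + (((n : ℝ) + 1) * a).toNNReal)) * ENNReal.ofReal a ≤
      ∫⁻ v in Ioi (0 : ℝ), ρ (t + v.toNNReal) := by
    rw [← ENNReal.tsum_mul_right]
    refine (ENNReal.tsum_le_tsum hterm).trans ?_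
    rw [← lintegral_iUnion (fun n => measurableSet_Ioc) hdisj]
    exact lintegral_mono_set hsub
  have h1 : ENNReal.ofReal (1 / a) * ENNReal.ofReal a = 1 := by
    rw [← ENNReal.ofReal_mul (by positivity), one_div_mul_cancel ha.ne', ENNReal.ofReal_one]
  calc _ = ENNReal.ofReal (1 / a) *
        ((∑' n : ℕ, ρ (t + (((n : ℝ) + 1) * a).toNNReal)) * ENNReal.ofReal a) := by
        rw [mul_comm _ (ENNReal.ofReal a), ← mul_assoc, h1, one_mul]
    _ ≤ _ := mul_le_mul' le_rfl hmain

/-- The site 0 gives `ρ t`; the positive and the negative half-line each give `1 / cot θ` times the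
integral. -/
lemma tsum_entryTime_le {ρ : ℝ≥0 → ℝ≥0∞} (hρ : Antitone ρ) {θ : ℝ}
    (hθ : θ ∈ Ioo 0 (Real.pi / 2)) (t : ℝ≥0) :
    ∑' x : ℤ, ρ (entryTime θ t x) ≤
      ρ t + ENNReal.ofReal (2 / Real.cot θ) * ∫⁻ v in Ioi (0 : ℝ), ρ (t + v.toNNReal) := by
  have hcot := cot_pos_of_mem hθ
  have h := tsum_antitone_le_lintegral hρ hcot t
  rw [tsum_of_nat_of_neg_add_one ENNReal.summable ENNReal.summable,
    tsum_eq_zero_add' ENNReal.summable]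
  have e1 : ∀ n : ℕ, ρ (entryTime θ t ((n + 1 : ℕ) : ℤ)) =
      ρ (t + (((n : ℝ) + 1) * Real.cot θ).toNNReal) := fun n => by
    rw [entryTime]
    congr 4
    push_cast
    exact abs_of_nonneg (by positivity)
  have e2 : ∀ n : ℕ, ρ (entryTime θ t (-((n : ℤ) + 1))) =
      ρ (t + (((n : ℝ) + 1) * Real.cot θ).toNNReal) := fun n => by
    rw [entryTime]
    congr 4
    push_cast
    rw [abs_neg]
    exact abs_of_nonneg (by positivity)
  have e3 : ENNReal.ofReal (2 / Real.cot θ) =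
      ENNReal.ofReal (1 / Real.cot θ) + ENNReal.ofReal (1 / Real.cot θ) := by
    rw [← ENNReal.ofReal_add (by positivity) (by positivity)]
    congr 1
    ring
  simp only [e1, e2]
  rw [e3, add_mul (ENNReal.ofReal _), add_assoc]
  refine add_le_add ?_ (add_le_add h h)
  simp [entryTime]

/-- The coupling bound for events in the cone. -/
lemma IsBasicCoupling.abs_sub_le (hc : IsSpinFlipRate c) {P : Kernel Config (CadlagPath Config)}
    (hP : IsSpinFlipSystem c P) (hQ : IsBasicCoupling c Q) {θ : ℝ}
    (hθ : θ ∈ Ioo 0 (Real.pi / 2)) (t : ℝ≥0) {B : Set (CadlagPath Config)}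
    (hB : MeasurableSet[sigmaCone θ t] B) (η η' : Config) :
    ENNReal.ofReal |(P η).real B - (P η').real B| ≤
      rhoDisagree Q t + ENNReal.ofReal (2 / Real.cot θ) *
        ∫⁻ v in Ioi (0 : ℝ), rhoDisagree Q (t + v.toNNReal) := by
  refine le_trans ?_ (tsum_entryTime_le (rhoDisagree_antitone Q) hθ t)
  rw [sigmaCone_eq_comap] at hB
  obtain ⟨S, hS, rfl⟩ := hB
  have hBm : MeasurableSet (coneSpins θ t ⁻¹' S) := measurable_coneSpins θ t hS
  have := hQ.feller.prob (η, η')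
  set B₁ : Set (CadlagPath (Config × Config)) := mapPath Prod.fst continuous_fst ⁻¹' (coneSpins θ t ⁻¹' S) with hB₁
  set B₂ : Set (CadlagPath (Config × Config)) := mapPath Prod.snd continuous_snd ⁻¹' (coneSpins θ t ⁻¹' S) with hB₂
  have hm₁ : MeasurableSet B₁ := measurable_mapPath continuous_fst measurable_fst hBm
  have hm₂ : MeasurableSet B₂ := measurable_mapPath continuous_snd measurable_snd hBm
  have e1 : (P η).real (coneSpins θ t ⁻¹' S) = (Q (η, η')).real B₁ := by
    rw [← hQ.map_fst hc hP (η, η'), map_measureReal_apply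
      (measurable_mapPath continuous_fst measurable_fst) hBm]
  have e2 : (P η').real (coneSpins θ t ⁻¹' S) = (Q (η, η')).real B₂ := by
    rw [← hQ.map_snd hc hP (η, η'), map_measureReal_apply
      (measurable_mapPath continuous_snd measurable_snd) hBm]
  -- Off the union the copies agree at every space-time point of the cone, so the event occurs for
  -- both or for neither.
  have hsub : symmDiff B₁ B₂ ⊆
      ⋃ x : ℤ, {ω | ∃ s, entryTime θ t x ≤ s ∧ (ω.1 s).1 x ≠ (ω.1 s).2 x} := by
    intro ω hω
    by_contra hcon
    have hag : coneSpins θ t (mapPath Prod.fst continuous_fst ω) =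
        coneSpins θ t (mapPath Prod.snd continuous_snd ω) := by
      funext u
      by_contra hne
      exact hcon (mem_iUnion.2 ⟨u.1.1, u.1.2, entryTime_le hθ u.2, hne⟩)
    have hiff : ω ∈ B₁ ↔ ω ∈ B₂ := by
      simp only [hB₁, hB₂, mem_preimage, hag]
    rcases hω with ⟨h1, h2⟩ | ⟨h1, h2⟩
    · exact h2 (hiff.1 h1)
    · exact h2 (hiff.2 h1)
  rw [e1, e2]
  calc ENNReal.ofReal |(Q (η, η')).real B₁ - (Q (η, η')).real B₂|
      ≤ ENNReal.ofReal ((Q (η, η')).real (symmDiff B₁ B₂)) :=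
        ENNReal.ofReal_le_ofReal (abs_measureReal_sub_le_measureReal_symmDiff hm₁.nullMeasurableSet
          hm₂.nullMeasurableSet)
    _ = Q (η, η') (symmDiff B₁ B₂) := ofReal_measureReal
    _ ≤ Q (η, η') (⋃ x : ℤ, {ω | ∃ s, entryTime θ t x ≤ s ∧ (ω.1 s).1 x ≠ (ω.1 s).2 x}) :=
        measure_mono hsub
    _ ≤ ∑' x : ℤ, Q (η, η') {ω | ∃ s, entryTime θ t x ≤ s ∧ (ω.1 s).1 x ≠ (ω.1 s).2 x} :=
        measure_iUnion_le _
    _ ≤ ∑' x : ℤ, rhoDisagree Q (entryTime θ t x) :=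
        ENNReal.tsum_le_tsum fun x => hQ.measure_disagree_le hc (η, η') x _

/-- Monotonicity gives `ρ t * t ≤ ∫ ρ` over `(0, t]`, so ρ decays at least like `1 / t`. -/
lemma tendsto_zero_of_antitone_of_lintegral_lt_top {ρ : ℝ≥0 → ℝ≥0∞} (hρ : Antitone ρ)
    (h : ∫⁻ v in Ioi (0 : ℝ), ρ v.toNNReal < ∞) : Tendsto ρ atTop (𝓝 0) := by
  set I := ∫⁻ v in Ioi (0 : ℝ), ρ v.toNNReal with hI
  have hbound : ∀ t : ℝ≥0, 0 < t → ρ t ≤ I / t := by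
    intro t ht
    rw [ENNReal.le_div_iff_mul_le (Or.inl (by simpa using ht.ne')) (Or.inl ENNReal.coe_ne_top)]
    have hvol : volume (Ioc (0 : ℝ) t) = t := by simp
    calc ρ t * t = ∫⁻ _ in Ioc (0 : ℝ) t, ρ t := by rw [setLIntegral_const, hvol]
      _ ≤ ∫⁻ v in Ioc (0 : ℝ) t, ρ v.toNNReal :=
          setLIntegral_mono' measurableSet_Ioc fun v hv =>
            hρ (by simpa using Real.toNNReal_le_toNNReal hv.2)
      _ ≤ I := lintegral_mono_set Ioc_subset_Ioi_self
  have hlim : Tendsto (fun t : ℝ≥0 => I / (t : ℝ≥0∞)) atTop (𝓝 0) := by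
    have h1 : Tendsto (fun t : ℝ≥0 => (t : ℝ≥0∞)) atTop (𝓝 ∞) := 
      ENNReal.tendsto_coe_nhds_top.2 tendsto_id
    simpa using ENNReal.Tendsto.const_div h1 (Or.inr h.ne)
  refine tendsto_of_tendsto_of_tendsto_of_le_of_le' tendsto_const_nhds hlim
    (Eventually.of_forall fun _ => zero_le) ?_
  filter_upwards [eventually_gt_atTop 0] with t ht using hbound t ht

lemma tendsto_rho_bound {ρ : ℝ≥0 → ℝ≥0∞} (hρ : Antitone ρ)
    (h : ∫⁻ v in Ioi (0 : ℝ), ρ v.toNNReal < ∞) (C : ℝ) :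
    Tendsto (fun t : ℝ≥0 => ρ t + ENNReal.ofReal C * ∫⁻ v in Ioi (0 : ℝ), ρ (t + v.toNNReal))
      atTop (𝓝 0) := by
  have h0 := tendsto_zero_of_antitone_of_lintegral_lt_top hρ h
  have h1 : Tendsto (fun t : ℝ≥0 => ∫⁻ v in Ioi (0 : ℝ), ρ (t + v.toNNReal)) atTop
      (𝓝 (∫⁻ _ in Ioi (0 : ℝ), 0)) := by
    refine tendsto_lintegral_filter_of_dominated_convergence (fun v => ρ v.toNNReal)
      (Eventually.of_forall fun t => ?_) (Eventually.of_forall fun t => ?_) h.ne ?_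
    · exact hρ.measurable.comp (by fun_prop)
    · exact Eventually.of_forall fun v => hρ le_add_self
    · exact Eventually.of_forall fun v =>
        h0.comp (tendsto_atTop_mono (fun t => le_self_add) tendsto_id)
  rw [lintegral_zero] at h1
  have h2 := h0.add (ENNReal.Tendsto.const_mul h1 (Or.inr (ENNReal.ofReal_ne_top (r := C))))
  simpa using h2

end Rho

/-! ### Evolution equations along a Feller process -/

section Evolution

variable {E : Type} [TopologicalSpace E] [MeasurableSpace E] {P : Kernel E (CadlagPath E)}

lemma measurableSet_pastSigma_mono {s t : ℝ≥0} (hst : s ≤ t) {B : Set (CadlagPath E)}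
    (hB : MeasurableSet[pastSigma E s] B) : MeasurableSet[pastSigma E t] B := by
  have hmono : pastSigma E s ≤ pastSigma E t :=
    iSup_le fun r => le_iSup_of_le (⟨r.1, (mem_Iic.1 r.2).trans hst⟩ : Iic t) le_rfl
  exact hmono _ hB

/-- The increment of `∫_B φ(ω_t)` in terms of the semigroup. -/
lemma setIntegral_add_sub (hP : IsFellerProcess P) (e : E) {s : ℝ≥0} {B : Set (CadlagPath E)}
    (hB : MeasurableSet[pastSigma E s] B) {φ : E → ℝ} (hφ : Measurable φ) {C : ℝ}
    (hC : ∀ e, |φ e| ≤ C) (k : ℝ≥0) :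
    ∫ ω in B, φ (ω.1 (s + k)) ∂(P e) - ∫ ω in B, φ (ω.1 s) ∂(P e) =
      ∫ ω in B, (transOp P k φ (ω.1 s) - φ (ω.1 s)) ∂(P e) := by
  have h := hP.setIntegral_shiftPath e hB (F := fun ω => φ (ω.1 k)) (hφ.comp (measurable_eval k))
    (C := C) fun _ => hC _
  rw [integral_sub (integrable_eval hP e s (measurable_transOp k hφ)
    (abs_transOp_le hP k hC)).integrableOn (integrable_eval hP e s hφ hC).integrableOn]
  exact congrArg (· - ∫ ω in B, φ (ω.1 s) ∂(P e)) h

lemma abs_setIntegral_eval_le (hP : IsFellerProcess P) (e : E) (s : ℝ≥0) (B : Set (CadlagPath E))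
    {φ : E → ℝ} {C : ℝ} (hC : ∀ e, |φ e| ≤ C) : |∫ ω in B, φ (ω.1 s) ∂(P e)| ≤ C := by
  have := hP.prob e
  have hC0 : 0 ≤ C := (abs_nonneg _).trans (hC e)
  have h := norm_setIntegral_le_of_norm_le_const (μ := P e) (s := B)
    (f := fun ω : CadlagPath E => φ (ω.1 s)) (measure_lt_top _ _) fun ω _ => hC _
  refine h.trans ?_
  have := measureReal_le_one (μ := P e) (s := B)
  nlinarith

variable {φ ψ : E → ℝ} {C D : ℝ}

/-- The evolution equation, as a right derivative. -/
lemma HasGeneratorAt.hasDerivWithinAt (hP : IsFellerProcess P) (hgen : HasGeneratorAt P φ ψ)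
    (hφ : Measurable φ) (hC : ∀ e, |φ e| ≤ C) (hψ : Measurable ψ) (hD : ∀ e, |ψ e| ≤ D)
    (e : E) {s : ℝ≥0} {B : Set (CadlagPath E)} (hB : MeasurableSet[pastSigma E s] B) {τ : ℝ}
    (hτ : (s : ℝ) ≤ τ) :
    HasDerivWithinAt (fun τ : ℝ => ∫ ω in B, φ (ω.1 τ.toNNReal) ∂(P e))
      (∫ ω in B, ψ (ω.1 τ.toNNReal) ∂(P e)) (Ici τ) τ := by
  have hτ0 : 0 ≤ τ := s.2.trans hτ
  have hB' : MeasurableSet[pastSigma E τ.toNNReal] B :=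
    measurableSet_pastSigma_mono (NNReal.le_toNNReal_of_coe_le hτ) hB
  rw [← hasDerivWithinAt_Ioi_iff_Ici, hasDerivWithinAt_iff_tendsto_slope' self_notMem_Ioi,
    Metric.tendsto_nhds]
  intro δ hδ
  have hlim : Tendsto (fun z : ℝ => (z - τ).toNNReal) (𝓝[>] τ) (𝓝[>] 0) := by
    refine tendsto_nhdsWithin_iff.2 ⟨?_, ?_⟩
    · have : Continuous fun z : ℝ => (z - τ).toNNReal := by fun_prop
      simpa using (this.tendsto τ).mono_left nhdsWithin_le_nhds
    · filter_upwards [self_mem_nhdsWithin] with z hz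
      exact Real.toNNReal_pos.2 (sub_pos.2 hz)
  filter_upwards [hlim.eventually (Metric.tendstoUniformly_iff.1 hgen (δ / 2) (half_pos hδ)),
    self_mem_nhdsWithin] with z hz hzτ
  have hpos : 0 < z - τ := sub_pos.2 hzτ
  set k := (z - τ).toNNReal with hk
  have hkr : (k : ℝ) = z - τ := Real.coe_toNNReal _ hpos.le
  have hzk : z.toNNReal = τ.toNNReal + k := by
    rw [hk, ← Real.toNNReal_add hτ0 hpos.le]
    congr 1
    ring
  have e1 : slope (fun τ : ℝ => ∫ ω in B, φ (ω.1 τ.toNNReal) ∂(P e)) τ z -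
      ∫ ω in B, ψ (ω.1 τ.toNNReal) ∂(P e) =
      ∫ ω in B, ((transOp P k φ (ω.1 τ.toNNReal) - φ (ω.1 τ.toNNReal)) / k -
        ψ (ω.1 τ.toNNReal)) ∂(P e) := by
    have hi : Integrable (fun ω : CadlagPath E => transOp P k φ (ω.1 τ.toNNReal) -
        φ (ω.1 τ.toNNReal)) (P e) :=
      (integrable_eval hP e _ (measurable_transOp k hφ) (abs_transOp_le hP k hC)).sub
        (integrable_eval hP e _ hφ hC)
    rw [integral_sub (hi.div_const _).integrableOn (integrable_eval hP e _ hψ hD).integrableOn,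
      integral_div, ← setIntegral_add_sub hP e hB' hφ hC k, slope_def_field, hzk, hkr]
  rw [Real.dist_eq, e1]
  refine lt_of_le_of_lt (abs_setIntegral_eval_le hP e _ B
    (φ := fun x => (transOp P k φ x - φ x) / k - ψ x) (C := δ / 2) fun x => ?_) (half_lt_self hδ)
  have := hz x
  rw [Real.dist_eq, abs_sub_comm] at this
  exact this.le

/-- Uniform generator convergence bounds difference quotients by `D + 1` for small time steps. The
forward increments are thus small uniformly in the base point, which gives continuity from both
sides. Comparison by right derivatives requires it. -/
lemma HasGeneratorAt.continuousOn (hP : IsFellerProcess P) (hgen : HasGeneratorAt P φ ψ)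
    (hφ : Measurable φ) (hC : ∀ e, |φ e| ≤ C) (hD : ∀ e, |ψ e| ≤ D)
    (e : E) {s : ℝ≥0} {B : Set (CadlagPath E)} (hB : MeasurableSet[pastSigma E s] B) (T : ℝ) :
    ContinuousOn (fun τ : ℝ => ∫ ω in B, φ (ω.1 τ.toNNReal) ∂(P e)) (Icc s T) := by
  set u := fun τ : ℝ => ∫ ω in B, φ (ω.1 τ.toNNReal) ∂(P e) with hu
  have hinc : ∀ δ > 0, ∃ d > 0, ∀ τ z : ℝ, (s : ℝ) ≤ τ → τ < z → z < τ + d → |u z - u τ| ≤ δ := by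
    intro δ hδ
    have h1 : ∀ᶠ k : ℝ≥0 in 𝓝[>] 0, (∀ x, dist (ψ x) ((∫ ω, φ (ω.1 k) ∂(P x) - φ x) / k) < 1) ∧
        (k : ℝ) * (D + 1) < δ := by
      refine (Metric.tendstoUniformly_iff.1 hgen 1 one_pos).and ?_
      have : Tendsto (fun k : ℝ≥0 => (k : ℝ) * (D + 1)) (𝓝[>] 0) (𝓝 0) := by
        have hc : Continuous fun k : ℝ≥0 => (k : ℝ) * (D + 1) := by fun_prop
        simpa using (hc.tendsto 0).mono_left nhdsWithin_le_nhds
      exact this.eventually_lt_const hδ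
    obtain ⟨d, hd, hsub⟩ := mem_nhdsGT_iff_exists_Ioo_subset.1 h1
    refine ⟨d, hd, fun τ z hsτ hτz hzd => ?_⟩
    have hτ0 : 0 ≤ τ := s.2.trans hsτ
    have hpos : 0 < z - τ := sub_pos.2 hτz
    set k := (z - τ).toNNReal with hk
    have hkr : (k : ℝ) = z - τ := Real.coe_toNNReal _ hpos.le
    have hkd : k ∈ Ioo 0 d := by
      refine ⟨Real.toNNReal_pos.2 hpos, ?_⟩
      rw [← NNReal.coe_lt_coe, hkr]
      linarith
    obtain ⟨h2, h3⟩ := hsub hkd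
    have hB' : MeasurableSet[pastSigma E τ.toNNReal] B :=
      measurableSet_pastSigma_mono (NNReal.le_toNNReal_of_coe_le hsτ) hB
    have hzk : z.toNNReal = τ.toNNReal + k := by
      rw [hk, ← Real.toNNReal_add hτ0 hpos.le]
      congr 1
      ring
    simp only [hu, hzk]
    rw [setIntegral_add_sub hP e hB' hφ hC k]
    refine abs_setIntegral_eval_le hP e _ B (φ := fun x => transOp P k φ x - φ x) fun x => ?_
    have h4 := (h2 x).le
    rw [Real.dist_eq, abs_sub_comm] at h4
    have hk0 : 0 < (k : ℝ) := by rw [hkr]; exact hpos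
    have h5 : |(transOp P k φ x - φ x) / k| ≤ D + 1 := by
      have := abs_sub_abs_le_abs_sub ((∫ ω, φ (ω.1 k) ∂(P x) - φ x) / k) (ψ x)
      rw [transOp]
      linarith [hD x]
    rw [abs_div, abs_of_pos hk0, div_le_iff₀ hk0] at h5
    linarith
  intro τ hτ
  rw [ContinuousWithinAt, Metric.tendsto_nhds]
  intro δ hδ
  obtain ⟨d, hd, h⟩ := hinc (δ / 2) (half_pos hδ)
  have hnear : ∀ᶠ z in 𝓝[Icc (s : ℝ) T] τ, |z - τ| < d := by
    refine nhdsWithin_le_nhds ?_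
    filter_upwards [Metric.ball_mem_nhds τ hd] with z hz
    simpa [Real.dist_eq] using hz
  filter_upwards [hnear, self_mem_nhdsWithin] with z hz hzI
  rw [abs_lt] at hz
  rw [Real.dist_eq]
  rcases lt_trichotomy z τ with hlt | rfl | hgt
  · rw [abs_sub_comm]
    exact (h z τ hzI.1 hlt (by linarith)).trans_lt (half_lt_self hδ)
  · simpa using hδ
  · exact (h τ z hτ.1 hgt (by linarith)).trans_lt (half_lt_self hδ)

end Evolution

/-! ### Discrepancies in the basic coupling -/

section Discrepancy

variable {c : ℤ → Config → ℝ} {Q : Kernel (Config × Config) (CadlagPath (Config × Config))}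

/-- The indicator of a discrepancy at `x`. -/
def disc (x : ℤ) (p : Config × Config) : ℝ := if p.1 x ≠ p.2 x then 1 else 0

lemma disc_nonneg (x : ℤ) (p : Config × Config) : 0 ≤ disc x p := by
  unfold disc; split_ifs <;> simp

lemma abs_disc_le (x : ℤ) (p : Config × Config) : |disc x p| ≤ 1 := by
  unfold disc; split_ifs <;> simp

lemma measurableSet_disc (x : ℤ) : MeasurableSet {p : Config × Config | p.1 x ≠ p.2 x} :=
  (measurableSet_eq_fun ((measurable_pi_apply x).comp measurable_fst)
    ((measurable_pi_apply x).comp measurable_snd)).compl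

lemma measurable_disc (x : ℤ) : Measurable (disc x) :=
  Measurable.ite (measurableSet_disc x) measurable_const measurable_const

lemma IsSpinFlipRate.summable_influence_sub (hc : IsSpinFlipRate c) (x : ℤ) :
    Summable fun y => influence c (y - x) :=
  hc.summable_influence.comp_injective (sub_left_injective (b := x))

lemma tsum_influence_sub (c : ℤ → Config → ℝ) (x : ℤ) :
    ∑' y, influence c (y - x) = rateM c :=
  ((Equiv.subRight x).tsum_eq (influence c)).trans (tsum_influence c)

lemma IsSpinFlipRate.abs_sub_le_tsum (hc : IsSpinFlipRate c) {x : ℤ} {p : Config × Config}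
    (h : p.1 x = p.2 x) : |c x p.1 - c x p.2| ≤ ∑' y, influence c (y - x) * disc y p := by
  obtain ⟨K, hK0, hK⟩ := hc.exists_bound
  have hosc : OscLe (c x) fun y => influence c (y - x) + if y = x then K else 0 := by
    intro u η ζ hηζ
    by_cases hu : x = u
    · subst hu
      have h1 := hc.nonneg x η
      have h2 := hc.nonneg x ζ
      have h3 := hK x η
      have h4 := hK x ζ
      have h5 := influence_nonneg c (x - x)
      simp only [if_true]
      rw [abs_le]
      constructor <;> linarith
    · simpa [Ne.symm hu] using hc.abs_sub_le hu hηζ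
  have hs1 : Summable fun y => influence c (y - x) :=
    hc.summable_influence_sub x
  have hs2 : Summable fun y : ℤ => if y = x then K else 0 :=
    summable_of_ne_finset_zero (s := {x}) fun y hy => if_neg (by simpa using hy)
  refine (hosc.abs_sub_le_tsum (hc.continuous x) (hs1.add hs2) (fun y => ?_) p.1 p.2).trans_eq ?_
  · have := influence_nonneg c (y - x)
    split_ifs <;> linarith
  · refine tsum_congr fun y => ?_
    by_cases hy : y = x
    · subst hy
      simp [h, influence]
    · simp [hy, disc]

lemma summable_influence_mul_disc (hc : IsSpinFlipRate c) (x : ℤ) (p : Config × Config) :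
    Summable fun y => influence c (y - x) * disc y p :=
  Summable.of_nonneg_of_le (fun y => mul_nonneg (influence_nonneg c _) (disc_nonneg y p))
    (fun y => mul_le_of_le_one_right (influence_nonneg c _) ((le_abs_self _).trans (abs_disc_le y p)))
    (hc.summable_influence_sub x)

lemma disc_dependsOn (x : ℤ) (p q : Config × Config)
    (h : ∀ y ∈ ({x} : Finset ℤ), p.1 y = q.1 y ∧ p.2 y = q.2 y) : disc x p = disc x q := by
  have := h x (by simp)
  simp only [disc, this.1, this.2]

/-- Agreeing spins separate only through the excess of each rate over the minimum, and the two
excesses sum to the absolute difference. Differing spins are joined by a flip of either one. -/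
lemma basicCouplingGen_disc (c : ℤ → Config → ℝ) (x : ℤ) (p : Config × Config) :
    basicCouplingGen c (disc x) p =
      if p.1 x = p.2 x then |c x p.1 - c x p.2| else -(c x p.1 + c x p.2) := by
  rw [basicCouplingGen_eq_sum (disc_dependsOn x), Finset.sum_singleton, basicCouplingGenAt]
  by_cases h : p.1 x = p.2 x
  · rw [if_pos h, if_pos h]
    simp only [disc, flipAt_same, h]
    rcases le_total (c x p.1) (c x p.2) with hle | hle
    · rw [abs_of_nonpos (by linarith), min_eq_left hle]; simp
    · rw [abs_of_nonneg (by linarith), min_eq_right hle]; simp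
  · rw [if_neg h, if_neg h]
    have h1 : (!(p.1 x)) = p.2 x := by
      revert h
      cases p.1 x <;> cases p.2 x <;> simp
    have h2 : p.1 x = !(p.2 x) := by rw [← h1, Bool.not_not]
    have e1 : disc x (flipAt p.1 x, p.2) = 0 := by simp [disc, flipAt_same, h1]
    have e2 : disc x (p.1, flipAt p.2 x) = 0 := by simp [disc, flipAt_same, h2]
    have e3 : disc x p = 1 := if_pos h
    rw [e1, e2, e3]
    ring

/-- Discrepancies are created at a rate at most the influence of the existing ones, and disappear
at rate at least `ε` up to the same error. -/
lemma IsSpinFlipRate.basicCouplingGen_disc_le (hc : IsSpinFlipRate c) (x : ℤ)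
    (p : Config × Config) :
    basicCouplingGen c (disc x) p ≤
      ∑' y, influence c (y - x) * disc y p - rateEps c * disc x p := by
  rw [basicCouplingGen_disc]
  split_ifs with h
  · have : disc x p = 0 := if_neg (by simpa using h)
    rw [this, mul_zero, sub_zero]
    exact hc.abs_sub_le_tsum h
  · have hd : disc x p = 1 := if_pos h
    have h1 : flipAt p.1 x x = p.2 x := by
      rw [flipAt_same]
      revert h
      cases p.1 x <;> cases p.2 x <;> simp
    -- Flipping the first copy at `x` removes the discrepancy there, so `c x p.2` is close to `c x
    -- (flipAt p.1 x)`; the latter and `c x p.1` add up to at least ε.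
    have h2 := hc.abs_sub_le_tsum (p := (flipAt p.1 x, p.2)) h1
    have h3 : ∑' y, influence c (y - x) * disc y (flipAt p.1 x, p.2) ≤
        ∑' y, influence c (y - x) * disc y p := by
      refine Summable.tsum_le_tsum (fun y => ?_) (summable_influence_mul_disc hc _ _)
        (summable_influence_mul_disc hc _ _)
      by_cases hy : y = x
      · subst hy; simp [influence]
      · simp only [disc, flipAt_of_ne _ hy]; rfl
    have h4 := hc.rateEps_le x p.1
    have h5 := (abs_le.1 h2).2
    simp only at h5
    rw [hd]
    linarith

lemma abs_basicCouplingGen_disc_le (hc : IsSpinFlipRate c) {K : ℝ} (hK : ∀ x η, c x η ≤ K)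
    (x : ℤ) (p : Config × Config) : |basicCouplingGen c (disc x) p| ≤ 2 * K := by
  rw [basicCouplingGen_disc]
  have h1 := hc.nonneg x p.1
  have h2 := hc.nonneg x p.2
  have h3 := hK x p.1
  have h4 := hK x p.2
  split_ifs
  · rw [abs_abs, abs_le]
    constructor <;> linarith
  · rw [abs_le]
    constructor <;> linarith

lemma measurable_basicCouplingGen_disc (hc : IsSpinFlipRate c) (x : ℤ) :
    Measurable (basicCouplingGen c (disc x)) := by
  have h1 : Measurable fun p : Config × Config => c x p.1 :=
    (hc.continuous x).measurable.comp measurable_fst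
  have h2 : Measurable fun p : Config × Config => c x p.2 :=
    (hc.continuous x).measurable.comp measurable_snd
  rw [funext (basicCouplingGen_disc c x)]
  refine Measurable.ite ?_ ?_ (h1.add h2).neg
  · exact measurableSet_eq_fun ((measurable_pi_apply x).comp measurable_fst)
      ((measurable_pi_apply x).comp measurable_snd)
  · exact continuous_abs.measurable.comp (h1.sub h2)

/-- The expected influence of the discrepancies at a fixed time. -/
lemma setIntegral_tsum_disc (hc : IsSpinFlipRate c) (hQ : IsBasicCoupling c Q)
    (p : Config × Config) (B : Set (CadlagPath (Config × Config))) (s : ℝ≥0) (x : ℤ) :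
    Integrable (fun ω : CadlagPath (Config × Config) =>
        ∑' y, influence c (y - x) * disc y (ω.1 s)) (Q p) ∧
      ∫ ω in B, ∑' y, influence c (y - x) * disc y (ω.1 s) ∂(Q p) =
        ∑' y, influence c (y - x) * ∫ ω in B, disc y (ω.1 s) ∂(Q p) := by
  have := hQ.feller.prob p
  have hs : Summable fun y => influence c (y - x) :=
    hc.summable_influence_sub x
  have hm : Measurable fun q : Config × Config => ∑' y, influence c (y - x) * disc y q :=
    Measurable.tsum fun y => (measurable_disc y).const_mul _
  have hb : ∀ q, |∑' y, influence c (y - x) * disc y q| ≤ ∑' y, influence c (y - x) := by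
    intro q
    rw [abs_of_nonneg (tsum_nonneg fun y => mul_nonneg (influence_nonneg c _) (disc_nonneg y q))]
    exact Summable.tsum_le_tsum (fun y => mul_le_of_le_one_right (influence_nonneg c _)
      ((le_abs_self _).trans (abs_disc_le y q))) (summable_influence_mul_disc hc x q) hs
  refine ⟨integrable_eval hQ.feller p s hm hb, ?_⟩
  simp only [← integral_const_mul]
  have hi : ∀ y, Integrable (fun ω : CadlagPath (Config × Config) =>
      influence c (y - x) * disc y (ω.1 s)) ((Q p).restrict B) := fun y =>
    ((integrable_eval hQ.feller p s (measurable_disc y) (abs_disc_le y)).const_mul _).integrableOn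
  refine (integral_tsum_of_summable_integral_norm hi ?_).symm
  refine Summable.of_nonneg_of_le (fun y => integral_nonneg fun ω => norm_nonneg _) (fun y => ?_) hs
  have h1 := abs_setIntegral_eval_le hQ.feller p s B
    (φ := fun q => ‖influence c (y - x) * disc y q‖) (C := influence c (y - x)) fun q => ?_
  · exact (le_abs_self _).trans h1
  · rw [abs_norm, norm_mul, Real.norm_of_nonneg (influence_nonneg c _)]
    exact mul_le_of_le_one_right (influence_nonneg c _) (abs_disc_le y q)

lemma IsBasicCoupling.setIntegral_gen_le (hc : IsSpinFlipRate c) (hQ : IsBasicCoupling c Q)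
    (p : Config × Config) (B : Set (CadlagPath (Config × Config))) (s : ℝ≥0) (x : ℤ) {m : ℝ}
    (hm : ∀ y, ∫ ω in B, disc y (ω.1 s) ∂(Q p) ≤ m) :
    ∫ ω in B, basicCouplingGen c (disc x) (ω.1 s) ∂(Q p) ≤
      rateM c * m - rateEps c * ∫ ω in B, disc x (ω.1 s) ∂(Q p) := by
  obtain ⟨K, -, hK⟩ := hc.exists_bound
  obtain ⟨hi, he⟩ := setIntegral_tsum_disc hc hQ p B s x
  have hs : Summable fun y => influence c (y - x) :=
    hc.summable_influence_sub x
  have hid := integrable_eval hQ.feller p s (measurable_disc x) (abs_disc_le x)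
  have h1 : ∫ ω in B, basicCouplingGen c (disc x) (ω.1 s) ∂(Q p) ≤
      ∫ ω in B, (∑' y, influence c (y - x) * disc y (ω.1 s) - rateEps c * disc x (ω.1 s)) ∂(Q p) :=
    integral_mono (integrable_eval hQ.feller p s (measurable_basicCouplingGen_disc hc x)
      (abs_basicCouplingGen_disc_le hc hK x)).integrableOn
      (hi.sub (hid.const_mul _)).integrableOn fun ω => hc.basicCouplingGen_disc_le x _
  rw [integral_sub hi.integrableOn (hid.const_mul _).integrableOn, he, integral_const_mul] at h1
  have h2 : ∑' y, influence c (y - x) * ∫ ω in B, disc y (ω.1 s) ∂(Q p) ≤ rateM c * m := by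
    have hsum : ∑' y, influence c (y - x) = rateM c := tsum_influence_sub c x
    rw [← hsum, ← tsum_mul_right]
    refine Summable.tsum_le_tsum (fun y => mul_le_mul_of_nonneg_left (hm y)
      (influence_nonneg c _)) ?_ (hs.mul_right m)
    refine Summable.of_nonneg_of_le (fun y => mul_nonneg (influence_nonneg c _)
      (integral_nonneg fun ω => disc_nonneg y _)) (fun y => ?_) hs
    exact mul_le_of_le_one_right (influence_nonneg c _) ((le_abs_self _).trans
      (abs_setIntegral_eval_le hQ.feller p s B (abs_disc_le y)))
  linarith

lemma IsBasicCoupling.hasGeneratorAt_disc (hQ : IsBasicCoupling c Q) (x : ℤ) :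
    HasGeneratorAt Q (disc x) (basicCouplingGen c (disc x)) :=
  hQ.generator _ ⟨{x}, disc_dependsOn x⟩

/-- A comparison which improves an exponential bound on the discrepancies. -/
lemma IsBasicCoupling.exp_mul_integral_disc_le (hc : IsSpinFlipRate c) (hQ : IsBasicCoupling c Q)
    (p : Config × Config) {l : ℝ} (hl : 0 < l) (hle : rateEps c ≤ l) (k : ℕ) :
    ∀ (x : ℤ) (t : ℝ), 0 ≤ t →
      Real.exp (rateEps c * t) * ∫ ω, disc x (ω.1 t.toNNReal) ∂(Q p) ≤
        Real.exp (rateM c * t) + (rateM c / l) ^ k * Real.exp (l * t) := by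
  have := hQ.feller.prob p
  obtain ⟨K, -, hK⟩ := hc.exists_bound
  induction k with
  | zero =>
    intro x t ht
    have h1 : ∫ ω, disc x (ω.1 t.toNNReal) ∂(Q p) ≤ 1 :=
      (le_abs_self _).trans (abs_integral_le_of_forall (Q p) fun ω => abs_disc_le x (ω.1 t.toNNReal))
    have h2 : Real.exp (rateEps c * t) ≤ Real.exp (l * t) :=
      Real.exp_le_exp.2 (mul_le_mul_of_nonneg_right hle ht)
    have h3 := Real.exp_pos (rateM c * t)
    have h4 := Real.exp_pos (rateEps c * t)
    rw [pow_zero, one_mul]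
    nlinarith
  | succ k ih =>
    intro x t ht
    set u : ℝ → ℝ := fun τ => ∫ ω in Set.univ, disc x (ω.1 τ.toNNReal) ∂(Q p) with hu
    have hexp : ∀ (a τ : ℝ), HasDerivAt (fun τ => Real.exp (a * τ)) (a * Real.exp (a * τ)) τ := by
      intro a τ
      simpa [mul_comm] using ((hasDerivAt_id τ).const_mul a).exp
    have hcont : ContinuousOn u (Icc ((0 : ℝ≥0) : ℝ) t) :=
      (hQ.hasGeneratorAt_disc x).continuousOn hQ.feller (measurable_disc x) (abs_disc_le x)
        (abs_basicCouplingGen_disc_le hc hK x) p (s := 0) MeasurableSet.univ t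
    have hder : ∀ τ ∈ Ico (0 : ℝ) t, HasDerivWithinAt u
        (∫ ω in Set.univ, basicCouplingGen c (disc x) (ω.1 τ.toNNReal) ∂(Q p)) (Ici τ) τ :=
      fun τ hτ => (hQ.hasGeneratorAt_disc x).hasDerivWithinAt hQ.feller (measurable_disc x)
        (abs_disc_le x) (measurable_basicCouplingGen_disc hc x)
        (abs_basicCouplingGen_disc_le hc hK x) p (s := 0) MeasurableSet.univ (by simpa using hτ.1)
    -- If all sites satisfy the bound with exponent `k`, the derivative of `exp (ε τ) * u τ` is at
    -- most `M` times that bound. Since `M * (M / l) ^ k = l * (M / l) ^ (k + 1)`, this equals the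
    -- derivative of the bound with exponent `k + 1`. The iteration avoids differentiating a
    -- supremum over sites.
    have hmain := image_le_of_deriv_right_le_deriv_boundary
      (f := fun τ => Real.exp (rateEps c * τ) * u τ)
      (f' := fun τ => rateEps c * Real.exp (rateEps c * τ) * u τ + Real.exp (rateEps c * τ) *
        ∫ ω in Set.univ, basicCouplingGen c (disc x) (ω.1 τ.toNNReal) ∂(Q p))
      (B := fun τ => Real.exp (rateM c * τ) + (rateM c / l) ^ (k + 1) * Real.exp (l * τ))
      (B' := fun τ => rateM c * Real.exp (rateM c * τ) +
        (rateM c / l) ^ (k + 1) * (l * Real.exp (l * τ))) (a := 0) (b := t)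
      (ContinuousOn.mul (by fun_prop) (by simpa using hcont))
      (fun τ hτ => (hexp _ τ).hasDerivWithinAt.mul (hder τ hτ)) ?_ (by fun_prop)
      (fun τ _ => ((hexp _ τ).add ((hexp l τ).const_mul _)).hasDerivWithinAt) ?_
    · have := hmain ⟨ht, le_rfl⟩
      simpa [hu] using this
    · have h1 : u 0 ≤ 1 := (le_abs_self _).trans
        (abs_setIntegral_eval_le hQ.feller p _ _ (abs_disc_le x))
      have h2 : 0 ≤ (rateM c / l) ^ (k + 1) := pow_nonneg (div_nonneg (rateM_nonneg c) hl.le) _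
      simp only [mul_zero, Real.exp_zero]
      linarith
    · intro τ hτ
      have hE := Real.exp_pos (rateEps c * τ)
      have h1 := hQ.setIntegral_gen_le hc p Set.univ τ.toNNReal x
        (m := (Real.exp (rateM c * τ) + (rateM c / l) ^ k * Real.exp (l * τ)) /
          Real.exp (rateEps c * τ)) fun y => by
        rw [le_div_iff₀ hE, mul_comm, setIntegral_univ]
        exact ih y τ hτ.1
      have h2 := mul_le_mul_of_nonneg_left h1 hE.le
      have h3 : Real.exp (rateEps c * τ) * (rateM c *
          ((Real.exp (rateM c * τ) + (rateM c / l) ^ k * Real.exp (l * τ)) /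
            Real.exp (rateEps c * τ))) =
          rateM c * Real.exp (rateM c * τ) + (rateM c / l) ^ (k + 1) * (l * Real.exp (l * τ)) := by
        rw [pow_succ]
        field_simp
      rw [mul_sub, h3] at h2
      simp only [hu]
      linarith

/-- Exponential decay of the probability of a discrepancy. -/
lemma IsBasicCoupling.integral_disc_le (hc : IsSpinFlipRate c) (hQ : IsBasicCoupling c Q)
    (p : Config × Config) (x : ℤ) (t : ℝ≥0) :
    ∫ ω, disc x (ω.1 t) ∂(Q p) ≤ Real.exp (-(rateEps c - rateM c) * t) := by
  -- `l ≥ ε` makes the initial bound trivial, and `l > M` sends `(M / l) ^ k` to 0.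
  set l := rateM c + |rateEps c| + 1 with hl
  have hM := rateM_nonneg c
  have hl0 : 0 < l := by positivity
  have hle : rateEps c ≤ l := by linarith [le_abs_self (rateEps c)]
  have hq : rateM c / l < 1 := (div_lt_one hl0).2 (by linarith [abs_nonneg (rateEps c)])
  have hlim : Tendsto (fun k : ℕ => Real.exp (rateM c * t) + (rateM c / l) ^ k * Real.exp (l * t))
      atTop (𝓝 (Real.exp (rateM c * t))) := by
    have := ((tendsto_pow_atTop_nhds_zero_of_lt_one (div_nonneg hM hl0.le) hq).mul_const
      (Real.exp (l * t))).const_add (Real.exp (rateM c * t))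
    simpa using this
  have h := ge_of_tendsto' hlim fun k => by
    simpa using hQ.exp_mul_integral_disc_le hc p hl0 hle k x t t.2
  have e : Real.exp (-(rateEps c - rateM c) * t) =
      Real.exp (rateM c * t) / Real.exp (rateEps c * t) := by
    rw [← Real.exp_sub]
    congr 1
    ring
  rw [e, le_div_iff₀ (Real.exp_pos _), mul_comm]
  exact h

lemma integral_disc_eq (p : Config × Config) (x : ℤ) (t : ℝ≥0)
    (B : Set (CadlagPath (Config × Config))) :
    ∫ ω in B, disc x (ω.1 t) ∂(Q p) = (Q p).real ({ω | (ω.1 t).1 x ≠ (ω.1 t).2 x} ∩ B) := by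
  have hS : MeasurableSet {ω : CadlagPath (Config × Config) | (ω.1 t).1 x ≠ (ω.1 t).2 x} :=
    measurable_eval t (measurableSet_disc x)
  rw [← measureReal_restrict_apply hS, ← integral_indicator_one hS]
  refine integral_congr_ae (Eventually.of_forall fun ω => ?_)
  by_cases h : (ω.1 t).1 x = (ω.1 t).2 x <;> simp [disc, h]

lemma IsBasicCoupling.measure_disc_le (hc : IsSpinFlipRate c) (hQ : IsBasicCoupling c Q)
    (p : Config × Config) (x : ℤ) (t : ℝ≥0) :
    Q p {ω | (ω.1 t).1 x ≠ (ω.1 t).2 x} ≤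
      ENNReal.ofReal (Real.exp (-(rateEps c - rateM c) * t)) := by
  have := hQ.feller.prob p
  rw [← ofReal_measureReal]
  refine ENNReal.ofReal_le_ofReal ?_
  have h := integral_disc_eq (Q := Q) p x t Set.univ
  rw [setIntegral_univ, inter_univ] at h
  rw [← h]
  exact hQ.integral_disc_le hc p x t

/-- The probability that a discrepancy is absent at time `s` and present at time `s + h`. -/
lemma IsBasicCoupling.measure_agree_disc_le (hc : IsSpinFlipRate c) (hQ : IsBasicCoupling c Q)
    (hlt : rateM c < rateEps c) (p : Config × Config) (x : ℤ) (s h : ℝ≥0) :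
    (Q p).real ({ω | (ω.1 (s + h)).1 x ≠ (ω.1 (s + h)).2 x} ∩ {ω | (ω.1 s).1 x = (ω.1 s).2 x}) ≤
      rateM c / (rateEps c - rateM c) * (Real.exp (-(rateEps c - rateM c) * s) -
        Real.exp (-(rateEps c - rateM c) * (s + h : ℝ≥0))) := by
  have := hQ.feller.prob p
  obtain ⟨K, -, hK⟩ := hc.exists_bound
  set d := rateEps c - rateM c with hd
  have hd0 : 0 < d := sub_pos.2 hlt
  have hM := rateM_nonneg c
  set B : Set (CadlagPath (Config × Config)) := {ω | (ω.1 s).1 x = (ω.1 s).2 x} with hB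
  have hBm : MeasurableSet[pastSigma (Config × Config) s] B :=
    measurableSet_pastSigma_eval (C := {q : Config × Config | q.1 x = q.2 x}) le_rfl
      (measurableSet_eq_fun ((measurable_pi_apply x).comp measurable_fst)
        ((measurable_pi_apply x).comp measurable_snd))
  set u : ℝ → ℝ := fun τ => ∫ ω in B, disc x (ω.1 τ.toNNReal) ∂(Q p) with hu
  have hexp : ∀ (a τ : ℝ), HasDerivAt (fun τ => Real.exp (a * τ)) (a * Real.exp (a * τ)) τ := by
    intro a τ
    simpa [mul_comm] using ((hasDerivAt_id τ).const_mul a).exp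
  have hcont : ContinuousOn u (Icc (s : ℝ) (s + h : ℝ≥0)) :=
    (hQ.hasGeneratorAt_disc x).continuousOn hQ.feller (measurable_disc x) (abs_disc_le x)
      (abs_basicCouplingGen_disc_le hc hK x) p hBm _
  have hder : ∀ τ ∈ Ico (s : ℝ) (s + h : ℝ≥0), HasDerivWithinAt u
      (∫ ω in B, basicCouplingGen c (disc x) (ω.1 τ.toNNReal) ∂(Q p)) (Ici τ) τ :=
    fun τ hτ => (hQ.hasGeneratorAt_disc x).hasDerivWithinAt hQ.feller (measurable_disc x)
      (abs_disc_le x) (measurable_basicCouplingGen_disc hc x)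
      (abs_basicCouplingGen_disc_le hc hK x) p hBm hτ.1
  -- On `B` there is no discrepancy at `x` at time `s`. Dropping the loss term leaves creation at
  -- rate at most `M * exp (-d τ)`, whose integral from `s` is the comparison function.
  have hmain := image_le_of_deriv_right_le_deriv_boundary hcont hder
    (B := fun τ => rateM c / d * (Real.exp (-d * s) - Real.exp (-d * τ)))
    (B' := fun τ => rateM c / d * (0 - -d * Real.exp (-d * τ))) ?_ (by fun_prop)
    (fun τ _ => (((hasDerivAt_const τ _).sub (hexp (-d) τ)).const_mul _).hasDerivWithinAt) ?_
  · have h1 := hmain ⟨by simp, le_rfl⟩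
    simp only [hu, Real.toNNReal_coe] at h1
    rwa [integral_disc_eq] at h1
  · simp only [hu, Real.toNNReal_coe, sub_self, mul_zero]
    rw [integral_disc_eq]
    have : {ω : CadlagPath (Config × Config) | (ω.1 s).1 x ≠ (ω.1 s).2 x} ∩ B = ∅ := by
      ext ω
      simp [hB]
    simp [this]
  · intro τ hτ
    have hτ0 : 0 ≤ τ := s.2.trans hτ.1
    have h1 := hQ.setIntegral_gen_le hc p B τ.toNNReal x (m := Real.exp (-d * τ)) fun y => by
      calc ∫ ω in B, disc y (ω.1 τ.toNNReal) ∂(Q p) ≤ ∫ ω, disc y (ω.1 τ.toNNReal) ∂(Q p) :=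
            setIntegral_le_integral (integrable_eval hQ.feller p _ (measurable_disc y)
              (abs_disc_le y)) (Eventually.of_forall fun ω => disc_nonneg y _)
        _ ≤ _ := by
            have := hQ.integral_disc_le hc p y τ.toNNReal
            rwa [Real.coe_toNNReal _ hτ0] at this
    have h2 : 0 ≤ rateEps c * ∫ ω in B, disc x (ω.1 τ.toNNReal) ∂(Q p) :=
      mul_nonneg (hM.trans hlt.le) (integral_nonneg fun ω => disc_nonneg x _)
    have h3 : rateM c / d * (0 - -d * Real.exp (-d * τ)) = rateM c * Real.exp (-d * τ) := by
      field_simp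
      ring
    rw [h3]
    linarith

/-- Exponential decay of `ρ`. -/
lemma IsBasicCoupling.rhoDisagree_le (hc : IsSpinFlipRate c) (hQ : IsBasicCoupling c Q)
    (hlt : rateM c < rateEps c) (t : ℝ≥0) :
    rhoDisagree Q t ≤ ENNReal.ofReal (rateEps c / (rateEps c - rateM c) *
      Real.exp (-(rateEps c - rateM c) * t)) := by
  refine iSup_le fun p => ?_
  have := hQ.feller.prob p
  set d := rateEps c - rateM c with hd
  have hd0 : 0 < d := sub_pos.2 hlt
  have hM := rateM_nonneg c
  -- Disagreements are sought on dyadic meshes, which are countable and nested, so the events `D n`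
  -- increase.
  set time : ℕ → ℕ → ℝ≥0 := fun n i => t + i * (1 / 2) ^ n with htime
  set D : ℕ → Set (CadlagPath (Config × Config)) := fun n =>
    {ω | ∃ i : ℕ, (ω.1 (time n i)).1 0 ≠ (ω.1 (time n i)).2 0} with hD
  have hmono : Monotone D := by
    refine monotone_nat_of_le_succ fun n ω => ?_
    rintro ⟨i, hi⟩
    refine ⟨2 * i, ?_⟩
    have e : time (n + 1) (2 * i) = time n i := by
      simp only [htime, pow_succ]
      push_cast
      ring
    rwa [e]
  have hsub : {ω : CadlagPath (Config × Config) | ∃ s, t ≤ s ∧ (ω.1 s).1 0 ≠ (ω.1 s).2 0} ⊆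
      ⋃ n, D n := by
    rintro ω ⟨s, hts, hs⟩
    -- Disagreement at the origin is an open condition and paths are right-continuous, so it
    -- persists on some `[s, v)`, which a fine enough mesh must hit.
    have hopen : IsOpen {q : Config × Config | q.1 0 ≠ q.2 0} := by
      have h1 : Continuous fun q : Config × Config => q.1 0 := by fun_prop
      have h2 : Continuous fun q : Config × Config => q.2 0 := by fun_prop
      exact (isClosed_eq h1 h2).isOpen_compl
    have hev := (ω.2 s).1 (hopen.mem_nhds hs)
    obtain ⟨v, hv, hsubv⟩ := mem_nhdsGE_iff_exists_Ico_subset.1 hev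
    have hsv : s < v := hv
    obtain ⟨n, hn⟩ := exists_pow_lt_of_lt_one (tsub_pos_of_lt hsv) (y := (1 / 2 : ℝ≥0)) (by
      rw [← NNReal.coe_lt_coe]; norm_num)
    have hpow : (0 : ℝ≥0) < (1 / 2) ^ n := by positivity
    refine mem_iUnion.2 ⟨n, ⌈(s - t) / (1 / 2) ^ n⌉₊, ?_⟩
    apply hsubv
    have hc1 := Nat.le_ceil ((s - t) / (1 / 2) ^ n)
    have hc2 := Nat.ceil_lt_add_one (a := (s - t) / (1 / 2) ^ n) zero_le
    rw [div_le_iff₀ hpow] at hc1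
    have hc3 : (⌈(s - t) / (1 / 2) ^ n⌉₊ : ℝ≥0) * (1 / 2) ^ n < s - t + (1 / 2) ^ n := by
      calc _ < ((s - t) / (1 / 2) ^ n + 1) * (1 / 2) ^ n := mul_lt_mul_of_pos_right hc2 hpow
        _ = _ := by rw [add_mul, div_mul_cancel₀ _ hpow.ne', one_mul]
    constructor
    · calc s = t + (s - t) := (add_tsub_cancel_of_le hts).symm
        _ ≤ _ := by simp only [htime]; gcongr
    · calc time n ⌈(s - t) / (1 / 2) ^ n⌉₊ < t + (s - t + (1 / 2) ^ n) := by
            simp only [htime]; gcongr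
        _ = s + (1 / 2) ^ n := by rw [← add_assoc, add_tsub_cancel_of_le hts]
        _ < s + (v - s) := by gcongr
        _ = v := add_tsub_cancel_of_le hsv.le
  set g : ℕ → ℕ → ℝ := fun n i => Real.exp (-d * (time n i : ℝ≥0)) with hg
  have hstep : ∀ n, Q p (D n) ≤ ENNReal.ofReal (rateEps c / d * Real.exp (-d * t)) := by
    intro n
    -- A disagreement on the mesh is present at `t` or is seen to appear in some mesh interval. The
    -- bounds for the latter telescope, so the total does not depend on the mesh.
    set J : ℕ → Set (CadlagPath (Config × Config)) := fun i =>
      {ω | (ω.1 (time n (i + 1))).1 0 ≠ (ω.1 (time n (i + 1))).2 0} ∩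
        {ω | (ω.1 (time n i)).1 0 = (ω.1 (time n i)).2 0} with hJ
    have hcover : D n ⊆ {ω | (ω.1 t).1 0 ≠ (ω.1 t).2 0} ∪ ⋃ i, J i := by
      rintro ω ⟨i, hi⟩
      induction i with
      | zero =>
        left
        have e : time n 0 = t := by simp [htime]
        rwa [e] at hi
      | succ i ih =>
        by_cases hag : (ω.1 (time n i)).1 0 = (ω.1 (time n i)).2 0
        · exact Or.inr (mem_iUnion.2 ⟨i, hi, hag⟩)
        · exact ih hag
    have hJle : ∀ i, Q p (J i) ≤ ENNReal.ofReal (rateM c / d * (g n i - g n (i + 1))) := by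
      intro i
      rw [← ofReal_measureReal]
      refine ENNReal.ofReal_le_ofReal ?_
      have e : time n (i + 1) = time n i + (1 / 2) ^ n := by
        simp only [htime]
        push_cast
        ring
      have := hQ.measure_agree_disc_le hc hlt p 0 (time n i) ((1 / 2) ^ n)
      rwa [← e] at this
    have hganti : ∀ i, g n (i + 1) ≤ g n i := by
      intro i
      refine Real.exp_le_exp.2 ?_
      have : (time n i : ℝ) ≤ time n (i + 1) := by
        refine NNReal.coe_le_coe.2 ?_
        simp only [htime]
        gcongr
        simp
      nlinarith
    have hsum : ∑' i, ENNReal.ofReal (rateM c / d * (g n i - g n (i + 1))) ≤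
        ENNReal.ofReal (rateM c / d * Real.exp (-d * t)) := by
      refine ENNReal.tsum_le_of_sum_range_le fun N => ?_
      rw [← ENNReal.ofReal_sum_of_nonneg fun i _ =>
        mul_nonneg (div_nonneg hM hd0.le) (sub_nonneg.2 (hganti i)), ← Finset.mul_sum,
        Finset.sum_range_sub']
      refine ENNReal.ofReal_le_ofReal (mul_le_mul_of_nonneg_left ?_ (div_nonneg hM hd0.le))
      have e : g n 0 = Real.exp (-d * t) := by simp [hg, htime]
      have := Real.exp_pos (-d * (time n N : ℝ≥0))
      simp only [hg] at e ⊢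
      linarith
    calc Q p (D n) ≤ Q p {ω | (ω.1 t).1 0 ≠ (ω.1 t).2 0} + Q p (⋃ i, J i) :=
          (measure_mono hcover).trans (measure_union_le _ _)
      _ ≤ ENNReal.ofReal (Real.exp (-d * t)) +
            ENNReal.ofReal (rateM c / d * Real.exp (-d * t)) :=
          add_le_add (hQ.measure_disc_le hc p 0 t) ((measure_iUnion_le _).trans
            ((ENNReal.tsum_le_tsum hJle).trans hsum))
      -- This is `1 + M / d = ε / d` for `d = ε - M`.
      _ = ENNReal.ofReal (rateEps c / d * Real.exp (-d * t)) := by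
          rw [← ENNReal.ofReal_add (Real.exp_pos _).le
            (mul_nonneg (div_nonneg hM hd0.le) (Real.exp_pos _).le)]
          congr 1
          have : rateEps c = d + rateM c := by rw [hd]; ring
          rw [this]
          field_simp
  calc Q p {ω | ∃ s, t ≤ s ∧ (ω.1 s).1 0 ≠ (ω.1 s).2 0} ≤ Q p (⋃ n, D n) := measure_mono hsub
    _ = ⨆ n, Q p (D n) := hmono.measure_iUnion
    _ ≤ _ := iSup_le hstep

end Discrepancy

/-! ### Cone-mixing from the contraction of oscillations -/

section ConeMixing

/-- All spins of a path. -/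
def spins (ω : CadlagPath Config) (u : ℤ × ℝ≥0) : Bool := ω.1 u.2 u.1

lemma measurable_spins : Measurable spins :=
  measurable_pi_lambda _ fun u => (measurable_pi_apply u.1).comp (measurable_eval u.2)

/-- The weights of the sites of `T`, discounted at rate `d` before the times `τ`. -/
noncomputable def discounted (β : ℤ → ℝ) (T : Finset ℤ) (τ : ℤ → ℝ≥0) (d : ℝ) (s : ℝ≥0) (u : ℤ) :
    ℝ :=
  ∑ x ∈ T, Real.exp (-d * (τ x - s : ℝ≥0)) * β (u - x)

variable {β : ℤ → ℝ}

lemma discounted_nonneg (hβ0 : ∀ u, 0 ≤ β u) (T : Finset ℤ) (τ : ℤ → ℝ≥0) (d : ℝ) (s : ℝ≥0)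
    (u : ℤ) : 0 ≤ discounted β T τ d s u :=
  Finset.sum_nonneg fun _ _ => mul_nonneg (Real.exp_pos _).le (hβ0 _)

lemma summable_discounted (hβ : Summable β) (T : Finset ℤ) (τ : ℤ → ℝ≥0) (d : ℝ) (s : ℝ≥0) :
    Summable (discounted β T τ d s) :=
  summable_sum fun x _ => (hβ.comp_injective (sub_left_injective (b := x))).mul_left _

lemma one_le_discounted (hβ0 : ∀ u, 0 ≤ β u) (hβ1 : 1 ≤ β 0) {T : Finset ℤ} {τ : ℤ → ℝ≥0} (d : ℝ)
    {s : ℝ≥0} {u : ℤ} (hu : u ∈ T) (hs : τ u ≤ s) : 1 ≤ discounted β T τ d s u := by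
  have h := Finset.single_le_sum (f := fun x => Real.exp (-d * (τ x - s : ℝ≥0)) * β (u - x))
    (fun _ _ => mul_nonneg (Real.exp_pos _).le (hβ0 _)) hu
  refine le_trans ?_ h
  simpa [tsub_eq_zero_of_le hs] using hβ1

/-- A lapse of `h` shortens each remaining time `τ x - s`, truncated at 0, by at most `h`; the
factor `exp (-d * h)` earned by the semigroup makes up for this. -/
lemma exp_mul_discounted_le (hβ0 : ∀ u, 0 ≤ β u) (T : Finset ℤ) (τ : ℤ → ℝ≥0) {d : ℝ} (hd : 0 ≤ d)
    (s h : ℝ≥0) (u : ℤ) :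
    Real.exp (-d * h) * discounted β T τ d (s + h) u ≤ discounted β T τ d s u := by
  rw [discounted, Finset.mul_sum]
  refine Finset.sum_le_sum fun x _ => ?_
  rw [← mul_assoc, ← Real.exp_add]
  refine mul_le_mul_of_nonneg_right (Real.exp_le_exp.2 ?_) (hβ0 _)
  have h1 : τ x - s ≤ h + (τ x - (s + h)) := by
    rw [← tsub_tsub]
    exact le_add_tsub
  have h2 : ((τ x - s : ℝ≥0) : ℝ) ≤ h + (τ x - (s + h) : ℝ≥0) := by exact_mod_cast h1
  nlinarith

variable {c : ℤ → Config → ℝ} {P : Kernel Config (CadlagPath Config)}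

/-- Expectations of functions of finitely many space-time observations have small oscillations in
the initial configuration. -/
theorem IsSpinFlipSystem.oscLe_integral_spins (hc : IsSpinFlipRate c) (hP : IsSpinFlipSystem c P)
    (hβ : Summable β) (hβ0 : ∀ u, 0 ≤ β u) (hβ1 : 1 ≤ β 0) {lam : ℝ} (hlam : lam ≤ rateEps c)
    (hβs : ∀ (Λ : Finset ℤ) u, ∑ x ∈ Λ, influence c (u - x) * β x ≤ lam * β u)
    (T : Finset ℤ) (τ : ℤ → ℝ≥0) (n : ℕ) :
    ∀ (O : Finset (ℤ × ℝ≥0)) (s : ℝ≥0) (g : (ℤ × ℝ≥0 → Bool) → ℝ), O.card = n →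
      DependsOn g (O : Set (ℤ × ℝ≥0)) → (∀ z, g z ∈ Icc (0 : ℝ) 1) →
      (∀ u ∈ O, u.1 ∈ T ∧ τ u.1 ≤ s + u.2) →
      Continuous (fun η => ∫ ω, g (spins ω) ∂(P η)) ∧
      OscLe (fun η => ∫ ω, g (spins ω) ∂(P η)) (discounted β T τ (rateEps c - lam) s) := by
  obtain ⟨K, -, hK⟩ := hc.exists_bound
  have hPr := hP.feller.prob
  have habs : ∀ {g : (ℤ × ℝ≥0 → Bool) → ℝ}, (∀ z, g z ∈ Icc (0 : ℝ) 1) → ∀ z, |g z| ≤ 1 :=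
    fun hg z => by rw [abs_of_nonneg (hg z).1]; exact (hg z).2
  induction n using Nat.strong_induction_on with
  | _ n ih =>
    intro O s g hO hdep hg hOT
    rcases O.eq_empty_or_nonempty with rfl | hne
    · have hconst : ∀ z, g z = g fun _ => false := fun z => hdep (by simp)
      have hV : (fun η => ∫ ω, g (spins ω) ∂(P η)) = fun _ => g fun _ => false := by
        funext η
        have : (fun ω => g (spins ω)) = fun _ => g fun _ => false := funext fun ω => hconst _
        simp [this]
      rw [hV]
      refine ⟨continuous_const, fun u η ζ _ => ?_⟩
      simpa using discounted_nonneg hβ0 T τ _ s u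
    -- Run the dynamics up to the earliest observation time `d`, then treat the rest as a problem
    -- started there, with `s` recording the time already elapsed. Observations now at time 0 are
    -- read off the initial state, so strictly fewer remain.
    obtain ⟨m, hmO, hmin⟩ := O.exists_min_image Prod.snd hne
    set d := m.2 with hd
    set G : (ℤ × ℝ≥0 → Bool) → ℝ := fun z => g fun p => z (p.1, p.2 - d) with hG
    set O₁ := O.image fun p => (p.1, p.2 - d) with hO₁
    set O' := O₁.filter fun p => p.2 ≠ 0 with hO'
    have hGdep : DependsOn G (O₁ : Set (ℤ × ℝ≥0)) := fun z z' h =>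
      hdep fun p hp => h _ (Finset.mem_coe.2 (Finset.mem_image_of_mem _ (Finset.mem_coe.1 hp)))
    have hG01 : ∀ z, G z ∈ Icc (0 : ℝ) 1 := fun z => hg _
    have hshift : ∀ ω, g (spins ω) = G (spins (shiftPath d ω)) := fun ω =>
      hdep fun p hp => by
        have e : d + (p.2 - d) = p.2 := add_tsub_cancel_of_le (hmin p hp)
        simp only [spins, shiftPath, e]
    clear_value G
    -- the observations at time `0` are evaluated at the initial configuration
    set H : Config → (ℤ × ℝ≥0 → Bool) → ℝ := fun ζ z =>
      G fun p => if p.2 = 0 then ζ p.1 else z p with hH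
    have hHdep : ∀ ζ, DependsOn (H ζ) (O' : Set (ℤ × ℝ≥0)) := by
      intro ζ z z' h
      change G (fun p => if p.2 = 0 then ζ p.1 else z p) =
        G fun p => if p.2 = 0 then ζ p.1 else z' p
      refine hGdep fun p hp => ?_
      by_cases hp0 : p.2 = 0
      · simp only [hp0, if_true]
      · simp only [hp0, if_false]
        exact h p (Finset.mem_coe.2 (Finset.mem_filter.2 ⟨hp, hp0⟩))
    have hcard : O'.card < n := by
      refine lt_of_lt_of_le (Finset.card_lt_card (Finset.filter_ssubset.2 ?_))
        (hO ▸ Finset.card_image_le)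
      exact ⟨(m.1, m.2 - d), Finset.mem_image_of_mem _ hmO, by simp [hd]⟩
    have hIH := fun ζ => ih _ hcard O' (s + d) (H ζ) rfl (hHdep ζ)
        (fun z => hG01 fun p => if p.2 = 0 then ζ p.1 else z p) fun u hu => by
      obtain ⟨hu1, -⟩ := Finset.mem_filter.1 hu
      obtain ⟨p, hp, rfl⟩ := Finset.mem_image.1 hu1
      have e : d + (p.2 - d) = p.2 := add_tsub_cancel_of_le (hmin p hp)
      simpa only [add_assoc, e] using hOT p hp
    set W : Config → ℝ := fun ζ => ∫ ω, G (spins ω) ∂(P ζ) with hW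
    have hWH : ∀ ζ, W ζ = ∫ ω, H ζ (spins ω) ∂(P ζ) := by
      intro ζ
      refine integral_congr_ae ?_
      filter_upwards [hP.feller.start ζ] with ω hω
      refine congrArg G (funext fun p => ?_)
      split_ifs with hp
      · simp only [spins, hp, hω]
      · rfl
    have hHcongr : ∀ ζ ζ' : Config, (∀ x, (x, (0 : ℝ≥0)) ∈ O₁ → ζ x = ζ' x) → H ζ = H ζ' := by
      intro ζ ζ' h
      funext z
      change G (fun p => if p.2 = 0 then ζ p.1 else z p) =
        G fun p => if p.2 = 0 then ζ' p.1 else z p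
      refine hGdep fun p hp => ?_
      by_cases hp0 : p.2 = 0
      · simp only [hp0, if_true]
        refine h p.1 ?_
        rw [← hp0]
        exact hp
      · simp only [hp0, if_false]
    have hW01 : ∀ ζ, |W ζ| ≤ 1 ∧ 0 ≤ W ζ := fun ζ =>
      ⟨abs_integral_le_of_forall (P ζ) fun ω => habs hG01 _,
        integral_nonneg fun ω => (hG01 _).1⟩
    have hWcont : Continuous W := by
      rw [continuous_iff_continuousAt]
      intro ζ₀
      refine ((hIH ζ₀).1.continuousAt (x := ζ₀)).congr ?_
      have hev : ∀ᶠ ζ : Config in 𝓝 ζ₀, ∀ p ∈ O₁, ζ p.1 ∈ ({ζ₀ p.1} : Set Bool) := by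
        rw [Filter.eventually_all_finset]
        exact fun p _ => (continuous_apply p.1).continuousAt
          ((isOpen_discrete ({ζ₀ p.1} : Set Bool)).mem_nhds rfl)
      filter_upwards [hev] with ζ hζ
      rw [hWH ζ, hHcongr ζ ζ₀ fun x hx => hζ _ hx]
    have hWosc : OscLe W (discounted β T τ (rateEps c - lam) (s + d)) := by
      intro u η ζ hηζ
      -- If `u` is observed now, its entry time has passed and its weight is at least 1, which
      -- bounds any oscillation of a function with values in [0, 1]. Otherwise the change at `u`
      -- leaves `H` unaltered and the induction hypothesis applies.
      by_cases hu : (u, (0 : ℝ≥0)) ∈ O₁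
      · obtain ⟨p, hp, hpe⟩ := Finset.mem_image.1 hu
        simp only [Prod.mk.injEq] at hpe
        obtain ⟨hp1, hp2⟩ := hpe
        obtain ⟨hT, hτ⟩ := hOT p hp
        have hpd : p.2 = d := le_antisymm (tsub_eq_zero_iff_le.1 hp2) (hmin p hp)
        rw [hp1] at hT hτ
        rw [hpd] at hτ
        refine le_trans ?_ (one_le_discounted hβ0 hβ1 _ hT hτ)
        have h1 := hW01 η
        have h2 := hW01 ζ
        rw [abs_le] at h1 h2 ⊢
        constructor <;> linarith [h1.1.2, h2.1.2, h1.2, h2.2]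
      · have e : H ζ = H η := hHcongr _ _ fun x hx =>
          (hηζ x (by rintro rfl; exact hu hx)).symm
        rw [hWH η, hWH ζ, e]
        exact (hIH η).2 u η ζ hηζ
    have hVW : (fun η => ∫ ω, g (spins ω) ∂(P η)) = transOp P d W := by
      funext η
      simp only [hshift]
      exact hP.feller.integral_shiftPath η d (F := fun ω => G (spins ω))
        ((measurable_of_dependsOn hGdep).comp measurable_spins) (C := 1) fun ω => habs hG01 _
    rw [hVW]
    refine ⟨hP.feller.feller ⟨W, hWcont⟩ d, ?_⟩
    refine (HasJumpRate.oscLe_transOp hP.feller hP.hasJumpRate (hc.isJumpRate hK)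
      hc.continuous_spinJumpRate false (summable_discounted hβ T τ _ _)
      (discounted_nonneg hβ0 T τ _ _) (lam := lam) (fun Λ u => ?_) hWcont hWosc d).mono
      fun u => exp_mul_discounted_le hβ0 T τ (sub_nonneg.2 hlam) s d u
    exact sum_supersolution hβs T (w := fun x => Real.exp (-(rateEps c - lam) *
      (τ x - (s + d) : ℝ≥0))) (fun x => (Real.exp_pos _).le) (Λ.erase u) u

lemma summable_exp_neg_abs {a : ℝ} (ha : 0 < a) :
    Summable fun x : ℤ => Real.exp (-a * |(x : ℝ)|) := by
  have h : Summable fun n : ℕ => Real.exp (n * -a) := Real.summable_exp_nat_mul_iff.2 (by linarith)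
  refine Summable.of_nat_of_neg ?_ ?_
  · simpa [mul_comm] using h
  · simpa [mul_comm] using h

/-- In the regime `M < ε`, events in the cone depend on the initial state exponentially little. -/
theorem IsSpinFlipSystem.exists_exp_bound (hc : IsSpinFlipRate c) (hP : IsSpinFlipSystem c P)
    (hlt : rateM c < rateEps c) {θ : ℝ} (hθ : θ ∈ Ioo 0 (Real.pi / 2)) :
    ∃ C d : ℝ, 0 < d ∧ ∀ (t : ℝ≥0) (B : Set (CadlagPath Config)),
      MeasurableSet[sigmaCone θ t] B → ∀ η η' : Config,
        |(P η).real B - (P η').real B| ≤ C * Real.exp (-d * t) := by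
  -- `lam > M` yields a summable supersolution, while `lam < ε` leaves the positive contraction rate
  -- `d = ε - lam`.
  obtain ⟨lam, hlam1, hlam2⟩ := exists_between hlt
  obtain ⟨β, hβ, hβ0, hβ1, hβs⟩ := exists_supersolution hc.summable_influence (influence_nonneg c)
    (lam := lam) (by rwa [tsum_influence])
  set d := rateEps c - lam with hd
  have hd0 : 0 < d := sub_pos.2 hlam2
  have hcot := cot_pos_of_mem hθ
  have hPr := hP.feller.prob
  have hS := summable_exp_neg_abs (mul_pos hd0 hcot)
  refine ⟨(∑' u, β u) * ∑' x : ℤ, Real.exp (-(d * Real.cot θ) * |(x : ℝ)|), d, hd0,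
    fun t B hB η η' => ?_⟩
  set C := (∑' u, β u) * ∑' x : ℤ, Real.exp (-(d * Real.cot θ) * |(x : ℝ)|) with hC
  rw [sigmaCone_eq_comap] at hB
  obtain ⟨S, hSm, rfl⟩ := hB
  have hcyl : ∀ S ∈ measurableCylinders fun _ : spaceTimeCone θ t => Bool,
      |(P η).real (coneSpins θ t ⁻¹' S) - (P η').real (coneSpins θ t ⁻¹' S)| ≤
        C * Real.exp (-d * t) := by
    intro S hS'
    have hSm := MeasurableSet.of_mem_measurableCylinders hS'
    obtain ⟨I, S₀, hS₀, rfl⟩ := (mem_measurableCylinders _).1 hS'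
    classical
    set g : (ℤ × ℝ≥0 → Bool) → ℝ := fun z => if (fun i : I => z i.1.1) ∈ S₀ then 1 else 0 with hg
    set O : Finset (ℤ × ℝ≥0) := I.image Subtype.val with hO
    have hdep : DependsOn g (O : Set (ℤ × ℝ≥0)) := by
      intro z z' h
      have e : (fun i : I => z i.1.1) = fun i : I => z' i.1.1 :=
        funext fun i => h _ (Finset.mem_coe.2 (Finset.mem_image_of_mem _ i.2))
      simp only [hg, e]
    set T : Finset ℤ := O.image Prod.fst with hT
    obtain ⟨h1, h2⟩ := hP.oscLe_integral_spins hc hβ hβ0 hβ1 hlam2.le hβs T (entryTime θ t) O.card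
      O 0 g rfl hdep (fun z => by simp only [hg]; split_ifs <;> simp) fun u hu => by
        refine ⟨Finset.mem_image_of_mem _ hu, ?_⟩
        obtain ⟨v, -, rfl⟩ := Finset.mem_image.1 hu
        simpa using entryTime_le hθ v.2
    have hV : ∀ ξ, (P ξ).real (coneSpins θ t ⁻¹' cylinder I S₀) = ∫ ω, g (spins ω) ∂(P ξ) := by
      intro ξ
      rw [← integral_indicator_one (measurable_coneSpins θ t hSm)]
      refine integral_congr_ae (Eventually.of_forall fun ω => ?_)
      have hiff : ω ∈ coneSpins θ t ⁻¹' cylinder I S₀ ↔ (fun i : I => spins ω i.1.1) ∈ S₀ := Iff.rfl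
      by_cases hω : (fun i : I => spins ω i.1.1) ∈ S₀
      · simp only [hg, if_pos hω, indicator_of_mem (hiff.2 hω), Pi.one_apply]
      · simp only [hg, if_neg hω, indicator_of_notMem (mt hiff.1 hω)]
    rw [hV, hV]
    have hs := summable_discounted hβ T (entryTime θ t) d 0
    have h0 := discounted_nonneg hβ0 T (entryTime θ t) d 0
    have hshift : ∀ x : ℤ, ∑' u, β (u - x) = ∑' u, β u := fun x => (Equiv.subRight x).tsum_eq β
    have hw : ∀ x, Real.exp (-d * (entryTime θ t x - 0 : ℝ≥0)) =
        Real.exp (-d * t) * Real.exp (-(d * Real.cot θ) * |(x : ℝ)|) := fun x => by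
      rw [tsub_zero, entryTime, NNReal.coe_add, Real.coe_toNNReal _ (by positivity),
        ← Real.exp_add]
      congr 1
      ring
    calc _ ≤ ∑' y, if η y ≠ η' y then discounted β T (entryTime θ t) d 0 y else 0 :=
          h2.abs_sub_le_tsum h1 hs h0 η η'
      _ ≤ ∑' y, discounted β T (entryTime θ t) d 0 y := by
          refine Summable.tsum_le_tsum (fun y => ?_) (Summable.of_nonneg_of_le (fun y => ?_)
            (fun y => ?_) hs) hs <;> split_ifs <;> simp [h0]
      _ = ∑ x ∈ T, Real.exp (-d * (entryTime θ t x - 0 : ℝ≥0)) * ∑' u, β u := by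
          simp only [discounted]
          have hsum : ∀ x ∈ T, Summable fun y =>
              Real.exp (-d * (entryTime θ t x - 0 : ℝ≥0)) * β (y - x) := fun x _ =>
            Summable.mul_left _ (hβ.comp_injective (sub_left_injective (b := x)))
          rw [Summable.tsum_finsetSum hsum]
          exact Finset.sum_congr rfl fun x _ => by rw [tsum_mul_left, hshift]
      _ = Real.exp (-d * t) * (∑' u, β u) *
            ∑ x ∈ T, Real.exp (-(d * Real.cot θ) * |(x : ℝ)|) := by
          rw [Finset.mul_sum]
          exact Finset.sum_congr rfl fun x _ => by rw [hw]; ring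
      _ ≤ Real.exp (-d * t) * (∑' u, β u) *
            ∑' x : ℤ, Real.exp (-(d * Real.cot θ) * |(x : ℝ)|) :=
          mul_le_mul_of_nonneg_left (hS.sum_le_tsum T fun x _ => (Real.exp_pos _).le)
            (mul_nonneg (Real.exp_pos _).le (tsum_nonneg hβ0))
      _ = C * Real.exp (-d * t) := by rw [hC]; ring
  refine le_of_forall_pos_le_add fun δ hδ => ?_
  have hm := measurable_coneSpins θ t
  -- Approximating in the sum of the two laws gives one cylinder event close to the given event
  -- under both. The cylinder bound has a constant that does not depend on the cylinder, so it
  -- passes to the limit.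
  set ν := (P η + P η').map (coneSpins θ t) with hν
  have hdense := Measure.MeasureDense.of_generateFrom_isSetAlgebra_finite (μ := ν)
    (isSetAlgebra_measurableCylinders (α := fun _ : spaceTimeCone θ t => Bool))
    generateFrom_measurableCylinders.symm
  obtain ⟨S', hS', hlt'⟩ := hdense.approx S hSm (measure_ne_top _ _) (δ / 2) (half_pos hδ)
  have hSm' := MeasurableSet.of_mem_measurableCylinders hS'
  have hclose : ∀ ξ, P ξ ≤ P η + P η' → |(P ξ).real (coneSpins θ t ⁻¹' S) -
      (P ξ).real (coneSpins θ t ⁻¹' S')| ≤ δ / 2 := by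
    intro ξ hξ
    refine (abs_measureReal_sub_le_measureReal_symmDiff (hm hSm).nullMeasurableSet
      (hm hSm').nullMeasurableSet).trans ?_
    rw [measureReal_def]
    refine ENNReal.toReal_le_of_le_ofReal (half_pos hδ).le ?_
    calc P ξ (symmDiff (coneSpins θ t ⁻¹' S) (coneSpins θ t ⁻¹' S'))
        ≤ (P η + P η') (coneSpins θ t ⁻¹' symmDiff S S') := hξ _
      _ = ν (symmDiff S S') := (Measure.map_apply hm (hSm.symmDiff hSm')).symm
      _ ≤ ENNReal.ofReal (δ / 2) := hlt'.le
  have h1 := hclose η (Measure.le_add_right le_rfl)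
  have h2 := hclose η' (Measure.le_add_left le_rfl)
  have h3 := hcyl S' hS'
  rw [abs_le] at h1 h2 h3 ⊢
  constructor <;> linarith [h1.1, h1.2, h2.1, h2.2, h3.1, h3.2]

lemma IsSpinFlipSystem.isConeMixing (hc : IsSpinFlipRate c) (hP : IsSpinFlipSystem c P)
    (hlt : rateM c < rateEps c) (μ : Measure Config) [IsProbabilityMeasure μ] :
    IsConeMixing (P ∘ₘ μ) := by
  intro θ hθ
  obtain ⟨C, d, hd, h⟩ := hP.exists_exp_bound hc hlt hθ
  have hlim : Tendsto (fun t : ℝ≥0 => ENNReal.ofReal (C * Real.exp (-d * t))) atTop (𝓝 0) := by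
    have h1 : Tendsto (fun t : ℝ≥0 => Real.exp (-d * t)) atTop (𝓝 0) := by
      refine Real.tendsto_exp_atBot.comp ?_
      exact (NNReal.tendsto_coe_atTop.2 tendsto_id).const_mul_atTop_of_neg (by linarith)
    simpa using ENNReal.tendsto_ofReal (h1.const_mul C)
  refine tendsto_of_tendsto_of_tendsto_of_le_of_le tendsto_const_nhds hlim
    (fun _ => zero_le) fun t => ?_
  exact coneMixingCoeff_le hP.feller μ fun B hB η η' => ENNReal.ofReal_le_ofReal (h t B hB η η')

end ConeMixing

/-! ### Assembly of the four statements -/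

theorem mainTheorem6 (c : ℤ → Config → ℝ) (hc : IsSpinFlipRate c)
    (P : Kernel Config (CadlagPath Config)) (hP : IsSpinFlipSystem c P) :
    (∀ Q : Kernel (Config × Config) (CadlagPath (Config × Config)), IsBasicCoupling c Q →
      -- the bounds by `ρ(t) + (2/c) ∫₀^∞ ρ(t+v) dv`, with `c = cot θ`
      (∀ θ ∈ Ioo 0 (Real.pi / 2), ∀ t : ℝ≥0,
        (∀ B, MeasurableSet[sigmaCone θ t] B → ∀ η η' : Config,
          ENNReal.ofReal |(P η).real B - (P η').real B| ≤
            rhoDisagree Q t + ENNReal.ofReal (2 / Real.cot θ) *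
              ∫⁻ v in Ioi (0 : ℝ), rhoDisagree Q (t + v.toNNReal)) ∧
        (∀ μ : Measure Config, IsProbabilityMeasure μ →
          coneMixingCoeff (P ∘ₘ μ) θ t ≤
            rhoDisagree Q t + ENNReal.ofReal (2 / Real.cot θ) *
              ∫⁻ v in Ioi (0 : ℝ), rhoDisagree Q (t + v.toNNReal))) ∧
      -- integrability of `ρ` suffices for cone-mixing
      (∫⁻ v in Ioi (0 : ℝ), rhoDisagree Q v.toNNReal < ∞ →
        ∀ μ : Measure Config, IsProbabilityMeasure μ → IsConeMixing (P ∘ₘ μ)) ∧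
      -- exponential decay in the regime `M < ε`
      (rateM c < rateEps c →
        (∀ (η η' : Config) (x : ℤ) (t : ℝ≥0),
          Q (η, η') {ω | (ω.1 t).1 x ≠ (ω.1 t).2 x} ≤
            ENNReal.ofReal (Real.exp (-(rateEps c - rateM c) * t))) ∧
        (∀ t : ℝ≥0, rhoDisagree Q t ≤
          ENNReal.ofReal (rateEps c / (rateEps c - rateM c) *
            Real.exp (-(rateEps c - rateM c) * t))))) ∧
    -- the regime `M < ε` is cone-mixing
    (rateM c < rateEps c →
      ∀ μ : Measure Config, IsProbabilityMeasure μ → IsConeMixing (P ∘ₘ μ)) := by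
  refine ⟨fun Q hQ => ?_, fun hlt μ hμ => hP.isConeMixing hc hlt μ⟩
  have hbound : ∀ θ ∈ Ioo 0 (Real.pi / 2), ∀ t : ℝ≥0,
      ∀ B, MeasurableSet[sigmaCone θ t] B → ∀ η η' : Config,
        ENNReal.ofReal |(P η).real B - (P η').real B| ≤
          rhoDisagree Q t + ENNReal.ofReal (2 / Real.cot θ) *
            ∫⁻ v in Ioi (0 : ℝ), rhoDisagree Q (t + v.toNNReal) :=
    fun θ hθ t B hB η η' => hQ.abs_sub_le hc hP hθ t hB η η'
  have hcoeff : ∀ θ ∈ Ioo 0 (Real.pi / 2), ∀ t : ℝ≥0,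
      ∀ μ : Measure Config, IsProbabilityMeasure μ → coneMixingCoeff (P ∘ₘ μ) θ t ≤
        rhoDisagree Q t + ENNReal.ofReal (2 / Real.cot θ) *
          ∫⁻ v in Ioi (0 : ℝ), rhoDisagree Q (t + v.toNNReal) :=
    fun θ hθ t μ _ => coneMixingCoeff_le hP.feller μ (hbound θ hθ t)
  refine ⟨fun θ hθ t => ⟨hbound θ hθ t, hcoeff θ hθ t⟩, fun hint μ hμ θ hθ => ?_,
    fun hlt => ⟨fun η η' x t => hQ.measure_disc_le hc (η, η') x t,
      fun t => hQ.rhoDisagree_le hc hlt t⟩⟩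
  exact tendsto_of_tendsto_of_tendsto_of_le_of_le tendsto_const_nhds
    (tendsto_rho_bound (rhoDisagree_antitone Q) hint (2 / Real.cot θ))
    (fun _ => zero_le) fun t => hcoeff θ hθ t μ hμ
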